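/- Let $\Bbbk$ be a field of characteristic $0$, $H=\Bbbk[\partial]$, and write $(x_\lambda y)=\sum_{s\ge 0}\frac{\lambda^s}{s!}\,(x_{(s)}y)$, $[x_\lambda y]=\sum_{s\ge 0}\frac{\lambda^s}{s!}\,[x_{(s)}y]$ for the generating functions of the $n$-products of a conformal (super)algebra. Let $K_1=Hv\oplus Hg$ be the Neveu--Schwartz Lie conformal superalgebra ($v$ even, $g$ odd): $$[v_\lambda v]=(\partial+2\lambda)v,\qquad [g_\lambda v]=(\tfrac12\partial+\tfrac32\lambda)g,\qquad [g_\lambda g]=-\tfrac12 v .$$ Let $X=\{v,g\}$, $N(v,v)=3$, $N(v,g)=N(g,v)=N(g,g)=2$, and let $U=U(K_1;X,N)$ be the universal associative conformal envelope of $K_1$ with locality bound $N$ on $X$, i.e. the universal object among the $\mathbb Z_2$-graded associative conformal algebras $C$ with an even $H$-linear map $\varphi:K_1\to C$ that takes the bracket to the conformal supercommutator $[x_\lambda y]=(x_\lambda y)-(-1)^{|x||y|}(y_{-\partial-\lambda}x)$, whose image generates $C$, and such that $(\varphi(x)_{(n)}\varphi(y))=0$ for $x,y\in X$, $n\ge N(x,y)$.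 Such a universal envelope exists. Let $\mathrm{Cend}_2=M_{1|1}(\Bbbk[\partial,x])$ (diagonal matrices even, off-diagonal matrices odd) with $(f(\partial,x)_\lambda h(\partial,x))=f(-\lambda,x)\,h(\partial+\lambda,x+\lambda)$. There is an injective homomorphism $U\to\mathrm{Cend}_2$ of $\mathbb Z_2$-graded conformal algebras with $$v\mapsto\begin{pmatrix}x&0\\0&x-\frac12\partial\end{pmatrix},\qquad g\mapsto\frac12\begin{pmatrix}0&x\\-1&0\end{pmatrix},$$ whose image is the set of matrices $\begin{pmatrix}xf_{11}&xf_{12}\\f_{21}&f_{22}\end{pmatrix}$, $f_{ij}\in\Bbbk[\partial,x]$; identify $U$ with this image. Let $F_nU$ be the $H$-span of the words $(a_1{}_{(n_1)}(a_2{}_{(n_2)}\cdots{}_{(n_{d-1})}a_d)\cdots)$, $a_i\in X$, $0\le n_i<N(a_i,a_{i+1})$, of degree $d\le n$. For $u\in F_nU$, $w\in F_mU$ (homogeneous in parity for the bracket) the products of the classes given by the class of $(u_\lambda w)$ in $F_{n+m}U/F_{n+m-1}U$ and the class of $[u_\lambda w]$ in $F_{n+m-1}U/F_{n+m-2}U$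 are well defined, and they make $PK_1=\bigoplus_{n\ge1}F_nU/F_{n-1}U$ a Poisson conformal superalgebra. Let $PK_{10}$ be its even part, and let $\bar a_n$ ($n\ge1$), $\bar b_m$ ($m\ge2$) be the classes in $F_nU/F_{n-1}U$ and $F_mU/F_{m-1}U$ of $$a_n=\begin{pmatrix}x^n&0\\0&x^n-\frac12\partial x^{n-1}\end{pmatrix}\in F_nU,\qquad b_m=\begin{pmatrix}0&0\\0&x^{m-2}\end{pmatrix}\in F_mU .$$ Then $PK_{10}$ is a free $H$-module with basis $\bar a_n$ ($n\ge1$), $\bar b_m$ ($m\ge2$), and, for all admissible indices, $$\begin{aligned} [\bar a_n{}_\lambda\bar a_m]&=(n\partial+(m+n)\lambda)\,\bar a_{n+m-1}+\tfrac{\lambda^2+\partial\lambda}{4}\big((m+n-2)\lambda+(n-1)\partial\big)\bar b_{n+m-1},\\ [\bar a_n{}_\lambda\bar b_m]&=((n+m-2)\lambda+n\partial)\,\bar b_{n+m-1},\qquad [\bar b_n{}_\lambda\bar b_m]=0,\\ (\bar a_n{}_\lambda\bar a_m)&=\bar a_{n+m}+\tfrac{\lambda^2+\partial\lambda}{4}\,\bar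 b_{n+m},\qquad (\bar a_n{}_\lambda\bar b_m)=\bar b_{n+m},\qquad (\bar b_n{}_\lambda\bar b_m)=0 \end{aligned}$$ (for $n=m=1$ the coefficient of the undefined $\bar b_1$ is $0$). Let $PV_2=H\otimes v\Bbbk[v]$ with $(v^m{}_\lambda v^n)=v^{m+n}$ and $[v^m{}_\lambda v^n]=(m\partial+(m+n)\lambda)v^{m+n-1}$ for $m,n\ge1$. The $H$-linear map $PK_{10}\to PV_2$, $\bar a_n\mapsto v^n$, $\bar b_m\mapsto0$, is a surjective homomorphism of Poisson conformal algebras. Its kernel $K$, the $H$-submodule spanned by the $\bar b_m$, $m\ge2$, satisfies $(K_\lambda K)=[K_\lambda K]=0$, so that $PK_{10}$ is a null (square-zero) extension of $PV_2$ by the conformal module $K$. This extension is not split: no homomorphism of Poisson conformal algebras $PV_2\to PK_{10}$ is a section of it. -/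

import Mathlib

open Polynomial

universe u

noncomputable section

namespace ConfSuper

/-! Throughout, `H = k[∂]` is `Polynomial k`, so `∂ • x` is `(X : k[X]) • x`.
The ring `H[λ]` is `k[X][X]`: the inner variable is `∂`, the outer variable is `λ`. -/

/-- An `H`-module with a pair of `H`-submodules (even part `parity 0`, odd part `parity 1`)
and a family of `k`-bilinear operations `x (n) y = prod n x y`. No axioms are imposed here. -/
structure ConfData (k : Type u) [Field k] where
  carrier : Type u
  [acg : AddCommGroup carrier]
  [modk : Module k carrier]
  [modH : Module k[X] carrier]
  [tower : IsScalarTower k k[X] carrier]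
  parity : ZMod 2 → Submodule k[X] carrier
  prod : ℕ → carrier →ₗ[k] carrier →ₗ[k] carrier

instance {k : Type u} [Field k] : CoeSort (ConfData k) (Type u) := ⟨ConfData.carrier⟩

attribute [instance] ConfData.acg ConfData.modk ConfData.modH ConfData.tower

/-- The Koszul sign `(-1)^{ij}`. -/
def sgn (i j : ZMod 2) : ℤ := (-1) ^ (i.val * j.val)

section Products

variable {k : Type u} [Field k] {M : Type u} [AddCommGroup M] [Module k M] [Module k[X] M]

/-- `{y (n) x} = ∑_{s ≥ 0} (-1)^{n+s} ∂^{(s)} (y (n+s) x)`, the coefficient of `λ^{(n)}` in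
`(y_{-∂-λ} x)`. The sum is finite by locality. -/
def curly (p : ℕ → M →ₗ[k] M →ₗ[k] M) (n : ℕ) (y x : M) : M :=
  ∑ᶠ s : ℕ, ((-1 : k) ^ (n + s) * ((s.factorial : k))⁻¹) • ((X : k[X]) ^ s • p (n + s) y x)

/-- Axioms of a `ℤ/2`-graded conformal algebra: grading, locality, sesquilinearity. -/
structure IsConformal (par : ZMod 2 → Submodule k[X] M)
    (p : ℕ → M →ₗ[k] M →ₗ[k] M) : Prop where
  isCompl : IsCompl (par 0) (par 1)
  mem_parity : ∀ (i j : ZMod 2) (n : ℕ) (x y : M), x ∈ par i → y ∈ par j →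
    p n x y ∈ par (i + j)
  locality : ∀ x y : M, ∃ N : ℕ, ∀ n, N ≤ n → p n x y = 0
  partial_left : ∀ (n : ℕ) (x y : M), p n ((X : k[X]) • x) y = -((n : k) • p (n - 1) x y)
  partial_right : ∀ (n : ℕ) (x y : M),
    p n x ((X : k[X]) • y) = (X : k[X]) • p n x y + (n : k) • p (n - 1) x y

/-- `(x_λ (y_μ z)) = ((x_λ y)_{λ+μ} z)`, written in coefficients at `λ^{(n)} μ^{(m)}`. -/
def IsAssociative (p : ℕ → M →ₗ[k] M →ₗ[k] M) : Prop :=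
  ∀ (n m : ℕ) (x y z : M), p n x (p m y z) =
    ∑ s ∈ Finset.range (n + 1), (n.choose s : k) • p (n + m - s) (p s x y) z

/-- Axioms of a Poisson conformal superalgebra with product `mul` and bracket `br`. -/
structure IsPoisson (par : ZMod 2 → Submodule k[X] M)
    (mul br : ℕ → M →ₗ[k] M →ₗ[k] M) : Prop where
  mul_conformal : IsConformal par mul
  br_conformal : IsConformal par br
  mul_assoc : IsAssociative mul
  mul_comm : ∀ (i j : ZMod 2) (n : ℕ) (x y : M), x ∈ par i → y ∈ par j →
    mul n x y = sgn i j • curly mul n y x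
  br_skew : ∀ (i j : ZMod 2) (n : ℕ) (x y : M), x ∈ par i → y ∈ par j →
    br n x y = -(sgn i j • curly br n y x)
  jacobi : ∀ (i j : ZMod 2) (n m : ℕ) (x y z : M), x ∈ par i → y ∈ par j →
    br n x (br m y z) - sgn i j • br m y (br n x z) =
      ∑ s ∈ Finset.range (n + 1), (n.choose s : k) • br (n + m - s) (br s x y) z
  leibniz : ∀ (i j : ZMod 2) (n m : ℕ) (x y z : M), x ∈ par i → y ∈ par j →
    br n x (mul m y z) =
      ∑ s ∈ Finset.range (n + 1), (n.choose s : k) • mul (n + m - s) (br s x y) z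
        + sgn i j • mul m y (br n x z)

/-- `(x_λ y) = F` in `M[λ]`, where `(x_λ y) = ∑_s λ^s / s! (x (s) y)`. The `H[λ]`-module
`M[λ]` is `PolynomialModule k[X] M`. -/
def LambdaEq (p : ℕ → M →ₗ[k] M →ₗ[k] M) (x y : M) (F : PolynomialModule k[X] M) : Prop :=
  ∀ s : ℕ, p s x y = (s.factorial : k) • F.coeff s

/-- `x ∈ M` as a constant polynomial of `M[λ]`. -/
def cst (k : Type u) [Field k] {M : Type u} [AddCommGroup M] [Module k[X] M] (x : M) :
    PolynomialModule k[X] M :=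
  PolynomialModule.single k[X] 0 x

end Products

/-- The element `∂` of `H[λ]`. -/
def dd (k : Type u) [Field k] : k[X][X] := C X

/-- The element `λ` of `H[λ]`. -/
def ll (k : Type u) [Field k] : k[X][X] := X

section Homs

variable {k : Type u} [Field k]

/-- Homomorphisms: even `H`-linear maps preserving all `n`-products. -/
structure ConfData.Hom (A B : ConfData k) where
  map : A →ₗ[k[X]] B
  map_parity : ∀ (i : ZMod 2) (x : A), x ∈ A.parity i → map x ∈ B.parity i
  map_prod : ∀ (n : ℕ) (x y : A), map (A.prod n x y) = B.prod n (map x) (map y)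

/-- The conformal supercommutator `[x (n) y] = (x (n) y) - (-1)^{ij} {y (n) x}` of `x` of
parity `i` and `y` of parity `j`. -/
def ConfData.comm (A : ConfData k) (i j : ZMod 2) (n : ℕ) (x y : A) : A :=
  A.prod n x y - sgn i j • curly A.prod n y x

/-- `(A, φ)` is an associative conformal envelope of the Lie conformal superalgebra `L`
such that `N_A(φ(x_a), φ(x_b)) ≤ N(a, b)` for the elements `x_a` of `L`. -/
structure IsEnvelope (L : ConfData k) {ι : Type} (x : ι → L) (N : ι → ι → ℕ)
    (A : ConfData k) (φ : L →ₗ[k[X]] A) : Prop where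
  conformal : IsConformal A.parity A.prod
  assoc : IsAssociative A.prod
  map_parity : ∀ (i : ZMod 2) (y : L), y ∈ L.parity i → φ y ∈ A.parity i
  map_bracket : ∀ (i j : ZMod 2) (n : ℕ) (y z : L), y ∈ L.parity i → z ∈ L.parity j →
    φ (L.prod n y z) = A.comm i j n (φ y) (φ z)
  generated : ∀ S : Submodule k[X] A, (∀ y : L, φ y ∈ S) →
    (∀ (n : ℕ) (y z : A), y ∈ S → z ∈ S → A.prod n y z ∈ S) → S = ⊤
  locality : ∀ (a b : ι) (n : ℕ), N a b ≤ n → A.prod n (φ (x a)) (φ (x b)) = 0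

/-- `(U, φ)` is the universal associative conformal envelope `U(L; X, N)`, `X = {x_a}`. -/
structure IsUniversalEnvelope (L : ConfData k) {ι : Type} (x : ι → L) (N : ι → ι → ℕ)
    (U : ConfData k) (φ : L →ₗ[k[X]] U) : Prop where
  envelope : IsEnvelope L x N U φ
  universal : ∀ (A : ConfData k) (ψ : L →ₗ[k[X]] A), IsEnvelope L x N A ψ →
    ∃! f : U.Hom A, ∀ y : L, f.map (φ y) = ψ y

end Homs

section Graded

variable {k : Type u} [Field k] (U : ConfData k) {ι : Type} (x : ι → U) (N : ι → ι → ℕ)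

/-- `IsWord U x N a d w`: `w = a (n₁) (a₂ (n₂) … (n_{d-1}) a_d)`, a right-normed word of
degree `d` in the letters `x`, with first letter `a` and `n_i < N(a_i, a_{i+1})`. -/
inductive IsWord : ι → ℕ → U → Prop
  | letter (a : ι) : IsWord a 1 (x a)
  | cons (a b : ι) (n d : ℕ) (w : U) (hn : n < N a b) (hw : IsWord b d w) :
      IsWord a (d + 1) (U.prod n (x a) w)

/-- `F_d U`: spanned by all `∂^s w`, `w` a word of degree at most `d`. Thus `F_0 U = 0`. -/
def filt (d : ℕ) : Submodule k[X] U :=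
  Submodule.span k[X] {w | ∃ (a : ι) (e : ℕ), e ≤ d ∧ IsWord U x N a e w}

/-- `F_d U / F_{d-1} U` (which is zero for `d = 0`). -/
def GrPiece (d : ℕ) : Type u :=
  (filt U x N d) ⧸ (filt U x N (d - 1)).submoduleOf (filt U x N d)

instance (d : ℕ) : AddCommGroup (GrPiece U x N d) :=
  inferInstanceAs (AddCommGroup (_ ⧸ (filt U x N (d - 1)).submoduleOf (filt U x N d)))

instance (d : ℕ) : Module k (GrPiece U x N d) :=
  inferInstanceAs (Module k (_ ⧸ (filt U x N (d - 1)).submoduleOf (filt U x N d)))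

instance (d : ℕ) : Module k[X] (GrPiece U x N d) :=
  inferInstanceAs (Module k[X] (_ ⧸ (filt U x N (d - 1)).submoduleOf (filt U x N d)))

instance (d : ℕ) : IsScalarTower k k[X] (GrPiece U x N d) :=
  inferInstanceAs (IsScalarTower k k[X] (_ ⧸ (filt U x N (d - 1)).submoduleOf (filt U x N d)))

/-- The class `w + F_{d-1} U` of `w ∈ F_d U`. -/
def GrPiece.mk (d : ℕ) (w : U) (hw : w ∈ filt U x N d) : GrPiece U x N d :=
  Submodule.Quotient.mk (p := (filt U x N (d - 1)).submoduleOf (filt U x N d)) ⟨w, hw⟩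

/-- The associated graded `H`-module `⨁_d F_d U / F_{d-1} U`. -/
abbrev Gr : Type u := DirectSum ℕ (GrPiece U x N)

/-- The class of `w ∈ F_d U` in degree `d`, as an element of `Gr`. -/
def symb (d : ℕ) (w : U) (hw : w ∈ filt U x N d) : Gr U x N :=
  DirectSum.lof k[X] ℕ (GrPiece U x N) d (GrPiece.mk U x N d w hw)

/-- The `ℤ/2`-grading induced on `Gr`. -/
def grParity (i : ZMod 2) : Submodule k[X] (Gr U x N) :=
  Submodule.span k[X] {z | ∃ (d : ℕ) (w : U) (hw : w ∈ filt U x N d),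
    w ∈ U.parity i ∧ z = symb U x N d w hw}

/-- `mul` and `br` are the operations induced on `Gr`: for `w ∈ F_d U`, `w' ∈ F_e U`, the
product of classes is the class of `w (n) w'` in `F_{d+e}/F_{d+e-1}`, and their bracket is the
class of the supercommutator in `F_{d+e-1}/F_{d+e-2}`. -/
structure IsInduced (mul br : ℕ → Gr U x N →ₗ[k] Gr U x N →ₗ[k] Gr U x N) : Prop where
  mul_symb : ∀ (n d e : ℕ) (w w' : U) (hw : w ∈ filt U x N d) (hw' : w' ∈ filt U x N e),
    ∃ h : U.prod n w w' ∈ filt U x N (d + e),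
      mul n (symb U x N d w hw) (symb U x N e w' hw') = symb U x N (d + e) _ h
  br_symb : ∀ (i j : ZMod 2) (n d e : ℕ) (w w' : U) (hw : w ∈ filt U x N d)
    (hw' : w' ∈ filt U x N e), w ∈ U.parity i → w' ∈ U.parity j →
    ∃ h : U.comm i j n w w' ∈ filt U x N (d + e - 1),
      br n (symb U x N d w hw) (symb U x N e w' hw') = symb U x N (d + e - 1) _ h

end Graded

section Poisson

variable {k : Type u} [Field k]

/-- An `H`-module with two families of `k`-bilinear operations. No axioms are imposed here. -/
structure PoissonData (k : Type u) [Field k] where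
  carrier : Type u
  [acg : AddCommGroup carrier]
  [modk : Module k carrier]
  [modH : Module k[X] carrier]
  [tower : IsScalarTower k k[X] carrier]
  mul : ℕ → carrier →ₗ[k] carrier →ₗ[k] carrier
  br : ℕ → carrier →ₗ[k] carrier →ₗ[k] carrier

instance : CoeSort (PoissonData k) (Type u) := ⟨PoissonData.carrier⟩

attribute [instance] PoissonData.acg PoissonData.modk PoissonData.modH PoissonData.tower

/-- Homomorphisms: `H`-linear maps preserving both families of operations. -/
structure PoissonData.Hom (P Q : PoissonData k) where
  map : P →ₗ[k[X]] Q
  map_mul : ∀ (n : ℕ) (x y : P), map (P.mul n x y) = Q.mul n (map x) (map y)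
  map_br : ∀ (n : ℕ) (x y : P), map (P.br n x y) = Q.br n (map x) (map y)

variable {M : Type u} [AddCommGroup M] [Module k M] [Module k[X] M] [IsScalarTower k k[X] M]

/-- Restriction of a bilinear operation to a submodule which is closed under it. -/
def restrict (S : Submodule k[X] M) (p : M →ₗ[k] M →ₗ[k] M)
    (h : ∀ x y : M, x ∈ S → y ∈ S → p x y ∈ S) : S →ₗ[k] S →ₗ[k] S :=
  LinearMap.mk₂ k (fun x y => ⟨p x y, h x y x.2 y.2⟩)
    (by intros; ext; simp) (by intros; ext; simp) (by intros; ext; simp) (by intros; ext; simp)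

/-- The even part of a Poisson conformal superalgebra. -/
def evenPart (par : ZMod 2 → Submodule k[X] M) (mul br : ℕ → M →ₗ[k] M →ₗ[k] M)
    (h : IsPoisson par mul br) : PoissonData k where
  carrier := par 0
  mul n := restrict (par 0) (mul n) fun x y hx hy => by
    simpa using h.mul_conformal.mem_parity 0 0 n x y hx hy
  br n := restrict (par 0) (br n) fun x y hx hy => by
    simpa using h.br_conformal.mem_parity 0 0 n x y hx hy

/-- `π : P → Q` is a null (square-zero) extension of `Q` with kernel `K`. -/
structure IsNullExtension {P Q : PoissonData k} (π : P.Hom Q) (K : Submodule k[X] P) : Prop where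
  surjective : Function.Surjective π.map
  ker_eq : LinearMap.ker π.map = K
  mul_zero : ∀ (n : ℕ) (x y : P), x ∈ K → y ∈ K → P.mul n x y = 0
  br_zero : ∀ (n : ℕ) (x y : P), x ∈ K → y ∈ K → P.br n x y = 0

/-- `π : P → Q` splits: it has a section which is a homomorphism. -/
def IsSplit {P Q : PoissonData k} (π : P.Hom Q) : Prop :=
  ∃ σ : Q.Hom P, ∀ y : Q, π.map (σ.map y) = y

end Poisson

section Tables

variable {k : Type u} [Field k] {ι : Type}

/-- `f(∂) ↦ f(-λ)`. -/
def substL (k : Type u) [Field k] : k[X] →ₐ[k] k[X][X] := aeval (-ll k)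

/-- `f(∂) ↦ f(∂ + λ)`. -/
def substR (k : Type u) [Field k] : k[X] →ₐ[k] k[X][X] := aeval (dd k + ll k)

/-- The coefficient at `λ^{(n)} = λ^n / n!`. -/
def divCoeff (k : Type u) [Field k] (n : ℕ) : k[X][X] →ₗ[k] k[X] :=
  (n.factorial : k) • (lcoeff k[X] n).restrictScalars k

/-- The coefficient at `λ^{(n)}` of `f(-λ) h(∂+λ) t`. -/
def tableAux (n : ℕ) (t : ι →₀ k[X][X]) : k[X] →ₗ[k] k[X] →ₗ[k] (ι →₀ k[X]) :=
  LinearMap.mk₂ k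
    (fun f h => Finsupp.mapRange.linearMap (divCoeff k n) ((substL k f * substR k h) • t))
    (by intros; rw [map_add, add_mul, add_smul, map_add])
    (by intros; simp [map_smul])
    (by intros; rw [map_add, mul_add, add_smul, map_add])
    (by intros; simp [map_smul])

/-- The operations on the free `H`-module with basis `e_i` given by `(e_i _λ e_j) = T i j` and
extended by sesquilinearity: `(f(∂) e_i _λ h(∂) e_j) = f(-λ) h(∂+λ) T i j`. -/
def tableProd (T : ι → ι → (ι →₀ k[X][X])) (n : ℕ) :
    (ι →₀ k[X]) →ₗ[k] (ι →₀ k[X]) →ₗ[k] (ι →₀ k[X]) :=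
  Finsupp.lsum k fun i =>
    LinearMap.flip (Finsupp.lsum k fun j => (tableAux n (T i j)).flip)

end Tables

/-- The generators of the Neveu--Schwartz conformal superalgebra. -/
inductive NSGen : Type
  | v : NSGen
  | g : NSGen

/-- `|v| = 0`, `|g| = 1`. -/
def NSGen.par : NSGen → ZMod 2
  | .v => 0
  | .g => 1

/-- `N(v,v) = 3`, `N(v,g) = N(g,v) = N(g,g) = 2`. -/
def NSGen.loc : NSGen → NSGen → ℕ
  | .v, .v => 3
  | .v, .g => 2
  | .g, .v => 2
  | .g, .g => 2

/-- `[v_λ v] = (∂+2λ)v`, `[g_λ v] = (∂/2 + 3λ/2) g`, `[g_λ g] = -v/2`, and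
`[v_λ g] = -[g_{-∂-λ} v] = (∂ + 3λ/2) g`. -/
def nsTable (k : Type u) [Field k] : NSGen → NSGen → (NSGen →₀ k[X][X])
  | .v, .v => Finsupp.single .v (dd k + 2 * ll k)
  | .g, .v => Finsupp.single .g ((1 / 2 : k) • dd k + (3 / 2 : k) • ll k)
  | .v, .g => Finsupp.single .g (dd k + (3 / 2 : k) • ll k)
  | .g, .g => Finsupp.single .v (-(C (C (1 / 2 : k))))

/-- The Neveu--Schwartz conformal superalgebra `K_1 = H v ⊕ H g`. -/
def K1 (k : Type u) [Field k] : ConfData k where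
  carrier := NSGen →₀ k[X]
  parity i := Finsupp.supported k[X] k[X] {a | a.par = i}
  prod := tableProd (nsTable k)

/-- The elements `v`, `g` of `K_1`. -/
def K1.gen (k : Type u) [Field k] (a : NSGen) : K1 k :=
  (Finsupp.single a (1 : k[X]) : NSGen →₀ k[X])

/-- `PV_2 = H ⊗ v k[v]`, with `H`-basis `v^n`, `n ≥ 1`, and operations `(v^m _λ v^n) = v^{m+n}`,
`[v^m _λ v^n] = (m∂ + (m+n)λ) v^{m+n-1}`. -/
def PV2 (k : Type u) [Field k] : PoissonData k where
  carrier := ℕ+ →₀ k[X]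
  mul := tableProd fun m n => Finsupp.single (m + n) 1
  br := tableProd fun m n => Finsupp.single (m + n - 1)
    (((m : ℕ) : k[X][X]) * dd k + (((m : ℕ) : k[X][X]) + ((n : ℕ) : k[X][X])) * ll k)

/-- The element `v^n` of `PV_2`. -/
def PV2.vpow (k : Type u) [Field k] (n : ℕ+) : PV2 k :=
  (Finsupp.single n (1 : k[X]) : ℕ+ →₀ k[X])

section Cend

/-! Here `k[∂, x]` is `k[X][X]` with inner variable `∂` and outer variable `x`, and
`k[∂, x][λ]` is `k[X][X][X]`. -/

variable (k : Type u) [Field k]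

/-- `f(∂, x) ↦ f(-λ, x)`. -/
def cendL : k[X][X] →ₐ[k] k[X][X][X] :=
  aevalTower (aeval (-X : k[X][X][X])) (C X)

/-- `f(∂, x) ↦ f(∂ + λ, x + λ)`. -/
def cendR : k[X][X] →ₐ[k] k[X][X][X] :=
  aevalTower (aeval (C (C X) + X : k[X][X][X])) (C X + X)

/-- The `n`-product of `Cend_2`: the coefficient at `λ^{(n)}` of `f(-λ, x) h(∂+λ, x+λ)`. -/
def cendProd (n : ℕ) :
    Matrix (Fin 2) (Fin 2) k[X][X] →ₗ[k] Matrix (Fin 2) (Fin 2) k[X][X] →ₗ[k]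
      Matrix (Fin 2) (Fin 2) k[X][X] :=
  LinearMap.mk₂ k
    (fun f h => (n.factorial : k) • (f.map (cendL k) * h.map (cendR k)).map fun t => t.coeff n)
    (by intros; ext1 i j; simp [Matrix.mul_apply, add_mul]; ring)
    (by intros c _ _; ext1 i j; simp [Matrix.mul_apply, smul_comm c])
    (by intros; ext1 i j; simp [Matrix.mul_apply, mul_add]; ring)
    (by intros c _ _; ext1 i j; simp [Matrix.mul_apply, smul_comm c])

/-- `Cend_2 = M_{1|1}(k[∂, x])`; even elements are the diagonal matrices, odd elements the
off-diagonal ones. -/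
def Cend2 : ConfData k where
  carrier := Matrix (Fin 2) (Fin 2) k[X][X]
  parity i :=
    { carrier := {A | ∀ r c : Fin 2, ((r.val + c.val : ℕ) : ZMod 2) ≠ i → A r c = 0}
      add_mem' := fun ha hb r c h => by simp [ha r c h, hb r c h]
      zero_mem' := fun r c _ => rfl
      smul_mem' := fun t A ha r c h => by simp [ha r c h] }
  prod := cendProd k

/-- A matrix as an element of `Cend_2`. -/
def Cend2.mk (A : Matrix (Fin 2) (Fin 2) k[X][X]) : Cend2 k := A

/-- `v = diag(x, x - ∂/2)`. -/
def vMat : Cend2 k := Cend2.mk k !![X, 0; 0, X - C ((1 / 2 : k) • X)]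

/-- `g = (1/2) (0, x; -1, 0)`. -/
def gMat : Cend2 k := Cend2.mk k ((1 / 2 : k) • !![0, X; -1, 0])

/-- The matrices `(x f₁₁, x f₁₂; f₂₁, f₂₂)`. -/
def cendQ : Set (Cend2 k) :=
  {A | ∃ f : Matrix (Fin 2) (Fin 2) k[X][X],
    A = Cend2.mk k !![X * f 0 0, X * f 0 1; f 1 0, f 1 1]}

/-- `a_n = diag(x^n, x^n - ∂ x^{n-1}/2)`, `n ≥ 1`. -/
def aMat (n : ℕ) : Cend2 k :=
  Cend2.mk k !![X ^ n, 0; 0, X ^ n - C ((1 / 2 : k) • X) * X ^ (n - 1)]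

/-- `b_n = diag(0, x^{n-2})`, `n ≥ 2`. -/
def bMat (n : ℕ) : Cend2 k := Cend2.mk k !![0, 0; 0, X ^ (n - 2)]

end Cend

end ConfSuper

end

set_option linter.unusedSectionVars false

namespace ConfSuper

noncomputable section

section LambdaCalculus

/-- The sequence vanishes from some index on. -/
def EvZero {M : Type u} [Zero M] (c : ℕ → M) : Prop := ∃ N : ℕ, ∀ n, N ≤ n → c n = 0

/-- The double sequence has finite support. -/
def EvZero₂ {M : Type u} [Zero M] (c : ℕ → ℕ → M) : Prop :=
  ∃ N : ℕ, ∀ n m, N ≤ n ∨ N ≤ m → c n m = 0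

variable {k : Type u} [Field k] {M M' : Type u} [AddCommGroup M] [Module k M] [Module k[X] M]
  [AddCommGroup M'] [Module k M'] [Module k[X] M']

theorem EvZero.add {c d : ℕ → M} (hc : EvZero c) (hd : EvZero d) : EvZero (fun n => c n + d n) := by
  obtain ⟨N, hN⟩ := hc
  obtain ⟨N', hN'⟩ := hd
  exact ⟨max N N', fun n hn => by
    simp [hN n (le_trans (le_max_left _ _) hn), hN' n (le_trans (le_max_right _ _) hn)]⟩

theorem EvZero.map {c : ℕ → M} (hc : EvZero c) (f : ℕ → M →+ M') : EvZero (fun n => f n (c n)) := by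
  obtain ⟨N, hN⟩ := hc
  exact ⟨N, fun n hn => by simp [hN n hn]⟩

theorem EvZero.neg {c : ℕ → M} (hc : EvZero c) : EvZero (fun n => -(c n)) :=
  hc.map fun _ => -AddMonoidHom.id M

theorem EvZero.sub {c d : ℕ → M} (hc : EvZero c) (hd : EvZero d) : EvZero (fun n => c n - d n) := by
  simpa only [sub_eq_add_neg] using hc.add hd.neg

theorem EvZero.zsmul {c : ℕ → M} (hc : EvZero c) (a : ℤ) : EvZero (fun n => a • c n) :=
  hc.map fun _ => zsmulAddGroupHom a

theorem EvZero.smul {R : Type*} [Semiring R] [Module R M] {c : ℕ → M} (hc : EvZero c) (a : ℕ → R) :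
    EvZero (fun n => a n • c n) :=
  hc.map fun n => DistribSMul.toAddMonoidHom M (a n)

theorem EvZero.shift {c : ℕ → M} (hc : EvZero c) (j : ℕ) : EvZero (fun n => c (j + n)) := by
  obtain ⟨N, hN⟩ := hc
  exact ⟨N, fun n hn => hN _ (by omega)⟩

theorem EvZero.pred {c : ℕ → M} (hc : EvZero c) : EvZero (fun n => c (n - 1)) := by
  obtain ⟨N, hN⟩ := hc
  exact ⟨N + 1, fun n hn => hN _ (by omega)⟩

theorem evZero_zero : EvZero (fun _ => (0 : M)) := ⟨0, fun _ _ => rfl⟩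

/-- The value at `λ = s` of `∑ λ^n / n! c n`. -/
def lam (s : k[X]) (c : ℕ → M) : M := ∑ᶠ n, (s ^ n * C ((n.factorial : k)⁻¹)) • c n

theorem lam_eq_sum (s : k[X]) {c : ℕ → M} {N : ℕ} (h : ∀ n, N ≤ n → c n = 0) :
    lam s c = ∑ n ∈ Finset.range N, (s ^ n * C ((n.factorial : k)⁻¹)) • c n := by
  refine finsum_eq_sum_of_support_subset _ fun n hn => ?_
  by_contra h'
  exact hn (by simp [h n (by simpa using h')])

theorem lam_add (s : k[X]) {c d : ℕ → M} (hc : EvZero c) (hd : EvZero d) :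
    lam s (fun n => c n + d n) = lam s c + lam s d := by
  obtain ⟨N, hN⟩ := hc
  obtain ⟨N', hN'⟩ := hd
  have h1 := fun n (hn : max N N' ≤ n) => hN n (le_trans (le_max_left _ _) hn)
  have h2 := fun n (hn : max N N' ≤ n) => hN' n (le_trans (le_max_right _ _) hn)
  rw [lam_eq_sum s h1, lam_eq_sum s h2, lam_eq_sum (N := max N N') s
    (fun n hn => by simp [h1 n hn, h2 n hn]), ← Finset.sum_add_distrib]
  simp

theorem map_lam_of (s : k[X]) {c : ℕ → M} (hc : EvZero c) (f : M →+ M') (s' : k[X])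
    (hf : ∀ n (x : M), f ((s ^ n * C ((n.factorial : k)⁻¹)) • x)
      = (s' ^ n * C ((n.factorial : k)⁻¹)) • f x) :
    f (lam s c) = lam s' (fun n => f (c n)) := by
  obtain ⟨N, hN⟩ := hc
  rw [lam_eq_sum s hN, lam_eq_sum (N := N) s' (fun n hn => by simp [hN n hn]), map_sum]
  simp [hf]

theorem map_lam (s : k[X]) {c : ℕ → M} (hc : EvZero c) (f : M →ₗ[k[X]] M') :
    f (lam s c) = lam s (fun n => f (c n)) :=
  map_lam_of s hc f.toAddMonoidHom s fun _ _ => by simp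

theorem lam_smul (s a : k[X]) {c : ℕ → M} (hc : EvZero c) :
    lam s (fun n => a • c n) = a • lam s c :=
  (map_lam s hc (LinearMap.lsmul k[X] M a)).symm

theorem lam_neg (s : k[X]) {c : ℕ → M} (hc : EvZero c) :
    lam s (fun n => -(c n)) = -lam s c :=
  (map_lam s hc (-LinearMap.id)).symm

theorem lam_sub (s : k[X]) {c d : ℕ → M} (hc : EvZero c) (hd : EvZero d) :
    lam s (fun n => c n - d n) = lam s c - lam s d := by
  simp only [sub_eq_add_neg]
  rw [lam_add s hc hd.neg, lam_neg s hd]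

theorem lam_zsmul (s : k[X]) (a : ℤ) {c : ℕ → M} (hc : EvZero c) :
    lam s (fun n => a • c n) = a • lam s c := by
  have := lam_smul s (a : k[X]) hc
  simpa only [Int.cast_smul_eq_zsmul] using this

theorem lam_zero (s : k[X]) : lam s (fun _ => (0 : M)) = 0 := by simp [lam]

theorem lam_congr (s : k[X]) {c d : ℕ → M} (h : ∀ n, c n = d n) : lam s c = lam s d :=
  congrArg (lam s) (funext h)

theorem lam_eq_zero (s : k[X]) {c : ℕ → M} (h : ∀ n, c n = 0) : lam s c = 0 := by simp [lam, h]

theorem lam_zero_left {c : ℕ → M} (hc : EvZero c) : lam (0 : k[X]) c = c 0 := by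
  obtain ⟨N, hN⟩ := hc
  rw [lam_eq_sum (N := N + 1) _ (fun n hn => hN n (by omega)), Finset.sum_range_succ']
  simp

variable [IsScalarTower k k[X] M] [IsScalarTower k k[X] M']

theorem C_smul' (a : k) (x : M) : (C a : k[X]) • x = a • x := algebraMap_smul k[X] a x

theorem k_smul_eq (a : k) (x : M) : a • x = (C a : k[X]) • x := (C_smul' a x).symm

theorem smul_comm' (a : k) (b : k[X]) (x : M) : a • b • x = b • a • x := by
  rw [k_smul_eq, k_smul_eq, smul_smul, smul_smul, mul_comm]

theorem linearMap_C_smul (f : M →ₗ[k] M') (a : k) (x : M) :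
    f ((C a : k[X]) • x) = (C a : k[X]) • f x := by
  rw [C_smul', C_smul', map_smul]

theorem map_lam_C (l : k) {c : ℕ → M} (hc : EvZero c) (f : M →ₗ[k] M') :
    f (lam (C l) c) = lam (C l) (fun n => f (c n)) :=
  map_lam_of _ hc f.toAddMonoidHom _ fun n x => by
    rw [← C_pow, ← C_mul]
    exact linearMap_C_smul f _ x

section CharZero

variable [CharZero k]

theorem lam_injective {c d : ℕ → M} (hc : EvZero c) (hd : EvZero d)
    (h : ∀ l : k, lam (C l) c = lam (C l) d) (n : ℕ) : c n = d n := by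
  obtain ⟨N, hN⟩ := hc.sub hd
  rw [← sub_eq_zero]
  rw [← Module.forall_dual_apply_eq_zero_iff k]
  intro f
  set p : k[X] := ∑ n ∈ Finset.range N, C ((n.factorial : k)⁻¹ * f (c n - d n)) * X ^ n with hp
  have hp0 : p = 0 := by
    refine Polynomial.funext fun l => ?_
    have h1 : f (lam (C l) (fun n => c n - d n)) = 0 := by rw [lam_sub _ hc hd, h, sub_self, map_zero]
    rw [lam_eq_sum _ hN, map_sum] at h1
    rw [hp, eval_finsetSum, eval_zero, ← h1]
    refine Finset.sum_congr rfl fun n _ => ?_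
    rw [← C_pow, ← C_mul, C_smul', map_smul]
    simp
    ring
  have h2 : p.coeff n = 0 := by rw [hp0, coeff_zero]
  rw [hp, finsetSum_coeff] at h2
  simp only [coeff_C_mul_X_pow] at h2
  by_cases hn : n < N
  · rw [Finset.sum_ite_eq, if_pos (Finset.mem_range.2 hn)] at h2
    have : (n.factorial : k) ≠ 0 := by exact_mod_cast n.factorial_ne_zero
    simpa [this] using h2
  · simp [hN n (by omega)]

theorem inv_factorial_mul (n s : ℕ) :
    (((n + s).factorial : k)⁻¹) * ((n + s).choose n : k) = (n.factorial : k)⁻¹ * (s.factorial : k)⁻¹ := by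
  have h1 : (n.factorial : k) ≠ 0 := by exact_mod_cast n.factorial_ne_zero
  have h2 : (s.factorial : k) ≠ 0 := by exact_mod_cast s.factorial_ne_zero
  have h3 : ((n + s).factorial : k) ≠ 0 := by exact_mod_cast (n + s).factorial_ne_zero
  have h := Nat.add_choose_mul_factorial_mul_factorial n s
  have h' : ((n + s).choose n : k) * n.factorial * s.factorial = (n + s).factorial := by
    rw [Nat.choose_symm_add]
    exact_mod_cast h
  field_simp
  linear_combination h'

theorem sum_range_antidiagonal {N : ℕ} (f : ℕ → ℕ → M) (h : ∀ i j, N ≤ i + j → f i j = 0) :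
    ∑ n ∈ Finset.range N, ∑ i ∈ Finset.range (n + 1), f i (n - i) =
      ∑ i ∈ Finset.range N, ∑ j ∈ Finset.range N, f i j := by
  rw [Finset.sum_range_diag_flip]
  refine Finset.sum_congr rfl fun i hi => ?_
  refine Finset.sum_subset (fun j hj => ?_) fun j hj hj' => h i j ?_
  · simp only [Finset.mem_range] at *; omega
  · simp only [Finset.mem_range] at *; omega

theorem lam_add_left (s t : k[X]) {c : ℕ → M} (hc : EvZero c) :
    lam (s + t) c = lam s (fun i => lam t (fun m => c (i + m))) := by
  obtain ⟨N, hN⟩ := hc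
  rw [lam_eq_sum _ hN, lam_eq_sum (N := N) s (fun n hn => by
    exact lam_eq_zero t fun m => hN _ (by omega))]
  have h2 : ∀ i, lam t (fun m => c (i + m)) = ∑ m ∈ Finset.range N,
      (t ^ m * C ((m.factorial : k)⁻¹)) • c (i + m) := fun i =>
    lam_eq_sum t fun n hn => hN _ (by omega)
  simp only [h2, Finset.smul_sum]
  rw [← sum_range_antidiagonal (fun i m => (s ^ i * C ((i.factorial : k)⁻¹)) •
    (t ^ m * C ((m.factorial : k)⁻¹)) • c (i + m))
    (fun i j hij => by rw [hN _ hij, smul_zero, smul_zero])]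
  refine Finset.sum_congr rfl fun n _ => ?_
  rw [add_pow, Finset.sum_mul, Finset.sum_smul]
  refine Finset.sum_congr rfl fun i hi => ?_
  have hi' : i + (n - i) = n := by simp only [Finset.mem_range] at hi; omega
  have := inv_factorial_mul (k := k) i (n - i)
  rw [hi'] at this ⊢
  rw [smul_smul]
  congr 1
  have h3 := congrArg (C : k → k[X]) this
  rw [C_mul, C_mul, C_eq_natCast] at h3
  linear_combination s ^ i * t ^ (n - i) * h3

theorem lam_conv (s : k[X]) {c : ℕ → ℕ → M} (hc : EvZero₂ c) :
    lam s (fun n => ∑ j ∈ Finset.range (n + 1), (n.choose j : k) • c (n - j) j) =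
      lam s (fun j => lam s (fun i => c i j)) := by
  obtain ⟨N, hN⟩ := hc
  have hN2 : ∀ i j, 2 * N ≤ i + j → c i j = 0 := fun i j h => hN i j (by omega)
  have h0 : ∀ n, 2 * N ≤ n → ∑ j ∈ Finset.range (n + 1), (n.choose j : k) • c (n - j) j = 0 := by
    intro n hn
    refine Finset.sum_eq_zero fun j hj => ?_
    rw [hN2 _ _ (by simp only [Finset.mem_range] at hj; omega), smul_zero]
  have h1 : ∀ j, lam s (fun i => c i j) = ∑ i ∈ Finset.range (2 * N),
      (s ^ i * C ((i.factorial : k)⁻¹)) • c i j := fun j =>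
    lam_eq_sum s fun n hn => hN2 _ _ (by omega)
  rw [lam_eq_sum s h0, lam_eq_sum (N := 2 * N) s (fun n hn => by
    exact lam_eq_zero s fun m => hN2 _ _ (by omega))]
  simp only [h1, Finset.smul_sum]
  rw [← sum_range_antidiagonal (fun j i => (s ^ j * C ((j.factorial : k)⁻¹)) •
    (s ^ i * C ((i.factorial : k)⁻¹)) • c i j)
    (fun i j hij => by rw [hN2 _ _ (by omega), smul_zero, smul_zero])]
  refine Finset.sum_congr rfl fun n _ => Finset.sum_congr rfl fun j hj => ?_
  have hj' : j + (n - j) = n := by simp only [Finset.mem_range] at hj; omega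
  have := inv_factorial_mul (k := k) j (n - j)
  rw [hj'] at this
  rw [smul_smul, k_smul_eq, smul_smul]
  congr 1
  have h3 := congrArg (C : k → k[X]) this
  rw [C_mul, C_mul] at h3
  have h4 : s ^ n = s ^ j * s ^ (n - j) := by rw [← pow_add, hj']
  rw [h4]
  linear_combination s ^ j * s ^ (n - j) * h3

theorem lam_shift (s : k[X]) {c : ℕ → M} (hc : EvZero c) :
    lam s (fun n => (n : k) • c (n - 1)) = s • lam s c := by
  obtain ⟨N, hN⟩ := hc
  rw [lam_eq_sum s hN, lam_eq_sum (N := N + 1) s (fun n hn => by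
    rw [hN _ (by omega), smul_zero]), Finset.sum_range_succ', Finset.smul_sum]
  simp only [Nat.cast_zero, zero_smul, smul_zero, add_zero]
  refine Finset.sum_congr rfl fun n _ => ?_
  rw [smul_smul, k_smul_eq, smul_smul, Nat.add_sub_cancel]
  congr 1
  rw [pow_succ, mul_assoc, ← C_mul, Nat.factorial_succ]
  have h1 : (n.factorial : k) ≠ 0 := by exact_mod_cast n.factorial_ne_zero
  have h2 : ((n + 1 : ℕ) : k) ≠ 0 := by exact_mod_cast n.succ_ne_zero
  have : (((n + 1) * n.factorial : ℕ) : k)⁻¹ * ((n + 1 : ℕ) : k) = (n.factorial : k)⁻¹ := by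
    push_cast at h2 ⊢
    field_simp
  rw [this]
  ring

end CharZero

end LambdaCalculus

section Families

variable {k : Type u} [Field k] [CharZero k]
  {M : Type u} [AddCommGroup M] [Module k M] [Module k[X] M] [IsScalarTower k k[X] M]
  {M' : Type u} [AddCommGroup M'] [Module k M'] [Module k[X] M'] [IsScalarTower k k[X] M']

/-- A family of bilinear operations is local. -/
def Loc (p : ℕ → M →ₗ[k] M →ₗ[k] M) : Prop := ∀ x y : M, EvZero (fun n => p n x y)

/-- A family of bilinear operations is sesquilinear. -/
structure Sesq (p : ℕ → M →ₗ[k] M →ₗ[k] M) : Prop where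
  left : ∀ (n : ℕ) (x y : M), p n ((X : k[X]) • x) y = -((n : k) • p (n - 1) x y)
  right : ∀ (n : ℕ) (x y : M),
    p n x ((X : k[X]) • y) = (X : k[X]) • p n x y + (n : k) • p (n - 1) x y

theorem IsConformal.loc {par : ZMod 2 → Submodule k[X] M} {p : ℕ → M →ₗ[k] M →ₗ[k] M}
    (h : IsConformal par p) : Loc p := h.locality

theorem IsConformal.sesq {par : ZMod 2 → Submodule k[X] M} {p : ℕ → M →ₗ[k] M →ₗ[k] M}
    (h : IsConformal par p) : Sesq p := ⟨h.partial_left, h.partial_right⟩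

/-- A `k`-subspace stable under `∂` as an `H`-submodule. -/
def Submodule.ofStable (S : Submodule k M) (hX : ∀ x ∈ S, (X : k[X]) • x ∈ S) :
    Submodule k[X] M where
  carrier := S
  add_mem' := S.add_mem
  zero_mem' := S.zero_mem
  smul_mem' f x hx := by
    change f • x ∈ S
    induction f using Polynomial.induction_on with
    | C a => rw [C_smul']; exact S.smul_mem a hx
    | add f g hf hg => rw [add_smul]; exact S.add_mem hf hg
    | monomial n a h =>
      have : (C a * X ^ (n + 1) : k[X]) • x = (X : k[X]) • (C a * X ^ n : k[X]) • x := by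
        rw [smul_smul]; congr 1; ring
      rw [this]
      exact hX _ h

theorem sesq_hom_ext {p : ℕ → M →ₗ[k] M →ₗ[k] M} {q : ℕ → M' →ₗ[k] M' →ₗ[k] M'} (hp : Sesq p)
    (hq : Sesq q) (f : M →ₗ[k[X]] M') {S T : Set M}
    (h : ∀ n, ∀ x ∈ S, ∀ y ∈ T, f (p n x y) = q n (f x) (f y)) (n : ℕ) {x y : M}
    (hx : x ∈ Submodule.span k[X] S) (hy : y ∈ Submodule.span k[X] T) :
    f (p n x y) = q n (f x) (f y) := by
  have fk : ∀ (a : k) (x : M), f (a • x) = a • f x := fun a x => by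
    rw [k_smul_eq, map_smul, C_smul']
  have h1 : ∀ x ∈ S, ∀ y ∈ Submodule.span k[X] T, ∀ n, f (p n x y) = q n (f x) (f y) := by
    intro x hx
    let W : Submodule k M :=
      { carrier := {y | ∀ n, f (p n x y) = q n (f x) (f y)}
        add_mem' := fun ha hb n => by simp only [map_add, ha n, hb n]
        zero_mem' := fun n => by simp
        smul_mem' := fun a y hy n => by simp only [map_smul, fk, hy n] }
    have : Submodule.span k[X] T ≤ Submodule.ofStable W (fun y hy n => by
        simp only [map_smul, hp.right, hq.right, map_add, fk, hy n, hy (n - 1)]) :=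
      Submodule.span_le.2 fun y hy n => h n x hx y hy
    exact fun y hy => this hy
  let W : Submodule k M :=
      { carrier := {x | ∀ n, f (p n x y) = q n (f x) (f y)}
        add_mem' := fun ha hb n => by simp only [map_add, LinearMap.add_apply, ha n, hb n]
        zero_mem' := fun n => by simp
        smul_mem' := fun a y hy n => by simp only [map_smul, LinearMap.smul_apply, fk, hy n] }
  have : Submodule.span k[X] S ≤ Submodule.ofStable W (fun y hy n => by
      simp only [map_smul, hp.left, hq.left, map_neg, fk, hy (n - 1)]) :=
    Submodule.span_le.2 fun x hx n => h1 x hx y hy n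
  exact this hx n

theorem sesq_mem {p : ℕ → M →ₗ[k] M →ₗ[k] M} (hp : Sesq p) (W : Submodule k[X] M) {S T : Set M}
    (h : ∀ n, ∀ x ∈ S, ∀ y ∈ T, p n x y ∈ W) (n : ℕ) {x y : M}
    (hx : x ∈ Submodule.span k[X] S) (hy : y ∈ Submodule.span k[X] T) : p n x y ∈ W := by
  have := sesq_hom_ext (q := fun _ => (0 : (M ⧸ W) →ₗ[k] (M ⧸ W) →ₗ[k] (M ⧸ W))) hp
    ⟨by simp, by simp⟩ W.mkQ (S := S) (T := T)
    (fun n x hx y hy => by simpa using h n x hx y hy) n hx hy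
  simpa using this

theorem lam_sesq_left {p : ℕ → M →ₗ[k] M →ₗ[k] M} (hl : Loc p) (hp : Sesq p) (s : k[X])
    (x y : M) : lam s (fun n => p n ((X : k[X]) • x) y) = -(s • lam s (fun n => p n x y)) := by
  simp only [hp.left]
  rw [lam_neg s ((hl x y).pred.smul fun n => (n : k)), lam_shift s (hl x y)]

theorem lam_sesq_right {p : ℕ → M →ₗ[k] M →ₗ[k] M} (hl : Loc p) (hp : Sesq p) (s : k[X])
    (x y : M) :
    lam s (fun n => p n x ((X : k[X]) • y)) = (X + s) • lam s (fun n => p n x y) := by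
  simp only [hp.right]
  rw [lam_add s ((hl x y).smul fun _ => (X : k[X])) ((hl x y).pred.smul fun n => (n : k)),
    lam_shift s (hl x y), lam_smul s _ (hl x y), add_smul]

/-- `(f(∂)x _λ y) = f(-λ) (x _λ y)`. -/
theorem lam_smul_left {p : ℕ → M →ₗ[k] M →ₗ[k] M} (hl : Loc p) (hp : Sesq p) (s f : k[X])
    (x y : M) : lam s (fun n => p n (f • x) y) = f.comp (-s) • lam s (fun n => p n x y) := by
  induction f using Polynomial.induction_on with
  | C a =>
    simp only [C_comp, C_smul', map_smul, LinearMap.smul_apply]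
    simp only [k_smul_eq]
    rw [lam_smul s _ (hl x y)]
  | add f g hf hg =>
    simp only [add_smul, map_add, LinearMap.add_apply, add_comp]
    rw [lam_add s (hl _ y) (hl _ y), hf, hg]
  | monomial n a h =>
    have : (C a * X ^ (n + 1) : k[X]) • x = (X : k[X]) • (C a * X ^ n : k[X]) • x := by
      rw [smul_smul]; congr 1; ring
    rw [this, lam_sesq_left hl hp, h, smul_smul, ← neg_smul]
    congr 1
    simp
    ring

theorem curly_eq_lam (p : ℕ → M →ₗ[k] M →ₗ[k] M) (n : ℕ) (y x : M) :
    curly p n y x = (C ((-1) ^ n) : k[X]) • lam (-X : k[X]) (fun s => p (n + s) y x) := by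
  rw [curly, lam, C_smul', smul_finsum]
  refine finsum_congr fun s => ?_
  rw [k_smul_eq, k_smul_eq, smul_smul, smul_smul]
  congr 1
  simp only [C_mul, C_pow, C_neg, C_1, pow_add, neg_pow (X : k[X]) s]
  ring

theorem Loc.curly {p : ℕ → M →ₗ[k] M →ₗ[k] M} (hl : Loc p) (y x : M) :
    EvZero (fun n => curly p n y x) := by
  obtain ⟨N, hN⟩ := hl y x
  refine ⟨N, fun n hn => ?_⟩
  simp only [curly_eq_lam]
  rw [lam_eq_sum (N := 0) _ fun m _ => hN _ (by omega)]
  simp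

theorem lam_neg_left (s : k[X]) (c : ℕ → M) :
    lam (-s) c = lam s (fun n => (C ((-1) ^ n) : k[X]) • c n) := by
  refine finsum_congr fun n => ?_
  rw [smul_smul]
  congr 1
  simp only [C_pow, C_neg, C_1, neg_pow s n]
  ring

/-- The family `{y (n) x}` has generating function `(y_{-∂-λ} x)`. -/
theorem lam_curly {p : ℕ → M →ₗ[k] M →ₗ[k] M} (hl : Loc p) (s : k[X]) (y x : M) :
    lam s (fun n => curly p n y x) = lam (-X - s) (fun n => p n y x) := by
  have : (-X - s : k[X]) = -s + -X := by ring
  rw [this, lam_add_left _ _ (hl y x), lam_neg_left]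
  simp only [curly_eq_lam]

/-- The bilinear operations `(y, x) ↦ {y (n) x}`. -/
def curlyL (p : ℕ → M →ₗ[k] M →ₗ[k] M) (hl : Loc p) (n : ℕ) : M →ₗ[k] M →ₗ[k] M :=
  LinearMap.mk₂ k (fun y x => curly p n y x)
    (fun y y' x => by
      simp only [curly_eq_lam, map_add, LinearMap.add_apply]
      rw [lam_add _ ((hl y x).shift n) ((hl y' x).shift n), smul_add])
    (fun a y x => by
      simp only [curly_eq_lam, map_smul, LinearMap.smul_apply]
      simp only [k_smul_eq a]
      rw [lam_smul _ _ ((hl y x).shift n), smul_comm])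
    (fun y x x' => by
      simp only [curly_eq_lam, map_add]
      rw [lam_add _ ((hl y x).shift n) ((hl y x').shift n), smul_add])
    (fun a y x => by
      simp only [curly_eq_lam, map_smul]
      simp only [k_smul_eq a]
      rw [lam_smul _ _ ((hl y x).shift n), smul_comm])

theorem curly_sesq_left {p : ℕ → M →ₗ[k] M →ₗ[k] M} (hl : Loc p) (hp : Sesq p) (n : ℕ) (y x : M) :
    curly p n ((X : k[X]) • y) x = (X : k[X]) • curly p n y x + (n : k) • curly p (n - 1) y x := by
  refine lam_injective (k := k) (hl.curly _ x)
    (((hl.curly y x).smul fun _ => (X : k[X])).add ((hl.curly y x).pred.smul fun n => (n : k)))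
    (fun l => ?_) n
  rw [lam_add _ ((hl.curly y x).smul fun _ => (X : k[X])) ((hl.curly y x).pred.smul fun n => (n : k)),
    lam_shift _ (hl.curly y x), lam_smul _ _ (hl.curly y x), lam_curly hl, lam_curly hl,
    lam_sesq_left hl hp, ← add_smul, ← neg_smul]
  congr 1
  ring

theorem curly_sesq_right {p : ℕ → M →ₗ[k] M →ₗ[k] M} (hl : Loc p) (hp : Sesq p) (n : ℕ) (y x : M) :
    curly p n y ((X : k[X]) • x) = -((n : k) • curly p (n - 1) y x) := by
  refine lam_injective (k := k) (hl.curly y _)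
    ((hl.curly y x).pred.smul fun n => (n : k)).neg
    (fun l => ?_) n
  rw [lam_neg _ ((hl.curly y x).pred.smul fun n => (n : k)),
    lam_shift _ (hl.curly y x), lam_curly hl, lam_curly hl,
    lam_sesq_right hl hp, ← neg_smul]
  congr 1
  ring

theorem curly_mem {p : ℕ → M →ₗ[k] M →ₗ[k] M} (hl : Loc p) (W : Submodule k[X] M) {y x : M}
    (h : ∀ n, p n y x ∈ W) (n : ℕ) : curly p n y x ∈ W := by
  rw [curly_eq_lam]
  obtain ⟨N, hN⟩ := (hl y x).shift n
  rw [lam_eq_sum _ hN]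
  exact W.smul_mem _ (W.sum_mem fun i _ => W.smul_mem _ (h _))

theorem curly_map {p : ℕ → M →ₗ[k] M →ₗ[k] M} {q : ℕ → M' →ₗ[k] M' →ₗ[k] M'} (hl : Loc p)
    (f : M →ₗ[k[X]] M') {y x : M} {y' x' : M'} (h : ∀ n, f (p n y x) = q n y' x') (n : ℕ) :
    f (curly p n y x) = curly q n y' x' := by
  rw [curly_eq_lam, curly_eq_lam, map_smul, map_lam _ ((hl y x).shift n)]
  simp only [h]

/-- The supercommutator with sign `ε`, as a family of bilinear operations. -/
def commL (p : ℕ → M →ₗ[k] M →ₗ[k] M) (hl : Loc p) (ε : ℤ) (n : ℕ) : M →ₗ[k] M →ₗ[k] M :=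
  p n - ε • (curlyL p hl n).flip

theorem commL_apply {p : ℕ → M →ₗ[k] M →ₗ[k] M} (hl : Loc p) (ε : ℤ) (n : ℕ) (x y : M) :
    commL p hl ε n x y = p n x y - ε • curly p n y x := rfl

theorem commL_loc {p : ℕ → M →ₗ[k] M →ₗ[k] M} (hl : Loc p) (ε : ℤ) : Loc (commL p hl ε) :=
  fun x y => (hl x y).sub ((hl.curly y x).zsmul ε)

theorem commL_sesq {p : ℕ → M →ₗ[k] M →ₗ[k] M} (hl : Loc p) (hp : Sesq p) (ε : ℤ) :
    Sesq (commL p hl ε) where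
  left n x y := by
    simp only [commL_apply, hp.left, curly_sesq_right hl hp, smul_neg, smul_sub, neg_sub,
      smul_comm ε]
    abel
  right n x y := by
    simp only [commL_apply, hp.right, curly_sesq_left hl hp, smul_sub, smul_add, smul_comm ε]
    abel

theorem lam_commL {p : ℕ → M →ₗ[k] M →ₗ[k] M} (hl : Loc p) (ε : ℤ) (s : k[X]) (x y : M) :
    lam s (fun n => commL p hl ε n x y) =
      lam s (fun n => p n x y) - ε • lam (-X - s) (fun n => p n y x) := by
  simp only [commL_apply]
  rw [lam_sub _ (hl x y) ((hl.curly y x).zsmul ε), lam_zsmul _ _ (hl.curly y x), lam_curly hl]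

theorem EvZero₂.of {c : ℕ → ℕ → M} (h1 : ∃ N, ∀ s, N ≤ s → ∀ r, c r s = 0)
    (h2 : ∀ s, EvZero (fun r => c r s)) : EvZero₂ c := by
  obtain ⟨N, hN⟩ := h1
  choose K hK using h2
  refine ⟨max N ((Finset.range N).sup K), fun r s h => ?_⟩
  by_cases hs : N ≤ s
  · exact hN s hs r
  · refine hK s r (le_trans (Finset.le_sup (f := K) (Finset.mem_range.2 (by omega)))
      (le_trans (le_max_right N _) (h.resolve_right fun h' => hs (le_trans (le_max_left _ _) h'))))

theorem EvZero₂.swap {c : ℕ → ℕ → M} (h : EvZero₂ c) : EvZero₂ (fun n m => c m n) := by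
  obtain ⟨N, hN⟩ := h
  exact ⟨N, fun n m h => hN m n h.symm⟩

theorem EvZero₂.add {c d : ℕ → ℕ → M} (hc : EvZero₂ c) (hd : EvZero₂ d) :
    EvZero₂ (fun n m => c n m + d n m) := by
  obtain ⟨N, hN⟩ := hc
  obtain ⟨N', hN'⟩ := hd
  exact ⟨max N N', fun n m h => by
    simp only [hN n m (by omega), hN' n m (by omega), add_zero]⟩

theorem EvZero₂.zsmul {c : ℕ → ℕ → M} (hc : EvZero₂ c) (a : ℤ) :
    EvZero₂ (fun n m => a • c n m) := by
  obtain ⟨N, hN⟩ := hc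
  exact ⟨N, fun n m h => by simp only [hN n m h, smul_zero]⟩

theorem EvZero₂.sub {c d : ℕ → ℕ → M} (hc : EvZero₂ c) (hd : EvZero₂ d) :
    EvZero₂ (fun n m => c n m - d n m) := by
  simpa [sub_eq_add_neg] using hc.add (hd.zsmul (-1))

theorem EvZero₂.right {c : ℕ → ℕ → M} (hc : EvZero₂ c) (n : ℕ) : EvZero (c n) := by
  obtain ⟨N, hN⟩ := hc
  exact ⟨N, fun m h => hN n m (Or.inr h)⟩

theorem EvZero₂.lam {c : ℕ → ℕ → M} (hc : EvZero₂ c) (s : k[X]) :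
    EvZero (fun n => lam s (c n)) := by
  obtain ⟨N, hN⟩ := hc
  exact ⟨N, fun n h => lam_eq_zero s fun m => hN n m (Or.inl h)⟩

theorem lam_lam_injective {c d : ℕ → ℕ → M} (hc : EvZero₂ c) (hd : EvZero₂ d)
    (h : ∀ l m : k, lam (C l) (fun n => lam (C m) (c n)) = lam (C l) (fun n => lam (C m) (d n)))
    (n m : ℕ) : c n m = d n m :=
  lam_injective (hc.right n) (hd.right n)
    (fun b => lam_injective (hc.lam (C b)) (hd.lam (C b)) (fun a => h a b) n) m

variable {p q : ℕ → M →ₗ[k] M →ₗ[k] M}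

theorem evZero₂_left (hp : Loc p) (hq : Loc q) (x y z : M) :
    EvZero₂ (fun r s => p r (q s x y) z) := by
  obtain ⟨N, hN⟩ := hq x y
  exact EvZero₂.of ⟨N, fun s hs r => by simp [hN s hs]⟩ fun s => hp _ z

theorem evZero₂_right (hp : Loc p) (hq : Loc q) (x y z : M) :
    EvZero₂ (fun n m => p n x (q m y z)) := by
  obtain ⟨N, hN⟩ := hq y z
  exact EvZero₂.of ⟨N, fun s hs r => by simp [hN s hs]⟩ fun s => hp x _

theorem evZero₂_conv {c : ℕ → ℕ → M} (hc : EvZero₂ c) :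
    EvZero₂ (fun n m => ∑ s ∈ Finset.range (n + 1), (n.choose s : k) • c (n + m - s) s) := by
  obtain ⟨N, hN⟩ := hc
  refine ⟨2 * N, fun n m h => Finset.sum_eq_zero fun s hs => ?_⟩
  simp only [Finset.mem_range] at hs
  rw [hN _ _ (by omega), smul_zero]

theorem lam_sum (s : k[X]) {ι : Type*} (t : Finset ι) {c : ι → ℕ → M}
    (hc : ∀ i ∈ t, EvZero (c i)) : lam s (fun n => ∑ i ∈ t, c i n) = ∑ i ∈ t, lam s (c i) := by
  classical
  induction t using Finset.induction_on with
  | empty => simp [lam_zero]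
  | insert a t ha ih =>
    have hE : EvZero (fun n => ∑ i ∈ t, c i n) := by
      clear ih ha
      induction t using Finset.induction_on with
      | empty => simpa using evZero_zero
      | insert b t hb ih =>
        simp only [Finset.sum_insert hb]
        exact (hc b (by simp)).add (ih fun i hi => hc i (by
          rcases Finset.mem_insert.1 hi with h | h <;> simp [h]))
    simp only [Finset.sum_insert ha]
    rw [lam_add s (hc a (by simp)) hE, ih fun i hi => hc i (by simp [hi])]

theorem lam_lam_conv (hp : Loc p) (hq : Loc q) (l m : k) (x y z : M) :
    lam (C l) (fun n => lam (C m) (fun r => ∑ s ∈ Finset.range (n + 1),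
      (n.choose s : k) • p (n + r - s) (q s x y) z)) =
    lam (C (l + m)) (fun r => p r (lam (C l) (fun s => q s x y)) z) := by
  have hE := evZero₂_left hp hq x y z
  have hE' : EvZero₂ (fun i s => lam (C m) (fun r => p (i + r) (q s x y) z)) := by
    obtain ⟨N, hN⟩ := hE
    refine ⟨N, fun i s h => ?_⟩
    exact lam_eq_zero _ fun r => hN _ _ (by omega)
  have h1 : ∀ n, lam (C m) (fun r => ∑ s ∈ Finset.range (n + 1),
      (n.choose s : k) • p (n + r - s) (q s x y) z) = ∑ s ∈ Finset.range (n + 1),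
      (n.choose s : k) • lam (C m) (fun r => p (n - s + r) (q s x y) z) := by
    intro n
    rw [lam_sum (C m) (c := fun s r => (n.choose s : k) • p (n + r - s) (q s x y) z)]
    · refine Finset.sum_congr rfl fun s hs => ?_
      simp only [Finset.mem_range] at hs
      simp only [k_smul_eq (n.choose s : k)]
      have h2 : ∀ r, n + r - s = n - s + r := fun r => by omega
      simp only [h2]
      rw [lam_smul _ _ ((hp _ z).shift _)]
    · intro s hs
      obtain ⟨N, hN⟩ := hp (q s x y) z
      exact ⟨N + n, fun r hr => by
        simp only [Finset.mem_range] at hs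
        simp only [hN (n + r - s) (by omega), smul_zero]⟩
  simp only [h1]
  rw [lam_conv _ hE', C_add]
  have h3 : ∀ s, lam (C l) (fun i => lam (C m) (fun r => p (i + r) (q s x y) z)) =
      lam (C l + C m) (fun r => p r (q s x y) z) := fun s =>
    (lam_add_left _ _ (hp _ z)).symm
  rw [← C_add] at *
  rw [lam_congr (C l) h3]
  obtain ⟨N, hN⟩ := hE
  have h5 : ∀ s, lam (C (l + m)) (fun r => p r (q s x y) z) = ∑ r ∈ Finset.range N,
      (C (l + m) ^ r * C ((r.factorial : k)⁻¹)) • p r (q s x y) z := fun s =>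
    lam_eq_sum _ fun r hr => hN r s (Or.inl hr)
  have h6 : ∀ r, p r (lam (C l) (fun s => q s x y)) z = lam (C l) (fun s => p r (q s x y) z) :=
    fun r => map_lam_C l (hq x y) ((p r).flip z)
  have h7 : ∀ r, N ≤ r → p r (lam (C l) (fun s => q s x y)) z = 0 := fun r hr => by
    rw [h6]
    exact lam_eq_zero _ fun s => hN r s (Or.inl hr)
  rw [lam_eq_sum (C (l + m)) h7]
  simp only [h5, h6]
  rw [lam_sum]
  · refine Finset.sum_congr rfl fun r _ => ?_
    exact lam_smul _ _ ((hq x y).map fun _ => ((p r).flip z).toAddMonoidHom)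
  · intro r _
    exact ((hq x y).map fun _ => ((p r).flip z).toAddMonoidHom).smul fun _ => _

theorem lam_lam_right (hq : Loc q) (l m : k) (x y z : M) :
    lam (C l) (fun n => lam (C m) (fun r => p n x (q r y z))) =
      lam (C l) (fun n => p n x (lam (C m) (fun r => q r y z))) := by
  exact lam_congr _ fun n => (map_lam_C m (hq y z) (p n x)).symm

theorem lam_comm (s t : k[X]) {c : ℕ → ℕ → M} (hc : EvZero₂ c) :
    lam s (fun n => lam t (fun m => c n m)) = lam t (fun m => lam s (fun n => c n m)) := by
  obtain ⟨N, hN⟩ := hc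
  have h1 : ∀ n, lam t (fun m => c n m) = ∑ m ∈ Finset.range N,
      (t ^ m * C ((m.factorial : k)⁻¹)) • c n m := fun n =>
    lam_eq_sum _ fun r hr => hN n r (Or.inr hr)
  have h2 : ∀ m, lam s (fun n => c n m) = ∑ n ∈ Finset.range N,
      (s ^ n * C ((n.factorial : k)⁻¹)) • c n m := fun m =>
    lam_eq_sum _ fun r hr => hN r m (Or.inl hr)
  rw [lam_eq_sum (N := N) s fun n hn => by
      rw [h1]; exact Finset.sum_eq_zero fun m _ => by rw [hN n m (Or.inl hn), smul_zero],
    lam_eq_sum (N := N) t fun n hn => by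
      rw [h2]; exact Finset.sum_eq_zero fun m _ => by rw [hN m n (Or.inr hn), smul_zero]]
  simp only [h1, h2, Finset.smul_sum]
  rw [Finset.sum_comm]
  exact Finset.sum_congr rfl fun m _ => Finset.sum_congr rfl fun n _ => smul_comm _ _ _

theorem lam_lam_right_swap (hp : Loc p) (hq : Loc q) (l m : k) (x y z : M) :
    lam (C l) (fun n => lam (C m) (fun r => q r y (p n x z))) =
      lam (C m) (fun r => q r y (lam (C l) (fun n => p n x z))) := by
  rw [lam_comm _ _ (evZero₂_right hq hp y x z).swap]
  exact lam_lam_right hp m l y x z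

end Families

section CendEvaluation

variable {k : Type u} [Field k]

/-- The value of a matrix over `k[∂, x]` at `∂ = d`, `x = t`. -/
def evMat (d t : k) : Matrix (Fin 2) (Fin 2) k[X][X] →+* Matrix (Fin 2) (Fin 2) k :=
  (evalEvalRingHom d t).mapMatrix

theorem evMat_apply (d t : k) (A : Matrix (Fin 2) (Fin 2) k[X][X]) (r c : Fin 2) :
    evMat d t A r c = (A r c).evalEval d t := rfl

theorem evMat_smul (d t : k) (f : k[X]) (A : Matrix (Fin 2) (Fin 2) k[X][X]) :
    evMat d t (f • A) = f.eval d • evMat d t A := by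
  ext r c
  simp [evMat_apply, evalEval, smul_eq_C_mul]

theorem evMat_injective [CharZero k] {A B : Matrix (Fin 2) (Fin 2) k[X][X]}
    (h : ∀ d t : k, evMat d t A = evMat d t B) : A = B := by
  ext1 r c
  have hz : ∀ q : k[X][X], (∀ d t : k, q.evalEval d t = 0) → q = 0 := by
    intro q hq
    have h1 : ∀ t : k, q.eval (C t) = 0 := fun t => Polynomial.funext fun d => by
      simpa [evalEval] using hq d t
    classical
    by_contra hne
    have hinf : (Set.range (C : k → k[X])).Infinite := Set.infinite_range_of_injective C_injective
    refine hinf ((q.roots.toFinset.finite_toSet).subset ?_)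
    rintro _ ⟨t, rfl⟩
    simp only [Finset.mem_coe, Multiset.mem_toFinset, mem_roots hne, IsRoot.def]
    exact h1 t
  rw [← sub_eq_zero]
  refine hz _ fun d t => ?_
  have := congrFun (congrFun (h d t) r) c
  rw [evMat_apply, evMat_apply] at this
  have h2 := map_sub (evalEvalRingHom d t) (A r c) (B r c)
  change (A r c - B r c).evalEval d t = (A r c).evalEval d t - (B r c).evalEval d t at h2
  rw [h2, this, sub_self]

/-- Evaluation at `∂ = d`, `x = t`, `λ = σ`. -/
def ev₃ (d t σ : k) : k[X][X][X] →+* k := (evalEvalRingHom d t).comp (evalRingHom (C (C σ)))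

theorem ev₃_cendL (d t σ : k) :
    (ev₃ d t σ).comp (cendL k).toRingHom = evalEvalRingHom (-σ) t := by
  refine Polynomial.ringHom_ext (fun f => ?_) ?_
  · have h : ((ev₃ d t σ).comp (cendL k).toRingHom).comp C = evalRingHom (-σ) := by
      refine Polynomial.ringHom_ext (fun a => ?_) ?_
      · simp [ev₃, cendL, algebraMap_eq, Polynomial.algebraMap_apply]
      · simp [ev₃, cendL]
    simpa [evalEval] using congrArg (fun g : k[X] →+* k => g f) h
  · simp [ev₃, cendL]

theorem ev₃_cendR (d t σ : k) :
    (ev₃ d t σ).comp (cendR k).toRingHom = evalEvalRingHom (d + σ) (t + σ) := by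
  refine Polynomial.ringHom_ext (fun f => ?_) ?_
  · have h : ((ev₃ d t σ).comp (cendR k).toRingHom).comp C = evalRingHom (d + σ) := by
      refine Polynomial.ringHom_ext (fun a => ?_) ?_
      · simp [ev₃, cendR, algebraMap_eq, Polynomial.algebraMap_apply]
      · simp [ev₃, cendR]
    simpa [evalEval] using congrArg (fun g : k[X] →+* k => g f) h
  · simp [ev₃, cendR]

theorem cendProd_apply (n : ℕ) (A B : Matrix (Fin 2) (Fin 2) k[X][X]) :
    cendProd k n A B =
      (n.factorial : k) • (A.map (cendL k) * B.map (cendR k)).map fun t => t.coeff n := rfl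

theorem cend_loc : Loc (cendProd k) := by
  intro A B
  set P := A.map (cendL k) * B.map (cendR k) with hP
  refine ⟨(∑ r, ∑ c, (P r c).natDegree) + 1, fun n hn => ?_⟩
  change (n.factorial : k) • P.map (fun t => t.coeff n) = 0
  ext1 r c
  have h1 : (P r c).natDegree ≤ ∑ r, ∑ c, (P r c).natDegree :=
    le_trans (Finset.single_le_sum (f := fun c => (P r c).natDegree)
        (fun _ _ => Nat.zero_le _) (Finset.mem_univ c))
      (Finset.single_le_sum (f := fun r => ∑ c, (P r c).natDegree)
        (fun _ _ => Nat.zero_le _) (Finset.mem_univ r))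
  simp [coeff_eq_zero_of_natDegree_lt (show (P r c).natDegree < n by omega)]

variable [CharZero k]

theorem evMat_lam_prod (d t : k) (s : k[X]) (A B : Matrix (Fin 2) (Fin 2) k[X][X]) :
    evMat d t (lam s (fun n => cendProd k n A B)) =
      evMat (-(s.eval d)) t A * evMat (d + s.eval d) (t + s.eval d) B := by
  obtain ⟨N, hN⟩ := cend_loc A B
  set σ := s.eval d
  have h1 : evMat (-σ) t A = (ev₃ d t σ).mapMatrix (A.map (cendL k)) := by
    rw [evMat, ← ev₃_cendL d t σ]; rfl
  have h2 : evMat (d + σ) (t + σ) B = (ev₃ d t σ).mapMatrix (B.map (cendR k)) := by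
    rw [evMat, ← ev₃_cendR d t σ]; rfl
  rw [h1, h2, ← map_mul, lam_eq_sum _ hN, map_sum]
  simp only [evMat_smul, cendProd_apply] at hN ⊢
  set P := A.map (cendL k) * B.map (cendR k)
  ext r c
  have h3 : ∀ n, N ≤ n → (P r c).coeff n = 0 := fun n hn => by
    have h4 := congrFun (congrFun (hN n hn) r) c
    have h5 : (n.factorial : k) ≠ 0 := by exact_mod_cast n.factorial_ne_zero
    simpa [h5] using h4
  have h6 : (P r c) = ∑ n ∈ Finset.range N, C ((P r c).coeff n) * X ^ n := by
    ext1 n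
    rw [finsetSum_coeff]
    simp only [coeff_C_mul_X_pow]
    by_cases hn : n < N
    · rw [Finset.sum_ite_eq, if_pos (Finset.mem_range.2 hn)]
    · rw [Finset.sum_ite_eq, if_neg (by simpa using hn), h3 n (by omega)]
  have h7 : (ev₃ d t σ).mapMatrix P r c = ev₃ d t σ (P r c) := rfl
  rw [h7, h6, map_sum, Matrix.sum_apply]
  refine Finset.sum_congr rfl fun n _ => ?_
  have h5 : (n.factorial : k) ≠ 0 := by exact_mod_cast n.factorial_ne_zero
  have h8 : (evalEvalRingHom d t) ((n.factorial : k) • (P r c).coeff n) =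
      n.factorial * evalEval d t ((P r c).coeff n) := by
    have : ((n.factorial : k) • (P r c).coeff n) = (n.factorial : k[X][X]) * (P r c).coeff n := by
      rw [Nat.cast_smul_eq_nsmul, nsmul_eq_mul]
    rw [this, map_mul, map_natCast]; rfl
  rw [Matrix.smul_apply, evMat_apply]
  have h9 : evalEval d t (((n.factorial : k) • P.map fun t => t.coeff n) r c) =
      n.factorial * evalEval d t ((P r c).coeff n) := h8
  rw [h9]
  have h10 : ev₃ d t σ (C ((P r c).coeff n) * X ^ n) =
      evalEval d t ((P r c).coeff n) * σ ^ n := by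
    rw [map_mul, map_pow]
    simp [ev₃]
  rw [h10]
  simp only [eval_mul, eval_pow, eval_C, smul_eq_mul]
  change σ ^ n * _ * _ = _
  field_simp

theorem evMat_lam_comm (d t : k) (ε : ℤ) (s : k[X]) (A B : Matrix (Fin 2) (Fin 2) k[X][X]) :
    evMat d t (lam s (fun n => commL (cendProd k) cend_loc ε n A B)) =
      evMat (-(s.eval d)) t A * evMat (d + s.eval d) (t + s.eval d) B -
      ε • (evMat (d + s.eval d) t B * evMat (-(s.eval d)) (t - d - s.eval d) A) := by
  rw [lam_commL, map_sub, map_zsmul, evMat_lam_prod, evMat_lam_prod]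
  simp only [eval_sub, eval_neg, eval_X]
  congr 4 <;> ring_nf

theorem evMat_X_smul (d t : k) (A : Matrix (Fin 2) (Fin 2) k[X][X]) :
    evMat d t ((X : k[X]) • A) = d • evMat d t A := by rw [evMat_smul, eval_X]

theorem cend_sesq : Sesq (cendProd k) where
  left n A B := by
    refine lam_injective (k := k) (cend_loc _ B)
      ((cend_loc A B).pred.smul fun n => (n : k)).neg (fun l => ?_) n
    rw [lam_neg _ ((cend_loc A B).pred.smul fun n => (n : k)), lam_shift _ (cend_loc A B)]
    refine evMat_injective fun d t => ?_
    rw [map_neg, evMat_smul, evMat_lam_prod, evMat_lam_prod, evMat_X_smul]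
    simp
  right n A B := by
    refine lam_injective (k := k) (cend_loc A _)
      (((cend_loc A B).smul fun _ => (X : k[X])).add
        ((cend_loc A B).pred.smul fun n => (n : k))) (fun l => ?_) n
    rw [lam_add _ ((cend_loc A B).smul fun _ => (X : k[X]))
      ((cend_loc A B).pred.smul fun n => (n : k)), lam_shift _ (cend_loc A B),
      lam_smul _ _ (cend_loc A B)]
    refine evMat_injective fun d t => ?_
    rw [map_add, evMat_smul, evMat_smul, evMat_lam_prod, evMat_lam_prod, evMat_X_smul]
    simp [add_smul, mul_add]

/-- The parity subspaces of `Cend_2`. -/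
def cendPar (i : ZMod 2) : Submodule k[X] (Matrix (Fin 2) (Fin 2) k[X][X]) := (Cend2 k).parity i

theorem mem_cend_parity {i : ZMod 2} {A : Matrix (Fin 2) (Fin 2) k[X][X]} :
    A ∈ cendPar i ↔
      ∀ r c : Fin 2, ((r.val + c.val : ℕ) : ZMod 2) ≠ i → A r c = 0 := Iff.rfl

theorem mem_cend_parity_zero {A : Matrix (Fin 2) (Fin 2) k[X][X]} :
    A ∈ cendPar 0 ↔ A 0 1 = 0 ∧ A 1 0 = 0 := by
  rw [mem_cend_parity]
  refine ⟨fun h => ⟨h 0 1 (by decide), h 1 0 (by decide)⟩, fun h r c hrc => ?_⟩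
  fin_cases r <;> fin_cases c
  · exact absurd rfl hrc
  · exact h.1
  · exact h.2
  · exact absurd rfl hrc

theorem mem_cend_parity_one {A : Matrix (Fin 2) (Fin 2) k[X][X]} :
    A ∈ cendPar 1 ↔ A 0 0 = 0 ∧ A 1 1 = 0 := by
  rw [mem_cend_parity]
  refine ⟨fun h => ⟨h 0 0 (by decide), h 1 1 (by decide)⟩, fun h r c hrc => ?_⟩
  fin_cases r <;> fin_cases c
  · exact h.1
  · exact absurd rfl hrc
  · exact absurd rfl hrc
  · exact h.2

theorem zmod_two_cases (i : ZMod 2) : i = 0 ∨ i = 1 := by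
  revert i; decide

theorem cend_isCompl : IsCompl (cendPar (k := k) 0) (cendPar 1) := by
  constructor
  · rw [Submodule.disjoint_def]
    intro A h0 h1
    rw [mem_cend_parity_zero] at h0
    rw [mem_cend_parity_one] at h1
    ext1 r c
    fin_cases r <;> fin_cases c
    · exact h1.1
    · exact h0.1
    · exact h0.2
    · exact h1.2
  · rw [codisjoint_iff, eq_top_iff]
    intro A _
    rw [Submodule.mem_sup]
    refine ⟨(!![A 0 0, 0; 0, A 1 1] : Matrix (Fin 2) (Fin 2) k[X][X]),
      mem_cend_parity_zero.2 ⟨rfl, rfl⟩,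
      (!![0, A 0 1; A 1 0, 0] : Matrix (Fin 2) (Fin 2) k[X][X]),
      mem_cend_parity_one.2 ⟨rfl, rfl⟩, ?_⟩
    ext1 r c
    fin_cases r <;> fin_cases c <;> simp

theorem cend_mem_parity (i j : ZMod 2) (n : ℕ) (A B : Matrix (Fin 2) (Fin 2) k[X][X]) (hA : A ∈ cendPar i)
    (hB : B ∈ cendPar j) : cendProd k n A B ∈ cendPar (i + j) := by
  intro r c hrc
  rw [cendProd_apply]
  have : (Matrix.map A (cendL k) * Matrix.map B (cendR k)) r c = 0 := by
    rw [Matrix.mul_apply]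
    refine Finset.sum_eq_zero fun m _ => ?_
    by_cases h1 : ((r.val + m.val : ℕ) : ZMod 2) = i
    · by_cases h2 : ((m.val + c.val : ℕ) : ZMod 2) = j
      · exfalso
        apply hrc
        rw [← h1, ← h2]
        push_cast
        have h3 : ((m.val : ZMod 2)) + m.val = 0 := CharTwo.add_self_eq_zero _
        linear_combination -h3
      · have : Matrix.map B (cendR k) m c = 0 := by
          rw [Matrix.map_apply, hB m c h2, map_zero]
        rw [this, mul_zero]
    · have : Matrix.map A (cendL k) r m = 0 := by
        rw [Matrix.map_apply, hA r m h1, map_zero]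
      rw [this, zero_mul]
  simp [this]

theorem cend_assoc : IsAssociative (cendProd k) := by
  intro n m x y z
  refine lam_lam_injective (k := k) (evZero₂_right cend_loc cend_loc x y z)
    (evZero₂_conv (k := k) (evZero₂_left cend_loc cend_loc x y z)) (fun l m => ?_) n m
  rw [lam_lam_right cend_loc, lam_lam_conv cend_loc cend_loc]
  refine evMat_injective fun d t => ?_
  simp only [evMat_lam_prod, eval_C]
  rw [← mul_assoc]
  congr 3 <;> ring_nf

theorem cend_comm_skew {ε : ℤ} (hε : ε * ε = 1) (n : ℕ) (x y : Matrix (Fin 2) (Fin 2) k[X][X]) :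
    commL (cendProd k) cend_loc ε n x y =
      -(ε • curly (commL (cendProd k) cend_loc ε) n y x) := by
  have hl := commL_loc (cend_loc (k := k)) ε
  refine lam_injective (k := k) (hl x y) ((hl.curly y x).zsmul ε).neg (fun l => ?_) n
  rw [lam_neg _ ((hl.curly y x).zsmul ε), lam_zsmul _ _ (hl.curly y x), lam_curly hl]
  refine evMat_injective fun d t => ?_
  rw [map_neg, map_zsmul, evMat_lam_comm, evMat_lam_comm]
  simp only [eval_sub, eval_neg, eval_X, eval_C]
  rw [smul_sub, smul_smul, hε, one_smul, neg_sub]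
  congr 4 <;> ring_nf

theorem cend_leibniz (ε ε' : ℤ) (n m : ℕ)
    (x y z : Matrix (Fin 2) (Fin 2) k[X][X]) :
    commL (cendProd k) cend_loc (ε * ε') n x (cendProd k m y z) =
      ∑ s ∈ Finset.range (n + 1), (n.choose s : k) •
        cendProd k (n + m - s) (commL (cendProd k) cend_loc ε s x y) z
      + ε • cendProd k m y (commL (cendProd k) cend_loc ε' n x z) := by
  have hl := fun ε => commL_loc (cend_loc (k := k)) ε
  have e1 := evZero₂_right (hl (ε * ε')) cend_loc x y z
  have e2 := evZero₂_conv (k := k) (evZero₂_left cend_loc (hl ε) x y z)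
  have e3 := (evZero₂_right cend_loc (hl ε') y x z).swap.zsmul ε
  refine lam_lam_injective (k := k) e1 (e2.add e3) (fun l m => ?_) n m
  have h1 : ∀ n, lam (C m) (fun m => ∑ s ∈ Finset.range (n + 1), (n.choose s : k) •
        cendProd k (n + m - s) (commL (cendProd k) cend_loc ε s x y) z
      + ε • cendProd k m y (commL (cendProd k) cend_loc ε' n x z)) =
      lam (C m) (fun m => ∑ s ∈ Finset.range (n + 1), (n.choose s : k) •
        cendProd k (n + m - s) (commL (cendProd k) cend_loc ε s x y) z) +
      ε • lam (C m) (fun m => cendProd k m y (commL (cendProd k) cend_loc ε' n x z)) :=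
    fun n => by rw [lam_add _ (e2.right n) (e3.right n), lam_zsmul _ _ (cend_loc _ _)]
  have e4 := (evZero₂_right cend_loc (hl ε') y x z).swap.lam (C m)
  rw [lam_congr _ h1, lam_add _ (e2.lam _) (e4.zsmul ε), lam_zsmul _ _ e4, lam_lam_right cend_loc,
    lam_lam_conv cend_loc (hl ε), lam_lam_right_swap (hl ε') cend_loc]
  refine evMat_injective fun d t => ?_
  simp only [map_add, map_zsmul, evMat_lam_prod, evMat_lam_comm, eval_C, eval_add]
  have a1 : ∀ a b : k, -(a + b) + a = -b := fun a b => by ring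
  have a2 : d + (l + m) = d + l + m := by ring
  have a3 : t + (l + m) = t + l + m := by ring
  have a4 : t - -(l + m) - l = t + m := by ring
  have a5 : d + m + l = d + l + m := by ring
  have a6 : t + m + l = t + l + m := by ring
  have a7 : t + m - (d + m) - l = t - d - l := by ring
  simp only [a1, a2, a3, a4, a5, a6, a7, sub_mul, mul_sub, smul_sub, mul_assoc,
    smul_mul_assoc, mul_smul_comm, smul_smul]
  abel

theorem cend_jacobi {ε ε' ε'' : ℤ} (hε : ε * ε = 1) (n m : ℕ)
    (x y z : Matrix (Fin 2) (Fin 2) k[X][X]) :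
    commL (cendProd k) cend_loc (ε * ε') n x (commL (cendProd k) cend_loc ε'' m y z) -
      ε • commL (cendProd k) cend_loc (ε * ε'') m y (commL (cendProd k) cend_loc ε' n x z) =
      ∑ s ∈ Finset.range (n + 1), (n.choose s : k) •
        commL (cendProd k) cend_loc (ε' * ε'') (n + m - s)
          (commL (cendProd k) cend_loc ε s x y) z := by
  have hl := fun ε => commL_loc (cend_loc (k := k)) ε
  have e1 := evZero₂_right (hl (ε * ε')) (hl ε'') x y z
  have e2 := evZero₂_conv (k := k) (evZero₂_left (hl (ε' * ε'')) (hl ε) x y z)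
  have e3 := (evZero₂_right (hl (ε * ε'')) (hl ε') y x z).swap
  refine lam_lam_injective (k := k) (e1.sub (e3.zsmul ε)) e2 (fun l m => ?_) n m
  have h1 : ∀ n, lam (C m) (fun m => commL (cendProd k) cend_loc (ε * ε') n x
        (commL (cendProd k) cend_loc ε'' m y z) -
      ε • commL (cendProd k) cend_loc (ε * ε'') m y (commL (cendProd k) cend_loc ε' n x z)) =
      lam (C m) (fun m => commL (cendProd k) cend_loc (ε * ε') n x
        (commL (cendProd k) cend_loc ε'' m y z)) -
      ε • lam (C m) (fun m => commL (cendProd k) cend_loc (ε * ε'') m y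
        (commL (cendProd k) cend_loc ε' n x z)) :=
    fun n => by
      rw [lam_sub _ (e1.right n) ((e3.zsmul ε).right n), lam_zsmul _ _ (hl _ _ _)]
  have e4 := e3.lam (C m)
  rw [lam_congr _ h1, lam_sub _ (e1.lam _) (e4.zsmul ε), lam_zsmul _ _ e4, lam_lam_right (hl _),
    lam_lam_conv (hl _) (hl ε), lam_lam_right_swap (hl ε') (hl _)]
  refine evMat_injective fun d t => ?_
  simp only [map_sub, map_zsmul, evMat_lam_comm, eval_C]
  have a1 : ∀ a b : k, -(a + b) + a = -b := fun a b => by ring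
  have a2 : d + (l + m) = d + l + m := by ring
  have a3 : t + (l + m) = t + l + m := by ring
  have a4 : t - -(l + m) - l = t + m := by ring
  have a5 : d + m + l = d + l + m := by ring
  have a6 : t + m + l = t + l + m := by ring
  have a7 : t + m - (d + m) - l = t - d - l := by ring
  have a8 : t + l - (d + l) - m = t - d - m := by ring
  have a9 : t - (d + l) - m = t - d - (l + m) := by ring
  have a10 : t - (d + m) - l = t - d - (l + m) := by ring
  have a11 : t - d - (l + m) + l = t - d - m := by ring
  have a12 : t - d - (l + m) - -(l + m) - l = t - d - l := by ring
  simp only [a1, a2, a3, a4, a5, a6, a7, a8, a9, a10, a11, a12, sub_mul, mul_sub, smul_sub, mul_assoc,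
    smul_mul_assoc, mul_smul_comm, smul_smul]
  rcases (mul_self_eq_one_iff).1 hε with rfl | rfl
  · module
  · module

end CendEvaluation

section Relations

variable {k : Type u} [Field k] [CharZero k]
  {A : Type u} [AddCommGroup A] [Module k A] [Module k[X] A] [IsScalarTower k k[X] A]

theorem H_smul_smul (f : k[X]) (a : k) (x : A) : f • a • x = a • f • x := (smul_comm' a f x).symm

/-- Elements `v`, `g` of an associative conformal algebra subject to the commutation and locality
relations of the Neveu--Schwartz generators. -/
structure NSRel (p : ℕ → A →ₗ[k] A →ₗ[k] A) (v g : A) : Prop where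
  sesq : Sesq p
  assoc : IsAssociative p
  gg : ∀ n, 2 ≤ n → p n g g = 0
  vg : ∀ n, 2 ≤ n → p n v g = 0
  comm_gg : v = (-4 : k) • p 0 g g + (2 : k) • (X : k[X]) • p 1 g g
  comm_gv : p 1 g v + p 1 v g = (3 / 2 : k) • g

/-- The element `e = -4 g (1) g`. -/
def eElt (p : ℕ → A →ₗ[k] A →ₗ[k] A) (g : A) : A := (-4 : k) • p 1 g g

/-- The element `h = e (0) g`. -/
def hElt (p : ℕ → A →ₗ[k] A →ₗ[k] A) (g : A) : A := p 0 (eElt p g) g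

theorem IsAssociative.apply_one {p : ℕ → A →ₗ[k] A →ₗ[k] A} (ha : IsAssociative p) {x y : A}
    (h : ∀ n, 1 ≤ n → p n x y = 0) (n m : ℕ) (z : A) :
    p n x (p m y z) = p (n + m) (p 0 x y) z := by
  rw [ha, Finset.sum_range_succ', Finset.sum_eq_zero]
  · simp
  · intro s _
    rw [h _ (by omega)]
    simp

theorem IsAssociative.apply_two {p : ℕ → A →ₗ[k] A →ₗ[k] A} (ha : IsAssociative p) {x y : A}
    (h : ∀ n, 2 ≤ n → p n x y = 0) (n m : ℕ) (z : A) :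
    p n x (p m y z) = p (n + m) (p 0 x y) z + (n : k) • p (n + m - 1) (p 1 x y) z := by
  rw [ha]
  cases n with
  | zero => simp
  | succ n =>
    rw [Finset.sum_range_succ', Finset.sum_range_succ', Finset.sum_eq_zero]
    · simp [add_comm]
    · intro s _
      rw [h _ (by omega)]
      simp

theorem IsAssociative.zero {p : ℕ → A →ₗ[k] A →ₗ[k] A} (ha : IsAssociative p) (m : ℕ) (x y z : A) :
    p 0 x (p m y z) = p m (p 0 x y) z := by
  rw [ha]
  simp

namespace NSRel

variable {p : ℕ → A →ₗ[k] A →ₗ[k] A} {v g : A}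

local notation "e" => eElt p g
local notation "h" => hElt p g

theorem g1g : p 1 g g = (-1 / 4 : k) • e := by
  rw [eElt, smul_smul]
  norm_num

variable (r : NSRel p v g)
include r

theorem g0g : p 0 g g = (-1 / 4 : k) • v - (1 / 8 : k) • (X : k[X]) • e := by
  have h1 := r.comm_gg
  rw [g1g, H_smul_smul] at h1
  generalize (X : k[X]) • e = y at *
  rw [h1]
  module

theorem GG (n m : ℕ) (w : A) : p n g (p m g w) =
    (-1 / 4 : k) • p (n + m) v w - (((n : k) - m) / 8) • p (n + m - 1) e w := by
  rw [r.assoc.apply_two r.gg, r.g0g, g1g]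
  simp only [map_sub, map_smul, LinearMap.sub_apply, LinearMap.smul_apply, r.sesq.left]
  push_cast
  module

theorem e_g (n : ℕ) (hn : 1 ≤ n) : p n e g = 0 := by
  have h1 := r.GG 0 (n + 1) g
  rw [r.gg _ (by omega), map_zero, zero_add, r.vg _ (by omega), Nat.add_sub_cancel] at h1
  have h2 : ((n : k) + 1) ≠ 0 := by exact_mod_cast n.succ_ne_zero
  have h3 : (((n : k) + 1) / 8) • p n e g = 0 := by
    rw [h1]
    push_cast
    module
  rcases smul_eq_zero.1 h3 with h4 | h4
  · field_simp at h4
    simp [h2] at h4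
  · exact h4

theorem g_e (n : ℕ) (hn : 1 ≤ n) : p n g e = 0 := by
  rw [eElt, map_smul, r.GG, r.vg _ (by omega), Nat.add_sub_cancel, r.e_g n hn]
  simp

theorem v1g : p 1 v g = g - (1 / 2 : k) • h := by
  have h1 := r.comm_gv
  have h2 : p 1 g v = (-4 : k) • p 1 g (p 0 g g) + (2 : k) • p 0 g (p 1 g g) := by
    conv_lhs => rw [r.comm_gg]
    have h3 := r.g_e 1 le_rfl
    have h4 : p 1 g (p 1 g g) = 0 := by rw [g1g, map_smul, h3, smul_zero]
    simp only [map_add, map_smul, r.sesq.right, h4]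
    simp
  have h5 := r.GG 1 0 g
  have h6 := r.GG 0 1 g
  have h7 : p 0 e g = h := rfl
  simp only [Nat.add_zero, Nat.zero_add, Nat.sub_self, h7] at h5 h6
  rw [h2, h5, h6] at h1
  have h8 : (3 / 2 : k) • p 1 v g = (3 / 2 : k) • g - (3 / 4 : k) • h := by
    rw [← h1]
    push_cast
    module
  have h9 : p 1 v g = (2 / 3 : k) • (3 / 2 : k) • p 1 v g := by module
  rw [h9, h8]
  module

theorem g0e : p 0 g e = g - h := by
  have h6 := r.GG 0 1 g
  have h7 : p 0 e g = h := rfl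
  simp only [Nat.zero_add, Nat.sub_self, h7] at h6
  rw [eElt, map_smul, h6, r.v1g]
  push_cast
  module

theorem EG (n m : ℕ) (w : A) :
    p n e (p m g w) = p (n + m) g w - p 0 g (p (n + m) e w) := by
  rw [r.assoc.apply_one r.e_g, r.assoc.zero, r.g0e, ← LinearMap.sub_apply, ← map_sub]
  congr 2
  rw [sub_sub_cancel]
  rfl

theorem GE (n m : ℕ) (w : A) : p n g (p m e w) = p 0 g (p (n + m) e w) := by
  rw [r.assoc.apply_one r.g_e, r.assoc.zero]

theorem e_e (n : ℕ) : p n e e = (-4 : k) • p (n + 1) g g := by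
  conv_lhs => rw [show p n e e = (-4 : k) • p n e (p 1 g g) by rw [eElt, map_smul]]
  rw [r.EG, r.e_g _ (by omega), map_zero, sub_zero]

theorem e0e : p 0 e e = e := r.e_e 0

theorem e_e' (n : ℕ) (hn : 1 ≤ n) : p n e e = 0 := by
  rw [r.e_e, r.gg _ (by omega), smul_zero]

theorem EE (n m : ℕ) (w : A) : p n e (p m e w) = p (n + m) e w := by
  rw [r.assoc.apply_one r.e_e', r.e0e]

theorem V0 (w : A) : p 0 v w = (-4 : k) • p 0 g (p 0 g w) := by
  rw [r.GG]
  simp only [Nat.add_zero, sub_self, zero_div, zero_smul, sub_zero]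
  module

theorem V_eq (n : ℕ) (w : A) :
    p n v w = (-4 : k) • p n g (p 0 g w) - ((n : k) / 2) • p (n - 1) e w := by
  rw [r.GG]
  simp only [Nat.add_zero]
  push_cast
  module

theorem G_G0 (n : ℕ) (w : A) :
    p n g (p 0 g w) = p 0 g (p n g w) - ((n : k) / 4) • p (n - 1) e w := by
  rw [r.GG, r.GG]
  simp only [Nat.add_zero, Nat.zero_add]
  push_cast
  module

/-- `[g (n) ·, v (0) ·] = n g (n-1) ·`. -/
theorem G_V0 (n : ℕ) (w : A) :
    p n g (p 0 v w) = p 0 v (p n g w) + (n : k) • p (n - 1) g w := by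
  rw [r.V0, r.V0, map_smul, r.G_G0, r.G_G0, map_sub, map_smul]
  cases n with
  | zero => simp
  | succ n =>
    rw [Nat.add_sub_cancel, r.EG]
    simp only [Nat.add_zero]
    module

/-- `[e (n) ·, v (0) ·] = n e (n-1) ·`. -/
theorem E_V0 (n : ℕ) (w : A) :
    p n e (p 0 v w) = p 0 v (p n e w) + (n : k) • p (n - 1) e w := by
  rw [r.V0, r.V0, map_smul, r.EG, Nat.add_zero, r.EG, r.G_G0, Nat.add_zero, map_sub]
  module

/-- `[v (n) ·, v (0) ·] = n v (n-1) ·`. -/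
theorem V_V0 (n : ℕ) (w : A) :
    p n v (p 0 v w) = p 0 v (p n v w) + (n : k) • p (n - 1) v w := by
  rw [r.V_eq n, r.V_eq n w, r.V_eq (n - 1) w, r.E_V0]
  cases n with
  | zero => simp [r.G_V0]
  | succ n =>
    simp only [Nat.add_sub_cancel, map_sub, map_smul, r.G_V0, Nat.cast_zero, zero_smul,
      add_zero]
    push_cast
    module

theorem g0h : p 0 g h = (-1 / 4 : k) • v - (1 / 8 : k) • (X : k[X]) • e + (1 / 4 : k) • p 0 v e := by
  have : h = g - p 0 g e := by rw [r.g0e]; abel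
  rw [this, map_sub, r.V0, r.g0g]
  generalize (X : k[X]) • e = y
  module

theorem g_h (n : ℕ) (hn : 1 ≤ n) : p n g h = 0 := by
  rw [hElt, r.GE, Nat.add_zero, r.e_g n hn, map_zero]

theorem v_eq : v = (-4 : k) • p 0 g g - (1 / 2 : k) • (X : k[X]) • e := by
  rw [r.g0g]
  generalize (X : k[X]) • e = y
  module

theorem g0v : p 0 g v = p 0 v g - (1 / 2 : k) • (X : k[X]) • (g - h) := by
  conv_lhs => rw [r.v_eq]
  rw [map_sub, map_smul, map_smul, r.sesq.right, r.g0e, r.V0]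
  simp

theorem g1v : p 1 g v = (1 / 2 : k) • g + (1 / 2 : k) • h := by
  have h1 := r.comm_gv
  rw [r.v1g] at h1
  have : p 1 g v = (3 / 2 : k) • g - (g - (1 / 2 : k) • h) := by rw [← h1]; abel
  rw [this]
  module

theorem g_v (n : ℕ) (hn : 2 ≤ n) : p n g v = 0 := by
  conv_lhs => rw [r.v_eq]
  rw [map_sub, map_smul, map_smul, r.sesq.right, r.g_e _ (by omega), r.g_e _ (by omega), r.G_G0,
    r.gg _ hn, r.e_g _ (by omega)]
  simp

theorem e0v : p 0 e v = p 0 v e - (1 / 2 : k) • (X : k[X]) • e := by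
  conv_lhs => rw [r.v_eq]
  rw [map_sub, map_smul, map_smul, r.sesq.right, r.e0e, r.EG]
  have h7 : p 0 e g = h := rfl
  simp only [Nat.add_zero, h7, r.g0h, r.g0g]
  generalize (X : k[X]) • e = y
  push_cast
  module

theorem e1v : p 1 e v = (1 / 2 : k) • e := by
  conv_lhs => rw [r.v_eq]
  rw [map_sub, map_smul, map_smul, r.sesq.right, r.e_e' 1 le_rfl, r.EG, Nat.add_zero,
    r.e_g 1 le_rfl, g1g, Nat.sub_self, r.e0e]
  simp
  module

theorem e_v (n : ℕ) (hn : 2 ≤ n) : p n e v = 0 := by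
  conv_lhs => rw [r.v_eq]
  rw [map_sub, map_smul, map_smul, r.sesq.right, r.e_e' n (by omega), r.EG, Nat.add_zero,
    r.e_g n (by omega), r.gg _ hn, r.e_e' _ (by omega)]
  simp

theorem e_h (n : ℕ) : p n e h = p n e g := by
  rw [hElt, r.EE, Nat.add_zero]

theorem v1v : p 1 v v = v + (1 / 4 : k) • (X : k[X]) • e := by
  rw [r.V_eq, r.g0v, map_sub, map_smul, r.sesq.right, r.G_V0, map_sub, map_sub, r.g_h _ le_rfl,
    g1g, r.g0g, r.g0h, Nat.sub_self, r.e0v]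
  simp only [smul_sub, H_smul_smul, smul_zero]
  generalize (X : k[X]) • e = y
  simp
  module

theorem v2v : p 2 v v = (1 / 2 : k) • e := by
  rw [r.V_eq, r.g0v, map_sub, map_smul, r.sesq.right, r.G_V0, map_sub, map_sub, r.g_h _ (by omega),
    r.gg 2 le_rfl, r.g_h _ (by omega)]
  simp [g1g, r.e1v]
  module

theorem v_v (n : ℕ) (hn : 3 ≤ n) : p n v v = 0 := by
  rw [r.V_eq, r.g0v, map_sub, map_smul, r.sesq.right, r.G_V0, map_sub, map_sub, r.g_h _ (by omega),
    r.gg n (by omega), r.g_h _ (by omega), r.gg _ (by omega), r.e_v _ (by omega)]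
  simp

theorem v1e : p 1 v e = (1 / 2 : k) • e := by
  rw [r.V_eq, r.g0e, map_sub, r.g_h _ le_rfl, g1g, Nat.sub_self, r.e0e]
  push_cast
  module

theorem v_e (n : ℕ) (hn : 2 ≤ n) : p n v e = 0 := by
  rw [r.V_eq, r.g0e, map_sub, r.g_h _ (by omega), r.gg _ hn, r.e_e' _ (by omega)]
  simp

theorem v1h : p 1 v h = (1 / 2 : k) • h := by
  rw [r.V_eq, r.g0h]
  simp only [map_add, map_sub, map_smul, r.sesq.right, r.G_V0, r.g1v, r.g_e 1 le_rfl, Nat.sub_self,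
    r.e_h, r.g0e]
  have h7 : p 0 e g = h := rfl
  rw [h7]
  simp
  module

theorem v_h (n : ℕ) (hn : 2 ≤ n) : p n v h = 0 := by
  rw [r.V_eq, r.g0h]
  simp only [map_add, map_sub, map_smul, r.sesq.right, r.G_V0, r.g_v n hn, r.g_e n (by omega),
    r.e_h, r.g_e (n - 1) (by omega), r.e_g (n - 1) (by omega)]
  simp

end NSRel

end Relations

section TableLemmas

variable {k : Type u} [Field k] {ι : Type}

theorem divCoeff_apply (n : ℕ) (t : k[X][X]) : divCoeff k n t = (n.factorial : k) • t.coeff n := rfl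

theorem tableProd_single (T : ι → ι → (ι →₀ k[X][X])) (n : ℕ) (i j : ι) (f h : k[X]) :
    tableProd T n (Finsupp.single i f) (Finsupp.single j h) =
      Finsupp.mapRange.linearMap (divCoeff k n) ((substL k f * substR k h) • T i j) := by
  simp [tableProd, tableAux]

theorem tableProd_single_one (T : ι → ι → (ι →₀ k[X][X])) (n : ℕ) {i j m : ι} {t : k[X][X]}
    (hT : T i j = Finsupp.single m t) :
    tableProd T n (Finsupp.single i 1) (Finsupp.single j 1) =
      ((n.factorial : k) • t.coeff n) • Finsupp.single m (1 : k[X]) := by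
  rw [tableProd_single, hT]
  simp [divCoeff_apply]

theorem neg_ll_mul (t : k[X][X]) : -ll k * t = -(ll k * t) := by ring

theorem divCoeff_neg_ll_mul (n : ℕ) (t : k[X][X]) :
    divCoeff k n (-ll k * t) = -((n : k) • divCoeff k (n - 1) t) := by
  rw [neg_ll_mul, map_neg, neg_inj, divCoeff_apply, divCoeff_apply, ll]
  cases n with
  | zero => simp
  | succ n =>
    rw [coeff_X_mul, Nat.add_sub_cancel, smul_smul, Nat.factorial_succ]
    push_cast
    ring_nf

theorem divCoeff_dd_add_ll_mul (n : ℕ) (t : k[X][X]) :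
    divCoeff k n ((dd k + ll k) * t) = X * divCoeff k n t + (n : k) • divCoeff k (n - 1) t := by
  have h1 := divCoeff_neg_ll_mul n t
  rw [neg_ll_mul, map_neg, neg_inj] at h1
  rw [add_mul, map_add, h1, divCoeff_apply n t, divCoeff_apply n (dd k * t), dd, coeff_C_mul,
    mul_smul_comm]

theorem tableProd_sesq (T : ι → ι → (ι →₀ k[X][X])) : Sesq (tableProd T) where
  left n x y := by
    induction x using Finsupp.induction_linear with
    | zero => simp
    | add x x' hx hx' =>
      simp only [smul_add, map_add, LinearMap.add_apply, hx, hx']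
      abel
    | single i f =>
      induction y using Finsupp.induction_linear with
      | zero => simp
      | add y y' hy hy' =>
        simp only [smul_add, map_add, hy, hy']
        abel
      | single j h =>
        rw [Finsupp.smul_single, tableProd_single, tableProd_single]
        ext1 m
        simp only [smul_eq_mul, map_mul, Finsupp.mapRange.linearMap_apply, Finsupp.mapRange_apply,
          Finsupp.smul_apply, Finsupp.neg_apply]
        rw [← divCoeff_neg_ll_mul]
        congr 1
        simp [substL]
        ring
  right n x y := by
    induction x using Finsupp.induction_linear with
    | zero => simp
    | add x x' hx hx' =>
      simp only [smul_add, map_add, LinearMap.add_apply, hx, hx']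
      abel
    | single i f =>
      induction y using Finsupp.induction_linear with
      | zero => simp
      | add y y' hy hy' =>
        simp only [smul_add, map_add, hy, hy']
        abel
      | single j h =>
        rw [Finsupp.smul_single, tableProd_single, tableProd_single, tableProd_single]
        ext1 m
        simp only [smul_eq_mul, map_mul, Finsupp.mapRange.linearMap_apply, Finsupp.mapRange_apply,
          Finsupp.smul_apply, Finsupp.add_apply]
        rw [← divCoeff_dd_add_ll_mul]
        congr 1
        simp [substR]
        ring

end TableLemmas

section LambdaTables

variable {k : Type u} [Field k]
  {M : Type u} [AddCommGroup M] [Module k M] [Module k[X] M] [IsScalarTower k k[X] M]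

theorem evZero_table (t : k[X][X]) (m : M) :
    EvZero (fun n => ((n.factorial : k) • t.coeff n) • m) :=
  ⟨t.natDegree + 1, fun n hn => by
    simp only [coeff_eq_zero_of_natDegree_lt (show t.natDegree < n by omega), smul_zero, zero_smul]⟩

theorem lam_table [CharZero k] (s : k[X]) (t : k[X][X]) (m : M) :
    lam s (fun n => ((n.factorial : k) • t.coeff n) • m) = t.eval s • m := by
  rw [lam_eq_sum (N := t.natDegree + 1) s fun n hn => by
    rw [coeff_eq_zero_of_natDegree_lt (show t.natDegree < n by omega), smul_zero, zero_smul],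
    eval_eq_sum_range, Finset.sum_smul]
  refine Finset.sum_congr rfl fun n _ => ?_
  have h5 : (n.factorial : k) ≠ 0 := by exact_mod_cast n.factorial_ne_zero
  rw [smul_smul]
  congr 1
  rw [smul_eq_C_mul]
  have : (C ((n.factorial : k)⁻¹) : k[X]) * C (n.factorial : k) = 1 := by
    rw [← C_mul, inv_mul_cancel₀ h5, C_1]
  linear_combination (s ^ n * t.coeff n) * this

end LambdaTables

section EnvelopeRelations

variable {k : Type u} [Field k] [CharZero k]

theorem K1_prod_gen (n : ℕ) {a b c : NSGen} {t : k[X][X]}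
    (h : nsTable k a b = Finsupp.single c t) :
    (K1 k).prod n (K1.gen k a) (K1.gen k b) = ((n.factorial : k) • t.coeff n) • K1.gen k c :=
  tableProd_single_one (nsTable k) n h

theorem K1_gen_mem (a : NSGen) : K1.gen k a ∈ (K1 k).parity a.par :=
  Finsupp.single_mem_supported k[X] (1 : k[X]) (show a ∈ {b : NSGen | b.par = a.par} from rfl)

theorem K1_parity_le (i : ZMod 2) :
    (K1 k).parity i ≤ Submodule.span k[X] (K1.gen k '' {a | a.par = i}) :=
  le_of_eq (Finsupp.supported_eq_span_single k[X] {a : NSGen | a.par = i})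

theorem K1_span : Submodule.span k[X] (Set.range (K1.gen k)) = ⊤ := by
  have h := Finsupp.supported_eq_span_single k[X] (Set.univ : Set NSGen)
  rw [Finsupp.supported_univ, Set.image_univ] at h
  exact h.symm

theorem sgn_zero_left (j : ZMod 2) : sgn 0 j = 1 := by simp [sgn]

theorem sgn_zero_right (j : ZMod 2) : sgn j 0 = 1 := by simp [sgn]

theorem sgn_one_one : sgn 1 1 = -1 := by decide

theorem sgn_mul_self (i j : ZMod 2) : sgn i j * sgn i j = 1 := by
  revert i j; decide

theorem sgn_comm (i j : ZMod 2) : sgn i j = sgn j i := by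
  revert i j; decide

theorem sgn_add_right (i j l : ZMod 2) : sgn i (j + l) = sgn i j * sgn i l := by
  revert i j l; decide

theorem sgn_add_left (i j l : ZMod 2) : sgn (i + j) l = sgn i l * sgn j l := by
  revert i j l; decide

theorem curly_two {A : Type u} [AddCommGroup A] [Module k A] [Module k[X] A]
    [IsScalarTower k k[X] A] {p : ℕ → A →ₗ[k] A →ₗ[k] A} {y x : A}
    (h : ∀ n, 2 ≤ n → p n y x = 0) (n : ℕ) :
    curly p n y x = (C ((-1) ^ n) : k[X]) • (p n y x - (X : k[X]) • p (n + 1) y x) := by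
  rw [curly_eq_lam, lam_eq_sum (N := 2) _ fun m hm => h _ (by omega)]
  simp [Finset.sum_range_succ, sub_eq_add_neg]

variable {A : ConfData k} {φ : K1 k →ₗ[k[X]] A}

theorem IsEnvelope.nsRel (h : IsEnvelope (K1 k) (K1.gen k) NSGen.loc A φ) :
    NSRel A.prod (φ (K1.gen k .v)) (φ (K1.gen k .g)) where
  sesq := h.conformal.sesq
  assoc := h.assoc
  gg := fun n hn => h.locality .g .g n hn
  vg := fun n hn => h.locality .v .g n hn
  comm_gg := by
    have h1 := h.map_bracket 1 1 0 _ _ (K1_gen_mem .g) (K1_gen_mem .g)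
    rw [K1_prod_gen (k := k) (a := .g) (b := .g) 0 rfl, map_smul, ConfData.comm, sgn_one_one,
      curly_two fun n hn => h.locality .g .g n hn] at h1
    simp only [coeff_neg, coeff_C_zero, Nat.factorial_zero, Nat.cast_one, one_smul, pow_zero, C_1,
      neg_smul, zero_add, C_smul'] at h1
    rw [sub_neg_eq_add] at h1
    have h2 : φ (K1.gen k .v) = (-2 : k) • -((1 / 2 : k) • φ (K1.gen k .v)) := by module
    rw [h2, h1]
    generalize (X : k[X]) • A.prod 1 (φ (K1.gen k .g)) (φ (K1.gen k .g)) = y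
    module
  comm_gv := by
    have h1 := h.map_bracket 1 0 1 _ _ (K1_gen_mem .g) (K1_gen_mem .v)
    rw [K1_prod_gen (k := k) (a := .g) (b := .v) 1 rfl, map_smul, ConfData.comm, sgn_zero_right,
      curly_two fun n hn => h.locality .v .g n hn] at h1
    rw [h.locality .v .g 2 le_rfl] at h1
    simp [dd, ll, coeff_X] at h1
    rw [← h1, k_smul_eq]

theorem IsEnvelope.v_mem (h : IsEnvelope (K1 k) (K1.gen k) NSGen.loc A φ) :
    φ (K1.gen k .v) ∈ A.parity 0 := h.map_parity 0 _ (K1_gen_mem .v)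

theorem IsEnvelope.g_mem (h : IsEnvelope (K1 k) (K1.gen k) NSGen.loc A φ) :
    φ (K1.gen k .g) ∈ A.parity 1 := h.map_parity 1 _ (K1_gen_mem .g)

theorem parity_k_smul {A : ConfData k} {i : ZMod 2} (a : k) {x : A} (hx : x ∈ A.parity i) :
    a • x ∈ A.parity i := by
  rw [k_smul_eq]
  exact Submodule.smul_mem _ _ hx

theorem IsEnvelope.e_mem (h : IsEnvelope (K1 k) (K1.gen k) NSGen.loc A φ) :
    eElt A.prod (φ (K1.gen k .g)) ∈ A.parity 0 :=
  parity_k_smul _ (h.conformal.mem_parity 1 1 1 _ _ h.g_mem h.g_mem)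

theorem IsEnvelope.h_mem (h : IsEnvelope (K1 k) (K1.gen k) NSGen.loc A φ) :
    hElt A.prod (φ (K1.gen k .g)) ∈ A.parity 1 :=
  h.conformal.mem_parity 0 1 0 _ _ h.e_mem h.g_mem

/-- An `H`-linear map on `K_1` is compatible with the brackets as soon as it is on generators. -/
theorem map_bracket_of_gen (hl : Loc A.prod) (hs : Sesq A.prod)
    (H : ∀ (a b : NSGen) (n : ℕ), φ ((K1 k).prod n (K1.gen k a) (K1.gen k b)) =
      A.comm a.par b.par n (φ (K1.gen k a)) (φ (K1.gen k b)))
    (i j : ZMod 2) (n : ℕ) (y z : K1 k) (hy : y ∈ (K1 k).parity i) (hz : z ∈ (K1 k).parity j) :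
    φ ((K1 k).prod n y z) = A.comm i j n (φ y) (φ z) := by
  refine sesq_hom_ext (q := commL A.prod hl (sgn i j)) (tableProd_sesq (nsTable k))
    (commL_sesq hl hs _) φ ?_ n (K1_parity_le i hy) (K1_parity_le j hz)
  rintro n _ ⟨a, rfl, rfl⟩ _ ⟨b, rfl, rfl⟩
  exact H a b n

/-- Left multiplication by `v` with index `0`, as an `H`-linear map. -/
def zeroMulL {M : Type u} [AddCommGroup M] [Module k M] [Module k[X] M] [IsScalarTower k k[X] M]
    {p : ℕ → M →ₗ[k] M →ₗ[k] M} (hs : Sesq p) (v : M) : M →ₗ[k[X]] M where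
  toFun := p 0 v
  map_add' := map_add _
  map_smul' f x := by
    let S : Submodule k[X] (M × M) := Submodule.ofStable
      { carrier := {z | p 0 v z.1 = z.2}
        add_mem' := fun {a b} ha hb => by
          change p 0 v (a.1 + b.1) = a.2 + b.2
          rw [map_add, ha, hb]
        zero_mem' := map_zero _
        smul_mem' := fun c z hz => by
          change p 0 v (c • z.1) = c • z.2
          rw [map_smul, hz] }
      (fun z (hz : p 0 v z.1 = z.2) => by
        change p 0 v ((X : k[X]) • z.1) = (X : k[X]) • z.2
        rw [hs.right, hz]
        simp)
    exact S.smul_mem f (show (x, p 0 v x) ∈ S from rfl)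

/-- `f ↦ f(v (0) ·) m`. -/
def polyAct {M : Type u} [AddCommGroup M] [Module k M] [Module k[X] M] [IsScalarTower k k[X] M]
    {p : ℕ → M →ₗ[k] M →ₗ[k] M} (hs : Sesq p) (v m : M) : k[X][X] →ₗ[k[X]] M :=
  LinearMap.applyₗ m ∘ₗ (aeval (zeroMulL hs v)).toLinearMap

section PolyAct

variable {M : Type u} [AddCommGroup M] [Module k M] [Module k[X] M] [IsScalarTower k k[X] M]
    {p : ℕ → M →ₗ[k] M →ₗ[k] M} (hs : Sesq p) (v m : M)

theorem polyAct_one : polyAct hs v m 1 = m := by simp [polyAct]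

theorem polyAct_X_mul (f : k[X][X]) : polyAct hs v m (X * f) = p 0 v (polyAct hs v m f) := by
  simp [polyAct]
  rfl

theorem polyAct_mem (S : Submodule k[X] M) (hm : m ∈ S) (hS : ∀ x ∈ S, p 0 v x ∈ S)
    (f : k[X][X]) : polyAct hs v m f ∈ S := by
  induction f using Polynomial.induction_on with
  | C a =>
    have : (C a : k[X][X]) = a • 1 := by rw [smul_eq_C_mul, mul_one]
    rw [this, map_smul, polyAct_one]
    exact S.smul_mem _ hm
  | add f g hf hg => rw [map_add]; exact S.add_mem hf hg
  | monomial n a h =>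
    have : (C a * X ^ (n + 1) : k[X][X]) = X * (C a * X ^ n) := by ring
    rw [this, polyAct_X_mul]
    exact hS _ h

/-- `(f₀, f₁, f₂, f₃) ↦ f₀(v (0) ·) v + f₁(v (0) ·) e + f₂(v (0) ·) g + f₃(v (0) ·) h`. -/
def normalForm (v g : M) : k[X][X] × k[X][X] × k[X][X] × k[X][X] →ₗ[k[X]] M :=
  (polyAct hs v v).coprod ((polyAct hs v (eElt p g)).coprod
    ((polyAct hs v g).coprod (polyAct hs v (hElt p g))))

theorem normalForm_apply (v g : M) (f₀ f₁ f₂ f₃ : k[X][X]) :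
    normalForm hs v g (f₀, f₁, f₂, f₃) = polyAct hs v v f₀ + (polyAct hs v (eElt p g) f₁ +
      (polyAct hs v g f₂ + polyAct hs v (hElt p g) f₃)) := rfl

theorem normalForm_X_mul (v g : M) (f : k[X][X] × k[X][X] × k[X][X] × k[X][X]) :
    normalForm hs v g (X * f.1, X * f.2.1, X * f.2.2.1, X * f.2.2.2) =
      p 0 v (normalForm hs v g f) := by
  obtain ⟨f₀, f₁, f₂, f₃⟩ := f
  simp only [normalForm_apply, polyAct_X_mul, map_add]

end PolyAct

end EnvelopeRelations

section Model

variable (k : Type u) [Field k]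

/-- The matrices whose first row is divisible by `x`. -/
def cendSub : Submodule k[X] (Matrix (Fin 2) (Fin 2) k[X][X]) where
  carrier := {A | ∀ c, X ∣ A 0 c}
  add_mem' := fun ha hb c => dvd_add (ha c) (hb c)
  zero_mem' := fun _ => dvd_zero _
  smul_mem' := fun t A ha c => by
    rw [Matrix.smul_apply, smul_eq_C_mul]
    exact dvd_mul_of_dvd_right (ha c) _

variable {k}

theorem cendProd_mem_cendSub (n : ℕ) (A B : Matrix (Fin 2) (Fin 2) k[X][X]) (hA : A ∈ cendSub k) :
    cendProd k n A B ∈ cendSub k := by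
  intro c
  rw [cendProd_apply]
  have h1 : C (X : k[X][X]) ∣ (A.map (cendL k) * B.map (cendR k)) 0 c := by
    rw [Matrix.mul_apply]
    refine Finset.dvd_sum fun m _ => dvd_mul_of_dvd_left ?_ _
    obtain ⟨f, hf⟩ := hA m
    rw [Matrix.map_apply, hf, map_mul]
    refine dvd_mul_of_dvd_left ?_ _
    simp [cendL]
  obtain ⟨q, hq⟩ := h1
  have h2 : ((n.factorial : k) • (A.map (cendL k) * B.map (cendR k)).map fun t => t.coeff n) 0 c =
      (n.factorial : k) • ((A.map (cendL k) * B.map (cendR k)) 0 c).coeff n := rfl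
  rw [h2, hq, coeff_C_mul, ← mul_smul_comm]
  exact dvd_mul_right _ _

variable (k) in
/-- The conformal algebra of matrices whose first row is divisible by `x`. -/
def cendQData : ConfData k where
  carrier := cendSub k
  parity i := (cendPar i).comap (cendSub k).subtype
  prod n := restrict (cendSub k) (cendProd k n) fun x y hx _ => cendProd_mem_cendSub n x y hx

variable (k) in
/-- The embedding of the model into the matrices. -/
def qVal : cendQData k →ₗ[k[X]] Matrix (Fin 2) (Fin 2) k[X][X] := (cendSub k).subtype

theorem qVal_injective : Function.Injective (qVal k) := Subtype.val_injective

theorem qVal_prod (n : ℕ) (x y : cendQData k) :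
    qVal k ((cendQData k).prod n x y) = cendProd k n (qVal k x) (qVal k y) := rfl

theorem qVal_mem (x : cendQData k) : qVal k x ∈ cendSub k := Subtype.property (p := (· ∈ cendSub k)) x

variable (k)

/-- `diag(x, x - ∂/2)`. -/
def vMatrix : Matrix (Fin 2) (Fin 2) k[X][X] := !![X, 0; 0, X - C ((1 / 2 : k) • X)]

/-- `(0, x; -1, 0) / 2`. -/
def gMatrix : Matrix (Fin 2) (Fin 2) k[X][X] := (1 / 2 : k) • !![0, X; -1, 0]

/-- The matrix unit `E₂₂`. -/
def eMatrix : Matrix (Fin 2) (Fin 2) k[X][X] := !![0, 0; 0, 1]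

/-- `-E₂₁ / 2`. -/
def hMatrix : Matrix (Fin 2) (Fin 2) k[X][X] := (-1 / 2 : k) • !![0, 0; 1, 0]

/-- `v` as an element of the model. -/
def vQ : cendQData k :=
  (⟨vMatrix k, fun c => by fin_cases c <;> simp [vMatrix]⟩ : cendSub k)

/-- `g` as an element of the model. -/
def gQ : cendQData k :=
  (⟨gMatrix k, fun c => by
    fin_cases c
    · simp [gMatrix]
    · simp only [gMatrix, Matrix.smul_apply]
      exact ⟨(1 / 2 : k) • 1, by simp⟩⟩ : cendSub k)

theorem qVal_vQ : qVal k (vQ k) = vMatrix k := rfl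

theorem qVal_gQ : qVal k (gQ k) = gMatrix k := rfl

variable {k}

theorem evMat_vMatrix (d t : k) : evMat d t (vMatrix k) = !![t, 0; 0, t - d / 2] := by
  ext r c
  fin_cases r <;> fin_cases c <;>
    simp [evMat_apply, vMatrix, evalEval, smul_eq_C_mul, div_eq_inv_mul]

theorem evMat_k_smul (d t a : k) (A : Matrix (Fin 2) (Fin 2) k[X][X]) :
    evMat d t (a • A) = a • evMat d t A := by
  rw [k_smul_eq a A, evMat_smul, eval_C]

theorem evMat_gMatrix (d t : k) : evMat d t (gMatrix k) = !![0, t / 2; -1 / 2, 0] := by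
  rw [gMatrix, evMat_k_smul]
  ext r c
  fin_cases r <;> fin_cases c <;>
    simp [evMat_apply, div_eq_inv_mul]

theorem evMat_eMatrix (d t : k) : evMat d t (eMatrix k) = !![0, 0; 0, 1] := by
  ext r c
  fin_cases r <;> fin_cases c <;> simp [evMat_apply, eMatrix]

theorem evMat_hMatrix (d t : k) : evMat d t (hMatrix k) = !![0, 0; -1 / 2, 0] := by
  rw [hMatrix, evMat_k_smul]
  ext r c
  fin_cases r <;> fin_cases c <;> simp [evMat_apply]

/-- The sequence `c₀, c₁, c₂, 0, 0, …`. -/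
def quad {M : Type u} [Zero M] (c₀ c₁ c₂ : M) : ℕ → M
  | 0 => c₀
  | 1 => c₁
  | 2 => c₂
  | _ => 0

theorem quad_evZero {M : Type u} [Zero M] (c₀ c₁ c₂ : M) : ∀ n, 3 ≤ n → quad c₀ c₁ c₂ n = 0 := by
  intro n hn
  match n, hn with
  | n + 3, _ => rfl

variable [CharZero k]

theorem eq_quad {c : ℕ → Matrix (Fin 2) (Fin 2) k[X][X]} (hc : EvZero c)
    (c₀ c₁ c₂ : Matrix (Fin 2) (Fin 2) k[X][X])
    (h : ∀ l d t : k, evMat d t (lam (C l) c) =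
      evMat d t c₀ + l • evMat d t c₁ + (l ^ 2 / 2) • evMat d t c₂) (n : ℕ) :
    c n = quad c₀ c₁ c₂ n := by
  refine lam_injective (k := k) hc ⟨3, quad_evZero c₀ c₁ c₂⟩ (fun l => evMat_injective fun d t => ?_) n
  rw [h, lam_eq_sum _ (quad_evZero c₀ c₁ c₂)]
  simp only [Finset.sum_range_succ, Finset.range_zero, Finset.sum_empty, map_add, evMat_smul, quad]
  simp [div_eq_mul_inv]

theorem q_loc : Loc (cendQData k).prod := by
  intro x y
  obtain ⟨N, hN⟩ := cend_loc (qVal k x) (qVal k y)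
  exact ⟨N, fun n hn => qVal_injective (hN n hn)⟩

theorem q_sesq : Sesq (cendQData k).prod where
  left n x y := qVal_injective (cend_sesq.left n (qVal k x) (qVal k y))
  right n x y := qVal_injective (cend_sesq.right n (qVal k x) (qVal k y))

theorem q_assoc : IsAssociative (cendQData k).prod := by
  intro n m x y z
  apply qVal_injective
  rw [map_sum]
  exact cend_assoc n m (qVal k x) (qVal k y) (qVal k z)

theorem q_isConformal : IsConformal (cendQData k).parity (cendQData k).prod where
  isCompl := by
    constructor
    · rw [Submodule.disjoint_def]
      intro A h0 h1
      exact qVal_injective (Submodule.disjoint_def.1 cend_isCompl.1 _ h0 h1)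
    · rw [codisjoint_iff, eq_top_iff]
      intro A _
      have hA := qVal_mem A
      rw [Submodule.mem_sup]
      refine ⟨(⟨!![qVal k A 0 0, 0; 0, qVal k A 1 1], fun c => ?_⟩ : cendSub k),
        mem_cend_parity_zero.2 ⟨rfl, rfl⟩,
        (⟨!![0, qVal k A 0 1; qVal k A 1 0, 0], fun c => ?_⟩ : cendSub k),
        mem_cend_parity_one.2 ⟨rfl, rfl⟩, ?_⟩
      · fin_cases c
        · exact hA 0
        · exact dvd_zero _
      · fin_cases c
        · exact dvd_zero _
        · exact hA 1
      · apply qVal_injective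
        change (!![qVal k A 0 0, 0; 0, qVal k A 1 1] + !![0, qVal k A 0 1; qVal k A 1 0, 0] :
          Matrix (Fin 2) (Fin 2) k[X][X]) = qVal k A
        ext1 r c
        fin_cases r <;> fin_cases c <;> simp
  mem_parity i j n x y hx hy := cend_mem_parity i j n (qVal k x) (qVal k y) hx hy
  locality := q_loc
  partial_left := q_sesq.left
  partial_right := q_sesq.right

/-- The images of the generators in the model. -/
def genQ (k : Type u) [Field k] : NSGen → cendQData k
  | .v => vQ k
  | .g => gQ k

/-- The embedding of `K_1` into the model. -/
def phiQ (k : Type u) [Field k] : K1 k →ₗ[k[X]] cendQData k :=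
  (Finsupp.linearCombination k[X] (genQ k) : (NSGen →₀ k[X]) →ₗ[k[X]] cendQData k)

theorem phiQ_gen (a : NSGen) : phiQ k (K1.gen k a) = genQ k a := by
  change Finsupp.linearCombination k[X] (genQ k) (Finsupp.single a 1) = _
  simp

theorem genQ_mem (a : NSGen) : genQ k a ∈ (cendQData k).parity a.par := by
  cases a
  · exact mem_cend_parity_zero.2 ⟨rfl, rfl⟩
  · refine mem_cend_parity_one.2 ⟨?_, ?_⟩ <;> simp [genQ, gQ, gMatrix]

theorem coe_q_comm (i j : ZMod 2) (n : ℕ) (x y : cendQData k) :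
    qVal k ((cendQData k).comm i j n x y) =
      commL (cendProd k) cend_loc (sgn i j) n (qVal k x) (qVal k y) := by
  have h := curly_map q_loc (qVal k) (fun n => qVal_prod n y x) n
  rw [commL_apply, ← h]
  rfl

theorem gg_quad (n : ℕ) : cendProd k n (gMatrix k) (gMatrix k) =
    quad ((-1 / 4 : k) • vMatrix k - (1 / 8 : k) • (X : k[X]) • eMatrix k)
      ((-1 / 4 : k) • eMatrix k) 0 n := by
  refine eq_quad (cend_loc _ _) _ _ _ (fun l d t => ?_) n
  rw [evMat_lam_prod]
  simp only [map_sub, map_zero, evMat_k_smul, evMat_X_smul, evMat_gMatrix, evMat_vMatrix,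
    evMat_eMatrix, eval_C]
  ext r c
  fin_cases r <;> fin_cases c <;> simp <;> ring

theorem vg_quad (n : ℕ) : cendProd k n (vMatrix k) (gMatrix k) =
    quad (cendProd k 0 (vMatrix k) (gMatrix k)) (gMatrix k - (1 / 2 : k) • hMatrix k) 0 n := by
  refine eq_quad (cend_loc _ _) _ _ _ (fun l d t => ?_) n
  rw [← lam_zero_left (k := k) (cend_loc _ _), evMat_lam_prod, evMat_lam_prod]
  simp only [map_sub, map_zero, evMat_k_smul, evMat_gMatrix, evMat_vMatrix,
    evMat_hMatrix, eval_C, eval_zero]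
  ext r c
  fin_cases r <;> fin_cases c <;> simp <;> ring

theorem gv_quad (n : ℕ) : cendProd k n (gMatrix k) (vMatrix k) =
    quad (cendProd k 0 (gMatrix k) (vMatrix k))
      ((1 / 2 : k) • gMatrix k + (1 / 2 : k) • hMatrix k) 0 n := by
  refine eq_quad (cend_loc _ _) _ _ _ (fun l d t => ?_) n
  rw [← lam_zero_left (k := k) (cend_loc _ _), evMat_lam_prod, evMat_lam_prod]
  simp only [map_add, map_zero, evMat_k_smul, evMat_gMatrix, evMat_vMatrix,
    evMat_hMatrix, eval_C, eval_zero]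
  ext r c
  fin_cases r <;> fin_cases c <;> simp <;> ring

theorem vv_quad (n : ℕ) : cendProd k n (vMatrix k) (vMatrix k) =
    quad (cendProd k 0 (vMatrix k) (vMatrix k))
      (vMatrix k + (1 / 4 : k) • (X : k[X]) • eMatrix k) ((1 / 2 : k) • eMatrix k) n := by
  refine eq_quad (cend_loc _ _) _ _ _ (fun l d t => ?_) n
  rw [← lam_zero_left (k := k) (cend_loc _ _), evMat_lam_prod, evMat_lam_prod]
  simp only [map_add, evMat_k_smul, evMat_vMatrix, evMat_X_smul,
    evMat_eMatrix, eval_C, eval_zero]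
  ext r c
  fin_cases r <;> fin_cases c <;> simp <;> ring

theorem eg_quad (n : ℕ) : cendProd k n (eMatrix k) (gMatrix k) = quad (hMatrix k) 0 0 n := by
  refine eq_quad (cend_loc _ _) _ _ _ (fun l d t => ?_) n
  rw [evMat_lam_prod]
  simp only [map_zero, evMat_eMatrix, evMat_gMatrix, evMat_hMatrix]
  ext r c
  fin_cases r <;> fin_cases c <;> simp

theorem quad_two {M : Type u} [Zero M] (c₀ c₁ : M) (n : ℕ) (hn : 2 ≤ n) : quad c₀ c₁ 0 n = 0 := by
  match n, hn with
  | 2, _ => rfl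
  | n + 3, _ => rfl

theorem comm_table {ε : ℤ} {A B D : Matrix (Fin 2) (Fin 2) k[X][X]} {T : k[X][X]}
    (h : ∀ l d t : k, evMat (-l) t A * evMat (d + l) (t + l) B -
      ε • (evMat (d + l) t B * evMat (-l) (t - d - l) A) = (T.eval (C l)).eval d • evMat d t D)
    (n : ℕ) : ((n.factorial : k) • T.coeff n) • D = commL (cendProd k) cend_loc ε n A B := by
  refine lam_injective (k := k) (evZero_table T D) (commL_loc cend_loc ε A B)
    (fun l => evMat_injective fun d t => ?_) n
  rw [lam_table, evMat_lam_comm, evMat_smul, ← h l d t]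
  simp only [eval_C]

theorem comm_vv (n : ℕ) {t : k[X][X]} (ht : nsTable k .v .v = Finsupp.single .v t) :
    ((n.factorial : k) • t.coeff n) • vMatrix k =
      commL (cendProd k) cend_loc 1 n (vMatrix k) (vMatrix k) := by
  have ht' : t = dd k + 2 * ll k := (Finsupp.single_injective _ ht).symm
  subst ht'
  refine comm_table (fun l d t => ?_) n
  have h : ((dd k + 2 * ll k : k[X][X]).eval (C l)).eval d = d + 2 * l := by
    simp [dd, ll]
  rw [h]
  simp only [evMat_vMatrix, one_smul]
  ext r c
  fin_cases r <;> fin_cases c <;> simp <;> ring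

theorem comm_vg (n : ℕ) {t : k[X][X]} (ht : nsTable k .v .g = Finsupp.single .g t) :
    ((n.factorial : k) • t.coeff n) • gMatrix k =
      commL (cendProd k) cend_loc 1 n (vMatrix k) (gMatrix k) := by
  have ht' : t = dd k + (3 / 2 : k) • ll k := (Finsupp.single_injective _ ht).symm
  subst ht'
  refine comm_table (fun l d t => ?_) n
  have h : ((dd k + (3 / 2 : k) • ll k : k[X][X]).eval (C l)).eval d = d + 3 / 2 * l := by
    simp [dd, ll, eval_smul]
  rw [h]
  simp only [evMat_vMatrix, evMat_gMatrix, one_smul]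
  ext r c
  fin_cases r <;> fin_cases c <;> simp <;> ring

theorem comm_gv (n : ℕ) {t : k[X][X]} (ht : nsTable k .g .v = Finsupp.single .g t) :
    ((n.factorial : k) • t.coeff n) • gMatrix k =
      commL (cendProd k) cend_loc 1 n (gMatrix k) (vMatrix k) := by
  have ht' : t = (1 / 2 : k) • dd k + (3 / 2 : k) • ll k := (Finsupp.single_injective _ ht).symm
  subst ht'
  refine comm_table (fun l d t => ?_) n
  have h : (((1 / 2 : k) • dd k + (3 / 2 : k) • ll k : k[X][X]).eval (C l)).eval d = 1 / 2 * d + 3 / 2 * l := by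
    simp [dd, ll, eval_smul]
  rw [h]
  simp only [evMat_vMatrix, evMat_gMatrix, one_smul]
  ext r c
  fin_cases r <;> fin_cases c <;> simp <;> ring

theorem comm_gg (n : ℕ) {t : k[X][X]} (ht : nsTable k .g .g = Finsupp.single .v t) :
    ((n.factorial : k) • t.coeff n) • vMatrix k =
      commL (cendProd k) cend_loc (-1) n (gMatrix k) (gMatrix k) := by
  have ht' : t = -(C (C (1 / 2 : k))) := (Finsupp.single_injective _ ht).symm
  subst ht'
  refine comm_table (fun l d t => ?_) n
  have h : ((-(C (C (1 / 2 : k))) : k[X][X]).eval (C l)).eval d = -(1 / 2) := by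
    simp
  rw [h]
  simp only [evMat_vMatrix, evMat_gMatrix, neg_smul, one_smul]
  ext r c
  fin_cases r <;> fin_cases c <;> simp <;> ring

theorem q_map_bracket_gen (a b : NSGen) (n : ℕ) :
    phiQ k ((K1 k).prod n (K1.gen k a) (K1.gen k b)) =
      (cendQData k).comm a.par b.par n (phiQ k (K1.gen k a)) (phiQ k (K1.gen k b)) := by
  apply qVal_injective
  rw [phiQ_gen, phiQ_gen]
  refine Eq.trans ?_ (coe_q_comm _ _ n _ _).symm
  cases a <;> cases b
  · rw [K1_prod_gen (k := k) (a := .v) (b := .v) n rfl, map_smul, phiQ_gen, map_smul]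
    exact comm_vv n rfl
  · rw [K1_prod_gen (k := k) (a := .v) (b := .g) n rfl, map_smul, phiQ_gen, map_smul]
    exact comm_vg n rfl
  · rw [K1_prod_gen (k := k) (a := .g) (b := .v) n rfl, map_smul, phiQ_gen, map_smul]
    exact comm_gv n rfl
  · rw [K1_prod_gen (k := k) (a := .g) (b := .g) n rfl, map_smul, phiQ_gen, map_smul]
    exact comm_gg n rfl

theorem coe_eElt_gQ : qVal k (eElt (cendQData k).prod (gQ k)) = eMatrix k := by
  change (-4 : k) • cendProd k 1 (gMatrix k) (gMatrix k) = _
  rw [gg_quad]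
  change (-4 : k) • (-1 / 4 : k) • eMatrix k = _
  module

theorem coe_hElt_gQ : qVal k (hElt (cendQData k).prod (gQ k)) = hMatrix k := by
  change cendProd k 0 (qVal k (eElt (cendQData k).prod (gQ k))) (gMatrix k) = _
  rw [coe_eElt_gQ, eg_quad]
  rfl

theorem cendProd_zero_v (A : Matrix (Fin 2) (Fin 2) k[X][X]) :
    cendProd k 0 (vMatrix k) A = A.map fun f => X * f := by
  refine evMat_injective fun d t => ?_
  rw [← lam_zero_left (k := k) (cend_loc _ _), evMat_lam_prod, eval_zero, evMat_vMatrix]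
  ext r c
  fin_cases r <;> fin_cases c <;> simp [Matrix.mul_apply, Fin.sum_univ_two, evMat_apply]

theorem coe_polyAct (m : cendQData k) (f : k[X][X]) :
    qVal k (polyAct q_sesq (vQ k) m f) = (qVal k m).map fun t => f * t := by
  induction f using Polynomial.induction_on with
  | C a =>
    have : (C a : k[X][X]) = a • 1 := by rw [smul_eq_C_mul, mul_one]
    rw [this, map_smul, polyAct_one, map_smul]
    ext1 r c
    simp
  | add f g hf hg =>
    rw [map_add, map_add, hf, hg]
    ext1 r c
    simp [add_mul]
  | monomial n a h =>
    have : (C a * X ^ (n + 1) : k[X][X]) = X * (C a * X ^ n) := by ring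
    rw [this, polyAct_X_mul, qVal_prod]
    change cendProd k 0 (vMatrix k) _ = _
    rw [cendProd_zero_v, h]
    ext1 r c
    simp [mul_assoc]

/-- The normal form of the elements of the model. -/
def normalQ (k : Type u) [Field k] [CharZero k] :
    k[X][X] × k[X][X] × k[X][X] × k[X][X] →ₗ[k[X]] cendQData k :=
  normalForm q_sesq (vQ k) (gQ k)

theorem coe_normalQ (f : k[X][X] × k[X][X] × k[X][X] × k[X][X]) :
    qVal k (normalQ k f) =
      !![X * f.1, C (C (1 / 2)) * (X * f.2.2.1);
        -(C (C (1 / 2)) * (f.2.2.1 + f.2.2.2)), f.2.1 + (X - C (C (1 / 2) * X)) * f.1] := by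
  obtain ⟨f₀, f₁, f₂, f₃⟩ := f
  rw [normalQ, normalForm_apply]
  simp only [map_add, coe_polyAct, coe_eElt_gQ, coe_hElt_gQ, qVal_vQ, qVal_gQ]
  have h2 : ∀ t : k[X][X], (2⁻¹ : k) • t = C (C 2⁻¹) * t := fun t => by
    rw [k_smul_eq, smul_eq_C_mul]
  have h3 : ∀ t : k[X][X], (-1 / 2 : k) • t = -(C (C 2⁻¹) * t) := fun t => by
    have h5 : (-1 / 2 : k) = -2⁻¹ := by norm_num
    rw [k_smul_eq, smul_eq_C_mul, h5, C_neg, C_neg]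
    ring
  have h4 : ∀ t : k[X], (2⁻¹ : k) • t = C 2⁻¹ * t := fun t => smul_eq_C_mul _
  ext1 r c
  fin_cases r <;> fin_cases c <;>
    simp [vMatrix, gMatrix, eMatrix, hMatrix, h2, h3, h4] <;> ring

theorem normalQ_injective : Function.Injective (normalQ k) := by
  refine LinearMap.ker_eq_bot.1 (LinearMap.ker_eq_bot'.2 ?_)
  rintro ⟨f₀, f₁, f₂, f₃⟩ hf
  have h := coe_normalQ (f₀, f₁, f₂, f₃)
  rw [hf, map_zero] at h
  have h12 : (C (C (1 / 2)) : k[X][X]) ≠ 0 := by simp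
  have h00 := congrFun (congrFun h 0) 0
  have h01 := congrFun (congrFun h 0) 1
  have h10 := congrFun (congrFun h 1) 0
  have h11 := congrFun (congrFun h 1) 1
  simp only [Matrix.zero_apply, Matrix.of_apply, Matrix.cons_val_zero,
    Matrix.cons_val_one, Matrix.cons_val_fin_one] at h00 h01 h10 h11
  have e0 : f₀ = 0 := (mul_eq_zero.1 h00.symm).resolve_left X_ne_zero
  have e2 : f₂ = 0 :=
    (mul_eq_zero.1 ((mul_eq_zero.1 h01.symm).resolve_left h12)).resolve_left X_ne_zero
  have e3 : f₃ = 0 := by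
    have := (mul_eq_zero.1 (neg_eq_zero.1 h10.symm)).resolve_left h12
    rwa [e2, zero_add] at this
  have e1 : f₁ = 0 := by
    rw [e0, mul_zero, add_zero] at h11
    exact h11.symm
  rw [e0, e1, e2, e3]
  rfl

theorem normalQ_surjective : Function.Surjective (normalQ k) := by
  intro A
  obtain ⟨p, hp⟩ := qVal_mem A 0
  obtain ⟨q, hq⟩ := qVal_mem A 1
  have h2 : (C (C (1 / 2)) : k[X][X]) * C (C 2) = 1 := by
    rw [← C_mul, ← C_mul]
    norm_num
  refine ⟨(p, qVal k A 1 1 - (X - C (C (1 / 2) * X)) * p, C (C 2) * q,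
    -(C (C 2) * q) - C (C 2) * qVal k A 1 0), qVal_injective ?_⟩
  rw [coe_normalQ]
  ext1 r c
  fin_cases r <;> fin_cases c
  · exact hp.symm
  · simp only [Fin.zero_eta, Fin.mk_one, Matrix.of_apply, Matrix.cons_val_zero,
      Matrix.cons_val_one, Matrix.cons_val_fin_one]
    rw [hq]
    linear_combination X * q * h2
  · simp only [Fin.zero_eta, Fin.mk_one, Matrix.of_apply, Matrix.cons_val_zero,
      Matrix.cons_val_one, Matrix.cons_val_fin_one]
    linear_combination qVal k A 1 0 * h2
  · simp

/-- Coordinates of the elements of the model. -/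
def normalEquiv (k : Type u) [Field k] [CharZero k] :
    (k[X][X] × k[X][X] × k[X][X] × k[X][X]) ≃ₗ[k[X]] cendQData k :=
  LinearEquiv.ofBijective (normalQ k) ⟨normalQ_injective, normalQ_surjective⟩

theorem q_induction (S : Submodule k[X] (cendQData k)) (hv : vQ k ∈ S)
    (he : eElt (cendQData k).prod (gQ k) ∈ S) (hg : gQ k ∈ S) (hh : hElt (cendQData k).prod (gQ k) ∈ S)
    (hS : ∀ x ∈ S, (cendQData k).prod 0 (vQ k) x ∈ S) : S = ⊤ := by
  rw [eq_top_iff]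
  intro x _
  obtain ⟨⟨f₀, f₁, f₂, f₃⟩, rfl⟩ := normalQ_surjective x
  rw [normalQ, normalForm_apply]
  exact S.add_mem (polyAct_mem _ _ _ S hv hS _) (S.add_mem (polyAct_mem _ _ _ S he hS _)
    (S.add_mem (polyAct_mem _ _ _ S hg hS _) (polyAct_mem _ _ _ S hh hS _)))

theorem q_isEnvelope : IsEnvelope (K1 k) (K1.gen k) NSGen.loc (cendQData k) (phiQ k) where
  conformal := q_isConformal
  assoc := q_assoc
  map_parity i y hy := by
    have : Submodule.span k[X] (K1.gen k '' {a | a.par = i}) ≤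
        ((cendQData k).parity i).comap (phiQ k) := by
      refine Submodule.span_le.2 ?_
      rintro _ ⟨a, rfl, rfl⟩
      refine Submodule.mem_comap.2 ?_
      rw [phiQ_gen]
      exact genQ_mem a
    exact this (K1_parity_le i hy)
  map_bracket := map_bracket_of_gen q_loc q_sesq q_map_bracket_gen
  generated S h1 h2 := by
    have hv : vQ k ∈ S := by
      have := h1 (K1.gen k .v)
      rwa [phiQ_gen] at this
    have hg : gQ k ∈ S := by
      have := h1 (K1.gen k .g)
      rwa [phiQ_gen] at this
    have he : eElt (cendQData k).prod (gQ k) ∈ S := by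
      rw [eElt, k_smul_eq]
      exact S.smul_mem _ (h2 1 _ _ hg hg)
    exact q_induction S hv he hg (h2 0 _ _ he hg) fun x hx => h2 0 _ _ hv hx
  locality a b n hn := by
    rw [phiQ_gen, phiQ_gen]
    apply qVal_injective
    cases a <;> cases b
    · exact (vv_quad n).trans (quad_evZero _ _ _ n hn)
    · exact (vg_quad n).trans (quad_two _ _ n hn)
    · exact (gv_quad n).trans (quad_two _ _ n hn)
    · exact (gg_quad n).trans (quad_two _ _ n hn)

end Model

section Universality

variable {k : Type u} [Field k] [CharZero k] {A : ConfData k} {φ : K1 k →ₗ[k[X]] A}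

/-- Closure of a multiplicativity condition under products. -/
theorem mul_closed {M M' : Type u} [AddCommGroup M] [Module k M] [Module k[X] M]
    [IsScalarTower k k[X] M] [AddCommGroup M'] [Module k M'] [Module k[X] M']
    [IsScalarTower k k[X] M'] {p : ℕ → M →ₗ[k] M →ₗ[k] M} {q : ℕ → M' →ₗ[k] M' →ₗ[k] M'}
    (hp : IsAssociative p) (hq : IsAssociative q) (f : M →ₗ[k] M') {x y : M}
    (hx : ∀ n z, f (p n x z) = q n (f x) (f z)) (hy : ∀ n z, f (p n y z) = q n (f y) (f z))
    (n : ℕ) : ∀ m z, f (p m (p n x y) z) = q m (f (p n x y)) (f z) := by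
  induction n using Nat.strong_induction_on with
  | _ n ih =>
    intro m z
    have h1 := hp n m x y z
    have h2 := hq n m (f x) (f y) (f z)
    rw [Finset.sum_range_succ] at h1 h2
    simp only [Nat.choose_self, Nat.cast_one, one_smul, Nat.add_sub_cancel_left] at h1 h2
    have h3 : f (p n x (p m y z)) = q n (f x) (q m (f y) (f z)) := by rw [hx, hy]
    rw [h1, h2, map_add, map_sum] at h3
    rw [← hx n y] at h3
    refine add_left_cancel (h3.trans ?_ |>.trans rfl)
    congr 1
    refine Finset.sum_congr rfl fun s hs => ?_
    rw [map_smul, ih s (Finset.mem_range.1 hs), hx]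

/-- The comparison map from the model to an envelope. -/
def theta (h : IsEnvelope (K1 k) (K1.gen k) NSGen.loc A φ) : cendQData k →ₗ[k[X]] A :=
  normalForm h.nsRel.sesq (φ (K1.gen k .v)) (φ (K1.gen k .g)) ∘ₗ (normalEquiv k).symm.toLinearMap

variable (h : IsEnvelope (K1 k) (K1.gen k) NSGen.loc A φ)

theorem theta_normalQ (f : k[X][X] × k[X][X] × k[X][X] × k[X][X]) :
    theta h (normalQ k f) = normalForm h.nsRel.sesq (φ (K1.gen k .v)) (φ (K1.gen k .g)) f := by
  have : (normalEquiv k).symm (normalQ k f) = f := (normalEquiv k).symm_apply_apply f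
  rw [theta, LinearMap.comp_apply, LinearEquiv.coe_coe, this]

theorem normalQ_v : normalQ k (1, 0, 0, 0) = vQ k := by
  rw [normalQ, normalForm_apply]
  simp only [polyAct_one, map_zero, add_zero]

theorem normalQ_e : normalQ k (0, 1, 0, 0) = eElt (cendQData k).prod (gQ k) := by
  rw [normalQ, normalForm_apply]
  simp only [polyAct_one, map_zero, add_zero, zero_add]

theorem normalQ_g : normalQ k (0, 0, 1, 0) = gQ k := by
  rw [normalQ, normalForm_apply]
  simp only [polyAct_one, map_zero, add_zero, zero_add]

theorem normalQ_h : normalQ k (0, 0, 0, 1) = hElt (cendQData k).prod (gQ k) := by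
  rw [normalQ, normalForm_apply]
  simp only [polyAct_one, map_zero, zero_add]

theorem theta_v : theta h (vQ k) = φ (K1.gen k .v) := by
  rw [← normalQ_v, theta_normalQ, normalForm_apply]
  simp only [polyAct_one, map_zero, add_zero]

theorem theta_e : theta h (eElt (cendQData k).prod (gQ k)) = eElt A.prod (φ (K1.gen k .g)) := by
  rw [← normalQ_e, theta_normalQ, normalForm_apply]
  simp only [polyAct_one, map_zero, add_zero, zero_add]

theorem theta_g : theta h (gQ k) = φ (K1.gen k .g) := by
  rw [← normalQ_g, theta_normalQ, normalForm_apply]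
  simp only [polyAct_one, map_zero, add_zero, zero_add]

theorem theta_h : theta h (hElt (cendQData k).prod (gQ k)) = hElt A.prod (φ (K1.gen k .g)) := by
  rw [← normalQ_h, theta_normalQ, normalForm_apply]
  simp only [polyAct_one, map_zero, zero_add]

theorem theta_V0 (x : cendQData k) :
    theta h ((cendQData k).prod 0 (vQ k) x) = A.prod 0 (φ (K1.gen k .v)) (theta h x) := by
  obtain ⟨f, rfl⟩ := normalQ_surjective x
  have h1 := normalForm_X_mul (q_sesq (k := k)) (vQ k) (gQ k) f
  have h2 := normalForm_X_mul h.nsRel.sesq (φ (K1.gen k .v)) (φ (K1.gen k .g)) f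
  rw [← normalQ] at h1
  rw [theta_normalQ, ← h1, theta_normalQ, h2]

theorem theta_k_smul (a : k) (x : cendQData k) : theta h (a • x) = a • theta h x := by
  rw [k_smul_eq, map_smul, C_smul']

theorem q_nsRel : NSRel (cendQData k).prod (vQ k) (gQ k) := by
  have := (q_isEnvelope (k := k)).nsRel
  rwa [phiQ_gen, phiQ_gen] at this

theorem theta_g_mul (n : ℕ) (x : cendQData k) :
    theta h ((cendQData k).prod n (gQ k) x) = A.prod n (φ (K1.gen k .g)) (theta h x) := by
  have r := h.nsRel
  have r' := q_nsRel (k := k)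
  let W : Submodule k (cendQData k) :=
    { carrier := {x | ∀ n, theta h ((cendQData k).prod n (gQ k) x) =
        A.prod n (φ (K1.gen k .g)) (theta h x)}
      add_mem' := fun ha hb n => by simp only [map_add, ha n, hb n]
      zero_mem' := fun n => by simp
      smul_mem' := fun a y hy n => by simp only [map_smul, theta_k_smul, hy n] }
  have hW : Submodule.ofStable W (fun y hy n => by
      simp only [map_smul, r.sesq.right, r'.sesq.right, map_add, theta_k_smul, hy n,
        hy (n - 1)]) = ⊤ := by
    refine q_induction _ (fun n => ?_) (fun n => ?_) (fun n => ?_) (fun n => ?_) fun x hx n => ?_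
    · match n with
      | 0 => simp only [theta_v, theta_g, theta_h, theta_V0, r.g0v, r'.g0v, map_sub, theta_k_smul,
          map_smul]
      | 1 => simp only [theta_v, theta_g, theta_h, r.g1v, r'.g1v, map_add, theta_k_smul]
      | n + 2 => rw [theta_v, r.g_v _ (by omega), r'.g_v _ (by omega), map_zero]
    · match n with
      | 0 => simp only [theta_e, theta_g, theta_h, r.g0e, r'.g0e, map_sub]
      | n + 1 => rw [theta_e, r.g_e _ (by omega), r'.g_e _ (by omega), map_zero]
    · match n with
      | 0 => simp only [theta_v, theta_g, theta_e, r.g0g, r'.g0g, map_sub, theta_k_smul, map_smul]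
      | 1 => simp only [theta_g, theta_e, NSRel.g1g, theta_k_smul]
      | n + 2 => rw [theta_g, r.gg _ (by omega), r'.gg _ (by omega), map_zero]
    · match n with
      | 0 => simp only [theta_v, theta_e, theta_h, theta_V0, r.g0h, r'.g0h, map_sub, map_add,
          theta_k_smul, map_smul]
      | n + 1 => rw [theta_h, r.g_h _ (by omega), r'.g_h _ (by omega), map_zero]
    · have hx : ∀ n, theta h ((cendQData k).prod n (gQ k) x) =
        A.prod n (φ (K1.gen k .g)) (theta h x) := hx
      rw [r'.G_V0, theta_V0, r.G_V0, map_add, theta_V0, theta_k_smul, hx, hx]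
  exact (hW ▸ Submodule.mem_top : x ∈ Submodule.ofStable W _) n

theorem theta_mul (n : ℕ) (x y : cendQData k) :
    theta h ((cendQData k).prod n x y) = A.prod n (theta h x) (theta h y) := by
  have r := h.nsRel
  have r' := q_nsRel (k := k)
  let W : Submodule k (cendQData k) :=
    { carrier := {x | ∀ n y, theta h ((cendQData k).prod n x y) = A.prod n (theta h x) (theta h y)}
      add_mem' := fun ha hb n y => by simp only [map_add, LinearMap.add_apply, ha n, hb n]
      zero_mem' := fun n => by simp
      smul_mem' := fun a x hx n y => by
        simp only [map_smul, LinearMap.smul_apply, theta_k_smul, hx n y] }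
  let S : Submodule k[X] (cendQData k) := Submodule.ofStable W (fun x hx n y => by
      simp only [map_smul, r.sesq.left, r'.sesq.left, map_neg, theta_k_smul, hx (n - 1) y])
  have hmul : ∀ (n : ℕ) (x y : cendQData k), x ∈ S → y ∈ S → (cendQData k).prod n x y ∈ S :=
    fun n x y hx hy => mul_closed r'.assoc r.assoc ((theta h).restrictScalars k) hx hy n
  have hg : gQ k ∈ S := fun n y => by rw [theta_g_mul, theta_g]
  have he : eElt (cendQData k).prod (gQ k) ∈ S := by
    rw [eElt]
    exact W.smul_mem _ (hmul 1 _ _ hg hg)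
  have hv : vQ k ∈ S := by
    rw [r'.v_eq]
    exact S.sub_mem (W.smul_mem _ (hmul 0 _ _ hg hg)) (W.smul_mem _ (S.smul_mem _ he))
  have hS : S = ⊤ := q_induction S hv he hg (hmul 0 _ _ he hg) fun x hx => hmul 0 _ _ hv hx
  exact (hS ▸ Submodule.mem_top : x ∈ S) n y

theorem IsEnvelope.V0_mem (h : IsEnvelope (K1 k) (K1.gen k) NSGen.loc A φ) {i : ZMod 2} {x : A} (hx : x ∈ A.parity i) :
    A.prod 0 (φ (K1.gen k .v)) x ∈ A.parity i := by
  have := h.conformal.mem_parity 0 i 0 _ _ h.v_mem hx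
  rwa [zero_add] at this

theorem theta_parity (i : ZMod 2) (x : cendQData k) (hx : x ∈ (cendQData k).parity i) :
    theta h x ∈ A.parity i := by
  obtain ⟨⟨f₀, f₁, f₂, f₃⟩, rfl⟩ := normalQ_surjective x
  rw [theta_normalQ, normalForm_apply]
  have hm := coe_normalQ (f₀, f₁, f₂, f₃)
  have h12 : (C (C (1 / 2)) : k[X][X]) ≠ 0 := by simp
  have hx : qVal k (normalQ k (f₀, f₁, f₂, f₃)) ∈ cendPar i := hx
  rw [hm] at hx
  have hV : ∀ x ∈ A.parity i, A.prod 0 (φ (K1.gen k .v)) x ∈ A.parity i := fun x hx => h.V0_mem hx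
  rcases zmod_two_cases i with rfl | rfl
  · rw [mem_cend_parity_zero] at hx
    obtain ⟨h01, h10⟩ := hx
    simp only [Matrix.of_apply, Matrix.cons_val_zero, Matrix.cons_val_one,
      Matrix.cons_val_fin_one] at h01 h10
    have e2 : f₂ = 0 := (mul_eq_zero.1 ((mul_eq_zero.1 h01).resolve_left h12)).resolve_left X_ne_zero
    have e3 : f₃ = 0 := by
      have := (mul_eq_zero.1 (neg_eq_zero.1 h10)).resolve_left h12
      rwa [e2, zero_add] at this
    rw [e2, e3, map_zero, map_zero, add_zero, add_zero]
    exact Submodule.add_mem _ (polyAct_mem _ _ _ _ h.v_mem hV _) (polyAct_mem _ _ _ _ h.e_mem hV _)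
  · rw [mem_cend_parity_one] at hx
    obtain ⟨h00, h11⟩ := hx
    simp only [Matrix.of_apply, Matrix.cons_val_zero, Matrix.cons_val_one,
      Matrix.cons_val_fin_one] at h00 h11
    have e0 : f₀ = 0 := (mul_eq_zero.1 h00).resolve_left X_ne_zero
    have e1 : f₁ = 0 := by
      rw [e0, mul_zero, add_zero] at h11
      exact h11
    rw [e0, e1, map_zero, map_zero, zero_add, zero_add]
    exact Submodule.add_mem _ (polyAct_mem _ _ _ _ h.g_mem hV _) (polyAct_mem _ _ _ _ h.h_mem hV _)

/-- The comparison homomorphism from the model to an envelope. -/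
def thetaHom : (cendQData k).Hom A where
  map := theta h
  map_parity := theta_parity h
  map_prod := theta_mul h

theorem map_eq_of_gen {B : Type u} [AddCommGroup B] [Module k[X] B] {f f' : K1 k →ₗ[k[X]] B}
    (hv : f (K1.gen k .v) = f' (K1.gen k .v)) (hg : f (K1.gen k .g) = f' (K1.gen k .g)) :
    f = f' := by
  refine LinearMap.ext_on_range K1_span fun a => ?_
  cases a
  · exact hv
  · exact hg

theorem ConfData.Hom.ext {A B : ConfData k} {f g : A.Hom B} (h : f.map = g.map) : f = g := by
  cases f
  cases g
  congr

theorem IsEnvelope.hom_ext (h : IsEnvelope (K1 k) (K1.gen k) NSGen.loc A φ)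
    {B : ConfData k} (f g : A.Hom B)
    (hfg : ∀ y, f.map (φ y) = g.map (φ y)) : f = g := by
  have := h.generated (LinearMap.eqLocus f.map g.map) hfg fun n y z hy hz => by
    rw [LinearMap.mem_eqLocus] at hy hz ⊢
    rw [f.map_prod, g.map_prod, hy, hz]
  refine ConfData.Hom.ext (LinearMap.ext fun x => ?_)
  exact (this ▸ Submodule.mem_top : x ∈ LinearMap.eqLocus f.map g.map)

theorem q_isUniversal :
    IsUniversalEnvelope (K1 k) (K1.gen k) NSGen.loc (cendQData k) (phiQ k) where
  envelope := q_isEnvelope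
  universal A ψ h := by
    have h1 : ∀ y, (thetaHom h).map (phiQ k y) = ψ y := by
      have : theta h ∘ₗ phiQ k = ψ := map_eq_of_gen
        (by rw [LinearMap.comp_apply, phiQ_gen]; exact theta_v h)
        (by rw [LinearMap.comp_apply, phiQ_gen]; exact theta_g h)
      exact fun y => LinearMap.congr_fun this y
    exact ⟨thetaHom h, h1, fun f hf => q_isEnvelope.hom_ext f _ fun y => by rw [hf, h1]⟩

/-- Composition of homomorphisms. -/
def ConfData.Hom.comp {A B D : ConfData k} (g : B.Hom D) (f : A.Hom B) : A.Hom D where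
  map := g.map ∘ₗ f.map
  map_parity i x hx := g.map_parity i _ (f.map_parity i x hx)
  map_prod n x y := by simp only [LinearMap.comp_apply, f.map_prod, g.map_prod]

/-- The identity homomorphism. -/
def ConfData.Hom.id (A : ConfData k) : A.Hom A where
  map := LinearMap.id
  map_parity _ _ hx := hx
  map_prod _ _ _ := rfl

theorem IsUniversalEnvelope.exists_iso {U : ConfData k} {φ : K1 k →ₗ[k[X]] U}
    (h : IsUniversalEnvelope (K1 k) (K1.gen k) NSGen.loc U φ) :
    ∃ f : U.Hom (cendQData k), Function.Bijective f.map ∧ ∀ y, f.map (φ y) = phiQ k y := by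
  obtain ⟨f, hf, -⟩ := h.universal _ _ q_isEnvelope
  obtain ⟨g, hg, -⟩ := q_isUniversal.universal _ _ h.envelope
  have h1 : g.comp f = ConfData.Hom.id U := h.envelope.hom_ext _ _ fun y => by
    change g.map (f.map (φ y)) = φ y
    rw [hf, hg]
  have h2 : f.comp g = ConfData.Hom.id (cendQData k) := q_isEnvelope.hom_ext _ _ fun y => by
    change f.map (g.map (phiQ k y)) = phiQ k y
    rw [hg, hf]
  refine ⟨f, ⟨fun x y hxy => ?_, fun x => ⟨g.map x, ?_⟩⟩, hf⟩
  · have h3 : ∀ x, g.map (f.map x) = x := fun x =>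
      LinearMap.congr_fun (congrArg ConfData.Hom.map h1) x
    rw [← h3 x, hxy, h3]
  · exact LinearMap.congr_fun (congrArg ConfData.Hom.map h2) x

/-- The inclusion of the model into `Cend_2`. -/
def qIncl (k : Type u) [Field k] : (cendQData k).Hom (Cend2 k) where
  map := qVal k
  map_parity _ _ hx := hx
  map_prod _ _ _ := rfl

theorem range_qVal : Set.range (qVal k) = cendQ k := by
  ext A
  constructor
  · rintro ⟨x, rfl⟩
    obtain ⟨p, hp⟩ := qVal_mem x 0
    obtain ⟨q, hq⟩ := qVal_mem x 1
    refine ⟨!![p, q; qVal k x 1 0, qVal k x 1 1], ?_⟩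
    change qVal k x = !![X * p, X * q; qVal k x 1 0, qVal k x 1 1]
    rw [← hp, ← hq]
    ext1 r c
    fin_cases r <;> fin_cases c <;> rfl
  · rintro ⟨f, rfl⟩
    refine ⟨(⟨!![X * f 0 0, X * f 0 1; f 1 0, f 1 1], fun c => ?_⟩ : cendSub k), rfl⟩
    fin_cases c
    · exact dvd_mul_right _ _
    · exact dvd_mul_right _ _

end Universality

section Filt

variable {k : Type u} [Field k] {U : ConfData k} {ι : Type} {x : ι → U} {N : ι → ι → ℕ}

theorem filt_mono {d e : ℕ} (h : d ≤ e) : filt U x N d ≤ filt U x N e :=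
  Submodule.span_mono fun _ ⟨a, c, hc, hw⟩ => ⟨a, c, hc.trans h, hw⟩

theorem IsWord.pos {a : ι} {d : ℕ} {w : U} (hw : IsWord U x N a d w) : 1 ≤ d := by
  cases hw <;> omega

theorem filt_zero : filt U x N 0 = ⊥ := by
  rw [filt, Submodule.span_eq_bot]
  rintro w ⟨a, e, he, hw⟩
  have := hw.pos
  omega

theorem IsWord.mem_filt {a : ι} {d : ℕ} {w : U} (hw : IsWord U x N a d w) : w ∈ filt U x N d :=
  Submodule.subset_span ⟨a, d, le_rfl, hw⟩

theorem filt_k_smul {d : ℕ} (a : k) {w : U} (hw : w ∈ filt U x N d) : a • w ∈ filt U x N d := by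
  rw [k_smul_eq]
  exact Submodule.smul_mem _ _ hw

theorem IsWord.homogeneous (hU : IsConformal U.parity U.prod) (hx : ∀ a, ∃ i, x a ∈ U.parity i)
    {a : ι} {d : ℕ} {w : U} (hw : IsWord U x N a d w) : ∃ i, w ∈ U.parity i := by
  induction hw with
  | letter a => exact hx a
  | cons a b n d w hn hw ih =>
    obtain ⟨i, hi⟩ := hx a
    obtain ⟨j, hj⟩ := ih
    exact ⟨i + j, hU.mem_parity i j n _ _ hi hj⟩

end Filt

section AssocMem

variable {k : Type u} [Field k] {M : Type u} [AddCommGroup M] [Module k M] [Module k[X] M]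
  [IsScalarTower k k[X] M] {p : ℕ → M →ₗ[k] M →ₗ[k] M}

theorem IsAssociative.mem_of_right (hp : IsAssociative p) (W : Submodule k M) {x y z : M}
    (h : ∀ n m, p n x (p m y z) ∈ W) (n : ℕ) : ∀ m, p m (p n x y) z ∈ W := by
  induction n using Nat.strong_induction_on with
  | _ n ih =>
    intro m
    have h1 := hp n m x y z
    rw [Finset.sum_range_succ] at h1
    simp only [Nat.choose_self, Nat.cast_one, one_smul, Nat.add_sub_cancel_left] at h1
    have h2 := sub_eq_iff_eq_add'.2 h1
    rw [← h2]
    exact W.sub_mem (h n m) (W.sum_mem fun s hs =>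
      W.smul_mem _ (ih s (Finset.mem_range.1 hs) _))

end AssocMem

section NSFiltration

variable {k : Type u} [Field k] [CharZero k] {A : ConfData k} {φ : K1 k →ₗ[k[X]] A}

/-- The filtration of an envelope of `K_1` by word length. -/
abbrev nsFilt (φ : K1 k →ₗ[k[X]] A) (d : ℕ) : Submodule k[X] A :=
  filt A (fun a => φ (K1.gen k a)) NSGen.loc d

/-- The elements `v (0) (v (0) ⋯ m)`. -/
def vPow (φ : K1 k →ₗ[k[X]] A) (i : ℕ) (m : A) : A := (A.prod 0 (φ (K1.gen k .v)))^[i] m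

theorem vPow_zero (m : A) : vPow φ 0 m = m := rfl

theorem vPow_succ (i : ℕ) (m : A) :
    vPow φ (i + 1) m = A.prod 0 (φ (K1.gen k .v)) (vPow φ i m) :=
  Function.iterate_succ_apply' _ _ _

/-- The monomials of degree at most `d`. -/
def monomials (φ : K1 k →ₗ[k[X]] A) (d : ℕ) : Set A :=
  {w | ∃ i, (i + 1 ≤ d ∧ (w = vPow φ i (φ (K1.gen k .v)) ∨ w = vPow φ i (φ (K1.gen k .g)))) ∨
    (i + 2 ≤ d ∧ (w = vPow φ i (eElt A.prod (φ (K1.gen k .g))) ∨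
      w = vPow φ i (hElt A.prod (φ (K1.gen k .g)))))}

/-- The span of the monomials of degree at most `d`. -/
def monSpan (φ : K1 k →ₗ[k[X]] A) (d : ℕ) : Submodule k[X] A :=
  Submodule.span k[X] (monomials φ d)

theorem monSpan_mono {d e : ℕ} (h : d ≤ e) : monSpan φ d ≤ monSpan φ e := by
  refine Submodule.span_mono ?_
  rintro w ⟨i, ⟨hi, hw⟩ | ⟨hi, hw⟩⟩
  · exact ⟨i, Or.inl ⟨hi.trans h, hw⟩⟩
  · exact ⟨i, Or.inr ⟨hi.trans h, hw⟩⟩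

theorem monSpan_k_smul {d : ℕ} (a : k) {w : A} (hw : w ∈ monSpan φ d) : a • w ∈ monSpan φ d := by
  rw [k_smul_eq]
  exact Submodule.smul_mem _ _ hw

theorem v_mem_monSpan {d : ℕ} (hd : 1 ≤ d) : φ (K1.gen k .v) ∈ monSpan φ d :=
  Submodule.subset_span ⟨0, Or.inl ⟨hd, Or.inl rfl⟩⟩

theorem g_mem_monSpan {d : ℕ} (hd : 1 ≤ d) : φ (K1.gen k .g) ∈ monSpan φ d :=
  Submodule.subset_span ⟨0, Or.inl ⟨hd, Or.inr rfl⟩⟩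

theorem e_mem_monSpan {d : ℕ} (hd : 2 ≤ d) : eElt A.prod (φ (K1.gen k .g)) ∈ monSpan φ d :=
  Submodule.subset_span ⟨0, Or.inr ⟨hd, Or.inl rfl⟩⟩

theorem h_mem_monSpan {d : ℕ} (hd : 2 ≤ d) : hElt A.prod (φ (K1.gen k .g)) ∈ monSpan φ d :=
  Submodule.subset_span ⟨0, Or.inr ⟨hd, Or.inr rfl⟩⟩

theorem V0_mem_monSpan (hs : Sesq A.prod) {d : ℕ} {w : A} (hw : w ∈ monSpan φ d) :
    A.prod 0 (φ (K1.gen k .v)) w ∈ monSpan φ (d + 1) := by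
  have : monSpan φ d ≤ (monSpan φ (d + 1)).comap (zeroMulL hs (φ (K1.gen k .v))) := by
    refine Submodule.span_le.2 ?_
    rintro w ⟨i, ⟨hi, rfl | rfl⟩ | ⟨hi, rfl | rfl⟩⟩ <;>
      refine Submodule.mem_comap.2 (Submodule.subset_span ?_)
    · exact ⟨i + 1, Or.inl ⟨by omega, Or.inl (vPow_succ _ _).symm⟩⟩
    · exact ⟨i + 1, Or.inl ⟨by omega, Or.inr (vPow_succ _ _).symm⟩⟩
    · exact ⟨i + 1, Or.inr ⟨by omega, Or.inl (vPow_succ _ _).symm⟩⟩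
    · exact ⟨i + 1, Or.inr ⟨by omega, Or.inr (vPow_succ _ _).symm⟩⟩
  exact this hw

/-- An operator with `[x (n) ·, v (0) ·] = n x (n-1) ·` raises degrees by one as soon as it does so
on the four lowest monomials. -/
theorem mul_mem_monSpan (hs : Sesq A.prod) {x : A}
    (hx : ∀ n w, A.prod n x (A.prod 0 (φ (K1.gen k .v)) w) =
      A.prod 0 (φ (K1.gen k .v)) (A.prod n x w) + (n : k) • A.prod (n - 1) x w)
    (hv : ∀ n, A.prod n x (φ (K1.gen k .v)) ∈ monSpan φ 2)
    (hg : ∀ n, A.prod n x (φ (K1.gen k .g)) ∈ monSpan φ 2)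
    (he : ∀ n, A.prod n x (eElt A.prod (φ (K1.gen k .g))) ∈ monSpan φ 3)
    (hh : ∀ n, A.prod n x (hElt A.prod (φ (K1.gen k .g))) ∈ monSpan φ 3) (n : ℕ) {d : ℕ} {w : A}
    (hw : w ∈ monSpan φ d) : A.prod n x w ∈ monSpan φ (d + 1) := by
  have key : ∀ (m : A) (c : ℕ), (∀ n, A.prod n x m ∈ monSpan φ (c + 1)) →
      ∀ i n, A.prod n x (vPow φ i m) ∈ monSpan φ (i + c + 1) := by
    intro m c hm i
    induction i with
    | zero => exact fun n => monSpan_mono (by omega) (hm n)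
    | succ i ih =>
      intro n
      rw [vPow_succ, hx]
      exact Submodule.add_mem _
        (monSpan_mono (by omega) (V0_mem_monSpan hs (ih n)))
        (monSpan_k_smul _ (monSpan_mono (by omega) (ih (n - 1))))
  refine sesq_mem hs _ (S := {x}) (T := monomials φ d) ?_ n (Submodule.mem_span_singleton_self x) hw
  rintro n y rfl w ⟨i, ⟨hi, rfl | rfl⟩ | ⟨hi, rfl | rfl⟩⟩
  · exact monSpan_mono (by omega) (key _ 1 hv i n)
  · exact monSpan_mono (by omega) (key _ 1 hg i n)
  · exact monSpan_mono (by omega) (key _ 2 he i n)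
  · exact monSpan_mono (by omega) (key _ 2 hh i n)

theorem g_mul_mem_monSpan (h : IsEnvelope (K1 k) (K1.gen k) NSGen.loc A φ) (n : ℕ) {d : ℕ} {w : A}
    (hw : w ∈ monSpan φ d) : A.prod n (φ (K1.gen k .g)) w ∈ monSpan φ (d + 1) := by
  have r := h.nsRel
  have hv : ∀ d, φ (K1.gen k .v) ∈ monSpan φ (d + 1) := fun d => v_mem_monSpan (by omega)
  have hg : ∀ d, φ (K1.gen k .g) ∈ monSpan φ (d + 1) := fun d => g_mem_monSpan (by omega)
  have he : ∀ d, eElt A.prod (φ (K1.gen k .g)) ∈ monSpan φ (d + 2) := fun d =>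
    e_mem_monSpan (by omega)
  have hh : ∀ d, hElt A.prod (φ (K1.gen k .g)) ∈ monSpan φ (d + 2) := fun d =>
    h_mem_monSpan (by omega)
  refine mul_mem_monSpan r.sesq r.G_V0 (fun n => ?_) (fun n => ?_) (fun n => ?_) (fun n => ?_) n hw
  · match n with
    | 0 =>
      rw [r.g0v]
      exact Submodule.sub_mem _ (V0_mem_monSpan r.sesq (hg 0))
        (monSpan_k_smul _ (Submodule.smul_mem _ _ (Submodule.sub_mem _ (hg 1) (hh 0))))
    | 1 =>
      rw [r.g1v]
      exact Submodule.add_mem _ (monSpan_k_smul _ (hg 1)) (monSpan_k_smul _ (hh 0))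
    | n + 2 =>
      rw [r.g_v _ (by omega)]
      exact Submodule.zero_mem _
  · match n with
    | 0 =>
      rw [r.g0g]
      exact Submodule.sub_mem _ (monSpan_k_smul _ (hv 1))
        (monSpan_k_smul _ (Submodule.smul_mem _ _ (he 0)))
    | 1 =>
      rw [NSRel.g1g]
      exact monSpan_k_smul _ (he 0)
    | n + 2 =>
      rw [r.gg _ (by omega)]
      exact Submodule.zero_mem _
  · match n with
    | 0 =>
      rw [r.g0e]
      exact Submodule.sub_mem _ (hg 2) (hh 1)
    | n + 1 =>
      rw [r.g_e _ (by omega)]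
      exact Submodule.zero_mem _
  · match n with
    | 0 =>
      rw [r.g0h]
      exact Submodule.add_mem _ (Submodule.sub_mem _ (monSpan_k_smul _ (hv 2))
        (monSpan_k_smul _ (Submodule.smul_mem _ _ (he 1))))
        (monSpan_k_smul _ (V0_mem_monSpan r.sesq (he 0)))
    | n + 1 =>
      rw [r.g_h _ (by omega)]
      exact Submodule.zero_mem _

theorem v_mul_mem_monSpan (h : IsEnvelope (K1 k) (K1.gen k) NSGen.loc A φ) (n : ℕ) {d : ℕ} {w : A}
    (hw : w ∈ monSpan φ d) : A.prod n (φ (K1.gen k .v)) w ∈ monSpan φ (d + 1) := by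
  have r := h.nsRel
  have hv : ∀ d, φ (K1.gen k .v) ∈ monSpan φ (d + 1) := fun d => v_mem_monSpan (by omega)
  have hg : ∀ d, φ (K1.gen k .g) ∈ monSpan φ (d + 1) := fun d => g_mem_monSpan (by omega)
  have he : ∀ d, eElt A.prod (φ (K1.gen k .g)) ∈ monSpan φ (d + 2) := fun d =>
    e_mem_monSpan (by omega)
  have hh : ∀ d, hElt A.prod (φ (K1.gen k .g)) ∈ monSpan φ (d + 2) := fun d =>
    h_mem_monSpan (by omega)
  refine mul_mem_monSpan r.sesq r.V_V0 (fun n => ?_) (fun n => ?_) (fun n => ?_) (fun n => ?_) n hw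
  · match n with
    | 0 => exact V0_mem_monSpan r.sesq (hv 0)
    | 1 =>
      rw [r.v1v]
      exact Submodule.add_mem _ (hv 1) (monSpan_k_smul _ (Submodule.smul_mem _ _ (he 0)))
    | 2 =>
      rw [r.v2v]
      exact monSpan_k_smul _ (he 0)
    | n + 3 =>
      rw [r.v_v _ (by omega)]
      exact Submodule.zero_mem _
  · match n with
    | 0 => exact V0_mem_monSpan r.sesq (hg 0)
    | 1 =>
      rw [r.v1g]
      exact Submodule.sub_mem _ (hg 1) (monSpan_k_smul _ (hh 0))
    | n + 2 =>
      rw [r.vg _ (by omega)]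
      exact Submodule.zero_mem _
  · match n with
    | 0 => exact V0_mem_monSpan r.sesq (he 0)
    | 1 =>
      rw [r.v1e]
      exact monSpan_k_smul _ (he 1)
    | n + 2 =>
      rw [r.v_e _ (by omega)]
      exact Submodule.zero_mem _
  · match n with
    | 0 => exact V0_mem_monSpan r.sesq (hh 0)
    | 1 =>
      rw [r.v1h]
      exact monSpan_k_smul _ (hh 1)
    | n + 2 =>
      rw [r.v_h _ (by omega)]
      exact Submodule.zero_mem _

theorem gen_mul_mem_monSpan (h : IsEnvelope (K1 k) (K1.gen k) NSGen.loc A φ) (a : NSGen) (n : ℕ)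
    {d : ℕ} {w : A} (hw : w ∈ monSpan φ d) : A.prod n (φ (K1.gen k a)) w ∈ monSpan φ (d + 1) := by
  cases a
  · exact v_mul_mem_monSpan h n hw
  · exact g_mul_mem_monSpan h n hw

theorem nsFilt_gen (a : NSGen) : φ (K1.gen k a) ∈ nsFilt φ 1 := (IsWord.letter a).mem_filt

theorem nsFilt_V0 (hs : Sesq A.prod) {d : ℕ} {w : A} (hw : w ∈ nsFilt φ d) :
    A.prod 0 (φ (K1.gen k .v)) w ∈ nsFilt φ (d + 1) := by
  have : nsFilt φ d ≤ (nsFilt φ (d + 1)).comap (zeroMulL hs (φ (K1.gen k .v))) := by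
    refine Submodule.span_le.2 ?_
    rintro w ⟨b, e, he, hw⟩
    have hb : 0 < NSGen.loc .v b := by cases b <;> decide
    exact Submodule.mem_comap.2 (filt_mono (show e + 1 ≤ d + 1 by omega)
      (IsWord.cons NSGen.v b 0 e w hb hw).mem_filt)
  exact this hw

theorem nsFilt_e : eElt A.prod (φ (K1.gen k .g)) ∈ nsFilt φ 2 :=
  filt_k_smul _ (IsWord.cons (x := fun a => φ (K1.gen k a)) NSGen.g .g 1 1 _ (by decide)
    (IsWord.letter NSGen.g)).mem_filt

theorem nsFilt_h (h : IsEnvelope (K1 k) (K1.gen k) NSGen.loc A φ) :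
    hElt A.prod (φ (K1.gen k .g)) ∈ nsFilt φ 2 := by
  have h1 : hElt A.prod (φ (K1.gen k .g)) =
      (2 : k) • (φ (K1.gen k .g) - A.prod 1 (φ (K1.gen k .v)) (φ (K1.gen k .g))) := by
    rw [h.nsRel.v1g]
    module
  rw [h1]
  exact filt_k_smul _ (Submodule.sub_mem _ (filt_mono one_le_two (nsFilt_gen .g))
    (IsWord.cons (x := fun a => φ (K1.gen k a)) NSGen.v .g 1 1 _ (by decide)
    (IsWord.letter NSGen.g)).mem_filt)

/-- The filtration by word length has a monomial basis. -/
theorem nsFilt_eq_monSpan (h : IsEnvelope (K1 k) (K1.gen k) NSGen.loc A φ) (d : ℕ) :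
    nsFilt φ d = monSpan φ d := by
  apply le_antisymm
  · refine Submodule.span_le.2 ?_
    rintro w ⟨a, e, he, hw⟩
    refine monSpan_mono he ?_
    clear he
    induction hw with
    | letter a =>
      cases a
      · exact v_mem_monSpan le_rfl
      · exact g_mem_monSpan le_rfl
    | cons a b n d w hn hw ih => exact gen_mul_mem_monSpan h a n ih
  · have key : ∀ (m : A) (c : ℕ), m ∈ nsFilt φ c → ∀ i, vPow φ i m ∈ nsFilt φ (i + c) := by
      intro m c hm i
      induction i with
      | zero => rwa [zero_add]
      | succ i ih =>
        rw [vPow_succ]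
        exact filt_mono (by omega) (nsFilt_V0 h.nsRel.sesq ih)
    refine Submodule.span_le.2 ?_
    rintro w ⟨i, ⟨hi, rfl | rfl⟩ | ⟨hi, rfl | rfl⟩⟩
    · exact filt_mono hi (key _ 1 (nsFilt_gen _) i)
    · exact filt_mono hi (key _ 1 (nsFilt_gen _) i)
    · exact filt_mono hi (key _ 2 nsFilt_e i)
    · exact filt_mono hi (key _ 2 (nsFilt_h h) i)

theorem nsFilt_gen_mul (h : IsEnvelope (K1 k) (K1.gen k) NSGen.loc A φ) (a : NSGen) (n : ℕ)
    {d : ℕ} {w : A} (hw : w ∈ nsFilt φ d) : A.prod n (φ (K1.gen k a)) w ∈ nsFilt φ (d + 1) := by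
  rw [nsFilt_eq_monSpan h] at hw ⊢
  exact gen_mul_mem_monSpan h a n hw

theorem nsFilt_mul (h : IsEnvelope (K1 k) (K1.gen k) NSGen.loc A φ) (n : ℕ) {d e : ℕ} {w z : A}
    (hw : w ∈ nsFilt φ d) (hz : z ∈ nsFilt φ e) : A.prod n w z ∈ nsFilt φ (d + e) := by
  refine sesq_mem h.conformal.sesq _ (T := nsFilt φ e) ?_ n hw (by rwa [Submodule.span_eq])
  rintro n w ⟨a, c, hc, hw⟩ z hz
  refine filt_mono (show c + e ≤ d + e by omega) ?_
  clear hc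
  induction hw generalizing n z with
  | letter a => exact filt_mono (by omega) (nsFilt_gen_mul h a n hz)
  | cons a b m c w hm hw ih =>
    exact h.assoc.mem_of_right ((nsFilt φ (c + 1 + e)).restrictScalars k) (fun n m =>
      filt_mono (by omega) (nsFilt_gen_mul h a n (ih m z hz))) m n

theorem nsFilt_map (y : K1 k) : φ y ∈ nsFilt φ 1 := by
  have h1 : Submodule.span k[X] (Set.range (K1.gen k)) ≤ (nsFilt φ 1).comap φ := by
    refine Submodule.span_le.2 ?_
    rintro _ ⟨a, rfl⟩
    exact nsFilt_gen a
  exact h1 (K1_span (k := k) ▸ Submodule.mem_top)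

end NSFiltration

section AlmostCommutative

variable {k : Type u} [Field k] [CharZero k]

/-- An associative conformal superalgebra whose filtration by word length has a commutative
associated graded algebra, and whose supercommutators satisfy the usual identities. -/
structure AlmostCommutative (U : ConfData k) {ι : Type} (x : ι → U) (N : ι → ι → ℕ) : Prop where
  conformal : IsConformal U.parity U.prod
  assoc : IsAssociative U.prod
  homogeneous : ∀ a, ∃ i, x a ∈ U.parity i
  skew : ∀ {ε : ℤ}, ε * ε = 1 → ∀ (n : ℕ) (w z : U), commL U.prod conformal.loc ε n w z =
    -(ε • curly (commL U.prod conformal.loc ε) n z w)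
  leibniz : ∀ (ε ε' : ℤ) (n m : ℕ) (w y z : U),
    commL U.prod conformal.loc (ε * ε') n w (U.prod m y z) =
      ∑ s ∈ Finset.range (n + 1), (n.choose s : k) •
        U.prod (n + m - s) (commL U.prod conformal.loc ε s w y) z
      + ε • U.prod m y (commL U.prod conformal.loc ε' n w z)
  jacobi : ∀ {ε ε' ε'' : ℤ}, ε * ε = 1 → ∀ (n m : ℕ) (w y z : U),
    commL U.prod conformal.loc (ε * ε') n w (commL U.prod conformal.loc ε'' m y z) -
      ε • commL U.prod conformal.loc (ε * ε'') m y (commL U.prod conformal.loc ε' n w z) =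
      ∑ s ∈ Finset.range (n + 1), (n.choose s : k) •
        commL U.prod conformal.loc (ε' * ε'') (n + m - s)
          (commL U.prod conformal.loc ε s w y) z
  mul_mem : ∀ (n : ℕ) {d e : ℕ} {w z : U}, w ∈ filt U x N d → z ∈ filt U x N e →
    U.prod n w z ∈ filt U x N (d + e)
  comm_mem : ∀ {i j : ZMod 2} (n : ℕ) {a b : ι} {d e : ℕ} {w z : U}, w ∈ U.parity i →
    z ∈ U.parity j → IsWord U x N a d w → IsWord U x N b e z →
    commL U.prod conformal.loc (sgn i j) n w z ∈ filt U x N (d + e - 1)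

variable {A : ConfData k} {φ : K1 k →ₗ[k[X]] A}

section Special

variable (hA : IsConformal A.parity A.prod) (Φ : A →ₗ[k[X]] Matrix (Fin 2) (Fin 2) k[X][X])
  (hm : ∀ n x y, Φ (A.prod n x y) = cendProd k n (Φ x) (Φ y))

include hm in
theorem map_commL (ε : ℤ) (n : ℕ) (x y : A) :
    Φ (commL A.prod hA.loc ε n x y) =
      commL (cendProd k) cend_loc ε n (Φ x) (Φ y) := by
  rw [commL_apply, commL_apply, map_sub, map_zsmul, hm,
    curly_map hA.loc Φ (fun n => hm n y x), ← commL_apply cend_loc]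

theorem hom_k_smul (a : k) (x : A) : Φ (a • x) = a • Φ x := by
  rw [k_smul_eq, map_smul]
  exact C_smul' a (Φ x)

variable (hΦ : Function.Injective Φ)
include hm hΦ

theorem skew_of_injective {ε : ℤ} (hε : ε * ε = 1) (n : ℕ) (w z : A) :
    commL A.prod hA.loc ε n w z = -(ε • curly (commL A.prod hA.loc ε) n z w) := by
  apply hΦ
  rw [map_neg, map_zsmul, map_commL hA Φ hm,
    curly_map (commL_loc hA.loc ε) Φ (fun n => map_commL hA Φ hm ε n z w)]
  exact cend_comm_skew hε n _ _

theorem leibniz_of_injective (ε ε' : ℤ) (n m : ℕ) (w y z : A) :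
    commL A.prod hA.loc (ε * ε') n w (A.prod m y z) =
      ∑ s ∈ Finset.range (n + 1), (n.choose s : k) •
        A.prod (n + m - s) (commL A.prod hA.loc ε s w y) z
      + ε • A.prod m y (commL A.prod hA.loc ε' n w z) := by
  apply hΦ
  simp only [map_add, map_sum, map_zsmul, hom_k_smul, hm, map_commL hA Φ hm]
  exact cend_leibniz ε ε' n m _ _ _

theorem jacobi_of_injective {ε ε' ε'' : ℤ} (hε : ε * ε = 1) (n m : ℕ) (w y z : A) :
    commL A.prod hA.loc (ε * ε') n w (commL A.prod hA.loc ε'' m y z) -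
      ε • commL A.prod hA.loc (ε * ε'') m y (commL A.prod hA.loc ε' n w z) =
      ∑ s ∈ Finset.range (n + 1), (n.choose s : k) •
        commL A.prod hA.loc (ε' * ε'') (n + m - s) (commL A.prod hA.loc ε s w y) z := by
  apply hΦ
  simp only [map_sub, map_sum, map_zsmul, hom_k_smul, map_commL hA Φ hm]
  exact cend_jacobi hε n m _ _ _

theorem comm_mem_symm {ε : ℤ} (hε : ε * ε = 1) (W : Submodule k[X] A) {w z : A}
    (hW : ∀ n, commL A.prod hA.loc ε n w z ∈ W) (n : ℕ) : commL A.prod hA.loc ε n z w ∈ W := by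
  rw [skew_of_injective hA Φ hm hΦ hε]
  exact W.neg_mem (zsmul_mem (curly_mem (commL_loc hA.loc ε) W hW n) ε)

end Special

theorem gen_mem_parity (h : IsEnvelope (K1 k) (K1.gen k) NSGen.loc A φ) (a : NSGen) :
    φ (K1.gen k a) ∈ A.parity a.par := h.map_parity _ _ (K1_gen_mem a)

theorem nsFilt_comm_gen (h : IsEnvelope (K1 k) (K1.gen k) NSGen.loc A φ) (a b : NSGen) (n : ℕ) :
    commL A.prod h.conformal.loc (sgn a.par b.par) n (φ (K1.gen k a)) (φ (K1.gen k b)) ∈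
      nsFilt φ 1 := by
  have h1 := h.map_bracket _ _ n _ _ (K1_gen_mem (k := k) a) (K1_gen_mem b)
  have h2 := nsFilt_map (φ := φ) ((K1 k).prod n (K1.gen k a) (K1.gen k b))
  rw [h1] at h2
  exact h2

theorem parity_unique (hA : IsConformal A.parity A.prod) {i j : ZMod 2} {x : A}
    (hi : x ∈ A.parity i) (hj : x ∈ A.parity j) : i = j ∨ x = 0 := by
  have hd := hA.isCompl.disjoint
  rcases zmod_two_cases i with rfl | rfl <;> rcases zmod_two_cases j with rfl | rfl
  · exact Or.inl rfl
  · exact Or.inr (Submodule.disjoint_def.1 hd x hi hj)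
  · exact Or.inr (Submodule.disjoint_def.1 hd x hj hi)
  · exact Or.inl rfl

variable (h : IsEnvelope (K1 k) (K1.gen k) NSGen.loc A φ) (Φ : A →ₗ[k[X]] Matrix (Fin 2) (Fin 2) k[X][X])
  (hm : ∀ n x y, Φ (A.prod n x y) = cendProd k n (Φ x) (Φ y)) (hΦ : Function.Injective Φ)
include hm hΦ

theorem comm_gen_word_mem (a : NSGen) {b : NSGen} {e : ℕ} {z : A}
    (hz : IsWord A (fun a => φ (K1.gen k a)) NSGen.loc b e z) :
    ∃ j, z ∈ A.parity j ∧ ∀ n,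
      commL A.prod h.conformal.loc (sgn a.par j) n (φ (K1.gen k a)) z ∈ nsFilt φ e := by
  induction hz with
  | letter b =>
    refine ⟨b.par, gen_mem_parity h b, fun n => ?_⟩
    exact nsFilt_comm_gen h a b n
  | cons b c m e z hlt hz ih =>
    obtain ⟨j, hj, ih⟩ := ih
    refine ⟨b.par + j, h.conformal.mem_parity _ _ _ _ _ (gen_mem_parity h b) hj, fun n => ?_⟩
    rw [sgn_add_right, leibniz_of_injective h.conformal Φ hm hΦ]
    refine Submodule.add_mem _ (Submodule.sum_mem _ fun s _ => filt_k_smul _ ?_) (zsmul_mem ?_ _)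
    · exact filt_mono (by omega) (nsFilt_mul h _ (nsFilt_comm_gen h a b s) hz.mem_filt)
    · exact filt_mono (by omega) (nsFilt_gen_mul h b m (ih n))

theorem comm_word_word_mem {a b : NSGen} {d e : ℕ} {w z : A}
    (hw : IsWord A (fun a => φ (K1.gen k a)) NSGen.loc a d w)
    (hz : IsWord A (fun a => φ (K1.gen k a)) NSGen.loc b e z) :
    ∃ i j, w ∈ A.parity i ∧ z ∈ A.parity j ∧ ∀ n,
      commL A.prod h.conformal.loc (sgn i j) n w z ∈ nsFilt φ (d + e - 1) := by
  induction hw with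
  | letter a =>
    obtain ⟨j, hj, hn⟩ := comm_gen_word_mem h Φ hm hΦ a hz
    exact ⟨a.par, j, gen_mem_parity h a, hj, fun n => filt_mono (by omega) (hn n)⟩
  | cons a c m d w hlt hw ih =>
    obtain ⟨i, j, hi, hj, ih⟩ := ih
    obtain ⟨j', hj', hn⟩ := comm_gen_word_mem h Φ hm hΦ a hz
    have hne : ∃ j, z ∈ A.parity j ∧ (∀ n, commL A.prod h.conformal.loc (sgn a.par j) n
        (φ (K1.gen k a)) z ∈ nsFilt φ e) ∧
        ∀ n, commL A.prod h.conformal.loc (sgn i j) n w z ∈ nsFilt φ (d + e - 1) := by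
      rcases parity_unique h.conformal hj hj' with rfl | rfl
      · exact ⟨j, hj, hn, ih⟩
      · exact ⟨j, hj, fun n => by simp, ih⟩
    obtain ⟨j, hj, h1, h2⟩ := hne
    refine ⟨a.par + i, j, h.conformal.mem_parity _ _ _ _ _ (gen_mem_parity h a) hi, hj, ?_⟩
    refine comm_mem_symm h.conformal Φ hm hΦ (sgn_mul_self _ _) _ fun n => ?_
    have hw1 := hw.pos
    have hz1 := hz.pos
    rw [sgn_add_left, leibniz_of_injective h.conformal Φ hm hΦ]
    refine Submodule.add_mem _ (Submodule.sum_mem _ fun s _ => filt_k_smul _ ?_) (zsmul_mem ?_ _)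
    · exact filt_mono (by omega) (nsFilt_mul h _
        (comm_mem_symm h.conformal Φ hm hΦ (sgn_mul_self _ _) _ h1 s) hw.mem_filt)
    · exact filt_mono (by omega) (nsFilt_gen_mul h a m
        (comm_mem_symm h.conformal Φ hm hΦ (sgn_mul_self _ _) _ h2 n))

include h in
theorem almostCommutative :
    AlmostCommutative A (fun a => φ (K1.gen k a)) NSGen.loc where
  conformal := h.conformal
  assoc := h.assoc
  homogeneous a := ⟨a.par, gen_mem_parity h a⟩
  skew hε n w z := skew_of_injective h.conformal Φ hm hΦ hε n w z
  leibniz ε ε' n m w y z := leibniz_of_injective h.conformal Φ hm hΦ ε ε' n m w y z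
  jacobi hε n m w y z := jacobi_of_injective h.conformal Φ hm hΦ hε n m w y z
  mul_mem n _ _ _ _ hw hz := nsFilt_mul h n hw hz
  comm_mem n a b d e w z hi hj hw hz := by
    obtain ⟨i', j', hi', hj', H⟩ := comm_word_word_mem h Φ hm hΦ hw hz
    rcases parity_unique h.conformal hi hi' with rfl | rfl
    · rcases parity_unique h.conformal hj hj' with rfl | rfl
      · exact H n
      · simp
    · simp

end AlmostCommutative

section Symbols

variable {k : Type u} [Field k] {U : ConfData k} {ι : Type} {x : ι → U} {N : ι → ι → ℕ}

variable (x N) in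
/-- The projection `F_d → F_d / F_{d-1}`. -/
def grMk (d : ℕ) : filt U x N d →ₗ[k[X]] GrPiece U x N d :=
  ((filt U x N (d - 1)).submoduleOf (filt U x N d)).mkQ

theorem grMk_surjective (d : ℕ) : Function.Surjective (grMk x N d) := Submodule.mkQ_surjective _

theorem grMk_eq_zero {d : ℕ} {w : filt U x N d} :
    grMk x N d w = 0 ↔ (w : U) ∈ filt U x N (d - 1) :=
  Submodule.Quotient.mk_eq_zero _

variable (x N) in
/-- The class in degree `d`, as a linear map. -/
def symbL (d : ℕ) : filt U x N d →ₗ[k[X]] Gr U x N :=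
  DirectSum.lof k[X] ℕ (GrPiece U x N) d ∘ₗ grMk x N d

theorem symbL_eq_zero {d : ℕ} {w : filt U x N d} :
    symbL x N d w = 0 ↔ (w : U) ∈ filt U x N (d - 1) := by
  rw [symbL, LinearMap.comp_apply, DirectSum.lof_eq_of,
    (injective_iff_map_eq_zero' _).1 (DirectSum.of_injective (β := GrPiece U x N) d)]
  exact grMk_eq_zero

/-- `z` is the class of `w ∈ F_d` in degree `d`. -/
def IsSymb (d : ℕ) (w : U) (z : Gr U x N) : Prop :=
  ∃ hw : w ∈ filt U x N d, z = symb U x N d w hw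

theorem isSymb_symb {d : ℕ} {w : U} (hw : w ∈ filt U x N d) : IsSymb d w (symb U x N d w hw) :=
  ⟨hw, rfl⟩

namespace IsSymb

variable {d d' : ℕ} {w w' : U} {z z' : Gr U x N}

theorem mem (h : IsSymb d w z) : w ∈ filt U x N d := h.1

theorem eq (h : IsSymb d w z) : z = symbL x N d ⟨w, h.mem⟩ := h.2

theorem unique (h : IsSymb d w z) (h' : IsSymb d w z') : z = z' := h.eq.trans h'.eq.symm

theorem cast (h : IsSymb d w z) (hd : d = d') : IsSymb d' w z := hd ▸ h

theorem congr (h : IsSymb d w z) (hw : w = w') : IsSymb d w' z := hw ▸ h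

theorem add (h : IsSymb d w z) (h' : IsSymb d w' z') : IsSymb d (w + w') (z + z') := by
  obtain ⟨hw, rfl⟩ := h
  obtain ⟨hw', rfl⟩ := h'
  exact ⟨_, (map_add (symbL x N d) ⟨w, hw⟩ ⟨w', hw'⟩).symm⟩

theorem smul (h : IsSymb d w z) (f : k[X]) : IsSymb d (f • w) (f • z) := by
  obtain ⟨hw, rfl⟩ := h
  exact ⟨_, (map_smul (symbL x N d) f ⟨w, hw⟩).symm⟩

theorem neg (h : IsSymb d w z) : IsSymb d (-w) (-z) := by
  obtain ⟨hw, rfl⟩ := h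
  exact ⟨_, (map_neg (symbL x N d) ⟨w, hw⟩).symm⟩

theorem sub (h : IsSymb d w z) (h' : IsSymb d w' z') : IsSymb d (w - w') (z - z') := by
  rw [sub_eq_add_neg, sub_eq_add_neg]
  exact h.add h'.neg

theorem k_smul (h : IsSymb d w z) (a : k) : IsSymb d (a • w) (a • z) := by
  rw [k_smul_eq, k_smul_eq]
  exact h.smul _

theorem zsmul (h : IsSymb d w z) (a : ℤ) : IsSymb d (a • w) (a • z) := by
  rw [← Int.cast_smul_eq_zsmul k[X], ← Int.cast_smul_eq_zsmul k[X]]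
  exact h.smul _

theorem eq_zero_iff (h : IsSymb d w z) : z = 0 ↔ w ∈ filt U x N (d - 1) := by
  rw [h.eq, symbL_eq_zero]

theorem zero (d : ℕ) : IsSymb d (0 : U) (0 : Gr U x N) :=
  ⟨Submodule.zero_mem _, (map_zero (symbL x N d)).symm⟩

theorem sum {κ : Type*} (t : Finset κ) {f : κ → U} {g : κ → Gr U x N}
    (h : ∀ i ∈ t, IsSymb d (f i) (g i)) : IsSymb d (∑ i ∈ t, f i) (∑ i ∈ t, g i) := by
  classical
  induction t using Finset.induction_on with
  | empty => exact zero d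
  | insert a t ha ih =>
    rw [Finset.sum_insert ha, Finset.sum_insert ha]
    exact (h a (Finset.mem_insert_self _ _)).add
      (ih fun i hi => h i (Finset.mem_insert_of_mem hi))

theorem lam {c : ℕ → U} {c' : ℕ → Gr U x N} (hc : EvZero c) (hc' : EvZero c')
    (h : ∀ n, IsSymb d (c n) (c' n)) (s : k[X]) : IsSymb d (lam s c) (lam s c') := by
  obtain ⟨K, hK⟩ := hc
  obtain ⟨K', hK'⟩ := hc'
  rw [lam_eq_sum (N := max K K') s fun n hn => hK n (le_trans (le_max_left _ _) hn),
    lam_eq_sum (N := max K K') s fun n hn => hK' n (le_trans (le_max_right _ _) hn)]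
  exact sum _ fun i _ => (h i).smul _

theorem curly [CharZero k] {p : ℕ → U →ₗ[k] U →ₗ[k] U} {q : ℕ → Gr U x N →ₗ[k] Gr U x N →ₗ[k] Gr U x N}
    (hp : Loc p) (hq : Loc q) (h : ∀ n, IsSymb d (p n w w') (q n z z')) (n : ℕ) :
    IsSymb d (curly p n w w') (curly q n z z') := by
  rw [curly_eq_lam, curly_eq_lam]
  exact (lam ((hp w w').shift n) ((hq z z').shift n) (fun s => h _) _).smul _

end IsSymb

/-- The linear map on the associated graded module defined by compatible maps on the filtration. -/
def grLift {M : Type u} [AddCommGroup M] [Module k[X] M] (f : ∀ d, filt U x N d →ₗ[k[X]] M)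
    (hf : ∀ d (w : filt U x N d), (w : U) ∈ filt U x N (d - 1) → f d w = 0) :
    Gr U x N →ₗ[k[X]] M :=
  DirectSum.toModule k[X] ℕ M fun d =>
    Submodule.liftQ ((filt U x N (d - 1)).submoduleOf (filt U x N d)) (f d) fun w hw => hf d w hw

theorem IsSymb.grLift {M : Type u} [AddCommGroup M] [Module k[X] M]
    {f : ∀ d, filt U x N d →ₗ[k[X]] M}
    {hf : ∀ d (w : filt U x N d), (w : U) ∈ filt U x N (d - 1) → f d w = 0} {d : ℕ} {w : U}
    {z : Gr U x N} (h : IsSymb d w z) : grLift f hf z = f d ⟨w, h.mem⟩ := by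
  obtain ⟨hw, rfl⟩ := h
  exact (DirectSum.toModule_lof k[X] (M := GrPiece U x N) (φ := fun d =>
    Submodule.liftQ ((filt U x N (d - 1)).submoduleOf (filt U x N d)) (f d)
      fun w hw => hf d w hw) d (GrPiece.mk U x N d w hw))

theorem exists_grSec (d : ℕ) : ∃ s : GrPiece U x N d →ₗ[k] filt U x N d,
    ∀ z, grMk x N d (s z) = z := by
  obtain ⟨s, hs⟩ := LinearMap.exists_rightInverse_of_surjective ((grMk x N d).restrictScalars k)
    (LinearMap.range_eq_top.2 (grMk_surjective d))
  exact ⟨s, fun z => LinearMap.congr_fun hs z⟩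

variable (x N) in
/-- A linear section of the projection `F_d → F_d / F_{d-1}`. -/
def grSec (d : ℕ) : GrPiece U x N d →ₗ[k] filt U x N d := (exists_grSec d).choose

theorem symbL_grSec (d : ℕ) (z : GrPiece U x N d) :
    symbL x N d (grSec x N d z) = DirectSum.lof k ℕ (GrPiece U x N) d z :=
  congrArg (DirectSum.lof k[X] ℕ (GrPiece U x N) d) ((exists_grSec d).choose_spec z)

section Op

variable (B : U →ₗ[k] U →ₗ[k] U) (τ : ℕ → ℕ → ℕ)
  (hB : ∀ {d e : ℕ} {w z : U}, w ∈ filt U x N d → z ∈ filt U x N e → B w z ∈ filt U x N (τ d e))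

/-- The homogeneous components of the operation induced on the associated graded module. -/
def grOpPiece (d e : ℕ) : GrPiece U x N d →ₗ[k] GrPiece U x N e →ₗ[k] Gr U x N :=
  LinearMap.mk₂ k (fun a b => symb U x N (τ d e) (B (grSec x N d a) (grSec x N e b))
      (hB (grSec x N d a).2 (grSec x N e b).2))
    (fun a a' b => (isSymb_symb _).unique (((isSymb_symb _).add (isSymb_symb _)).congr (by simp)))
    (fun c a b => (isSymb_symb _).unique (((isSymb_symb _).k_smul c).congr (by simp)))
    (fun a b b' => (isSymb_symb _).unique (((isSymb_symb _).add (isSymb_symb _)).congr (by simp)))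
    (fun c a b => (isSymb_symb _).unique (((isSymb_symb _).k_smul c).congr (by simp)))

/-- The operation induced on the associated graded module. -/
def grOp : Gr U x N →ₗ[k] Gr U x N →ₗ[k] Gr U x N :=
  DirectSum.toModule k ℕ _ fun d =>
    LinearMap.flip (DirectSum.toModule k ℕ _ fun e => (grOpPiece B τ hB d e).flip)

theorem grOp_lof (d e : ℕ) (a : GrPiece U x N d) (b : GrPiece U x N e) :
    grOp B τ hB (DirectSum.lof k ℕ (GrPiece U x N) d a) (DirectSum.lof k ℕ (GrPiece U x N) e b) =
      grOpPiece B τ hB d e a b := by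
  rw [grOp, DirectSum.toModule_lof, LinearMap.flip_apply, DirectSum.toModule_lof,
    LinearMap.flip_apply]

theorem grOp_isSymb
    (hl : ∀ {d e : ℕ} {w z : U}, w ∈ filt U x N (d - 1) → z ∈ filt U x N e →
      B w z ∈ filt U x N (τ d e - 1))
    (hr : ∀ {d e : ℕ} {w z : U}, w ∈ filt U x N d → z ∈ filt U x N (e - 1) →
      B w z ∈ filt U x N (τ d e - 1))
    {d e : ℕ} {w z : U} {a b : Gr U x N} (ha : IsSymb d w a) (hb : IsSymb e z b) :
    IsSymb (τ d e) (B w z) (grOp B τ hB a b) := by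
  obtain ⟨hw, rfl⟩ := ha
  obtain ⟨hz, rfl⟩ := hb
  set a' := GrPiece.mk U x N d w hw
  set b' := GrPiece.mk U x N e z hz
  have h1 : grOp B τ hB (symb U x N d w hw) (symb U x N e z hz) = grOpPiece B τ hB d e a' b' :=
    grOp_lof B τ hB d e a' b'
  have h2 : IsSymb (τ d e) (B (grSec x N d a') (grSec x N e b')) (grOpPiece B τ hB d e a' b') :=
    isSymb_symb _
  have ha : w - grSec x N d a' ∈ filt U x N (d - 1) := by
    have h3 := symbL_grSec d a'
    have h4 : symbL x N d (⟨w, hw⟩ - grSec x N d a') = 0 := by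
      rw [map_sub, h3]
      exact sub_self _
    exact symbL_eq_zero.1 h4
  have hb : z - grSec x N e b' ∈ filt U x N (e - 1) := by
    have h3 := symbL_grSec e b'
    have h4 : symbL x N e (⟨z, hz⟩ - grSec x N e b') = 0 := by
      rw [map_sub, h3]
      exact sub_self _
    exact symbL_eq_zero.1 h4
  have h5 : B w z - B (grSec x N d a') (grSec x N e b') ∈ filt U x N (τ d e - 1) := by
    have h6 : B w z - B (grSec x N d a') (grSec x N e b') =
        B (w - grSec x N d a') z + B (grSec x N d a') (z - grSec x N e b') := by
      simp
    rw [h6]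
    exact Submodule.add_mem _ (hl ha hz) (hr (grSec x N d a').2 hb)
  rw [h1]
  have h7 : IsSymb (x := x) (N := N) (τ d e) (B w z - B (grSec x N d a') (grSec x N e b')) 0 := by
    have h8 := isSymb_symb (x := x) (N := N) (filt_mono (Nat.sub_le _ _) h5)
    rw [← h8.eq_zero_iff] at h5
    rwa [h5] at h8
  simpa using h7.add h2

end Op

variable {i j : ZMod 2}

theorem IsSymb.mem_grParity {d : ℕ} {w : U} {z : Gr U x N} (h : IsSymb d w z)
    (hw : w ∈ U.parity i) : z ∈ grParity U x N i :=
  Submodule.subset_span ⟨d, w, h.mem, hw, h.2⟩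

theorem grParity_induction {P : Gr U x N → Prop} (h0 : P 0) (hadd : ∀ a b, P a → P b → P (a + b))
    (hs : ∀ d w a, 1 ≤ d → w ∈ U.parity i → IsSymb d w a → P a) {z : Gr U x N}
    (hz : z ∈ grParity U x N i) : P z := by
  suffices ∀ f : k[X], P (f • z) by simpa using this 1
  induction hz using Submodule.span_induction with
  | mem z hz =>
    intro f
    obtain ⟨d, w, hw, hi, rfl⟩ := hz
    rcases Nat.eq_zero_or_pos d with rfl | hd
    · have h1 := (isSymb_symb hw).eq_zero_iff.2 hw
      rw [h1, smul_zero]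
      exact h0
    · exact hs d (f • w) _ hd (Submodule.smul_mem _ _ hi) ((isSymb_symb hw).smul f)
  | zero => simpa using h0
  | add a b _ _ ha hb =>
    intro f
    rw [smul_add]
    exact hadd _ _ (ha f) (hb f)
  | smul c a _ ha =>
    intro f
    rw [smul_smul]
    exact ha _

end Symbols

section Parity

variable {k : Type u} [Field k] [CharZero k] {U : ConfData k} {ι : Type} {x : ι → U}
  {N : ι → ι → ℕ}

/-- The projection onto the odd part. -/
def oddProj (hU : IsConformal U.parity U.prod) : U →ₗ[k[X]] U := Submodule.projection _ _ hU.isCompl.symm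

theorem oddProj_even (hU : IsConformal U.parity U.prod) {w : U} (hw : w ∈ U.parity 0) :
    oddProj hU w = 0 := Submodule.projection_apply_right hU.isCompl.symm ⟨w, hw⟩

theorem oddProj_odd (hU : IsConformal U.parity U.prod) {w : U} (hw : w ∈ U.parity 1) :
    oddProj hU w = w := Submodule.projection_apply_left hU.isCompl.symm ⟨w, hw⟩

theorem oddProj_mem (hU : IsConformal U.parity U.prod) (w : U) : oddProj hU w ∈ U.parity 1 :=
  Submodule.projection_apply_mem hU.isCompl.symm w

theorem sub_oddProj_mem (hU : IsConformal U.parity U.prod) (w : U) :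
    w - oddProj hU w ∈ U.parity 0 := by
  rw [← Submodule.projection_apply_eq_zero_iff hU.isCompl.symm]
  change oddProj hU (w - oddProj hU w) = 0
  rw [map_sub, oddProj_odd hU (oddProj_mem hU w), sub_self]

theorem AlmostCommutative.oddProj_filt (ac : AlmostCommutative U x N) {d : ℕ} {w : U}
    (hw : w ∈ filt U x N d) : oddProj ac.conformal w ∈ filt U x N d := by
  have h1 : filt U x N d ≤ (filt U x N d).comap (oddProj ac.conformal) := by
    refine Submodule.span_le.2 ?_
    rintro w ⟨a, e, he, hw⟩
    refine Submodule.mem_comap.2 ?_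
    obtain ⟨i, hi⟩ := hw.homogeneous ac.conformal ac.homogeneous
    rcases zmod_two_cases i with rfl | rfl
    · rw [oddProj_even _ hi]
      exact Submodule.zero_mem _
    · rw [oddProj_odd _ hi]
      exact filt_mono he hw.mem_filt
  exact h1 hw

theorem AlmostCommutative.gr_induction (ac : AlmostCommutative U x N) {P : Gr U x N → Prop}
    (h0 : P 0) (hadd : ∀ a b, P a → P b → P (a + b))
    (hs : ∀ i d w a, 1 ≤ d → w ∈ U.parity i → IsSymb d w a → P a) (z : Gr U x N) : P z := by
  induction z using DirectSum.induction_on with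
  | zero => exact h0
  | of d z =>
    obtain ⟨⟨w, hw⟩, rfl⟩ := Submodule.Quotient.mk_surjective _ z
    change P (symb U x N d w hw)
    have hw1 := ac.oddProj_filt hw
    have h1 : symb U x N d w hw = symb U x N d (w - oddProj ac.conformal w)
        (Submodule.sub_mem _ hw hw1) + symb U x N d (oddProj ac.conformal w) hw1 :=
      (isSymb_symb _).unique (((isSymb_symb _).add (isSymb_symb _)).congr (by simp))
    rw [h1]
    exact hadd _ _
      (grParity_induction h0 hadd (hs 0)
        ((isSymb_symb _).mem_grParity (sub_oddProj_mem ac.conformal w)))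
      (grParity_induction h0 hadd (hs 1)
        ((isSymb_symb _).mem_grParity (oddProj_mem ac.conformal w)))
  | add a b ha hb => exact hadd _ _ ha hb

/-- The supercommutator, as a bilinear operation. -/
def superComm (hU : IsConformal U.parity U.prod) (n : ℕ) : U →ₗ[k] U →ₗ[k] U :=
  commL U.prod hU.loc 1 n + (2 : ℤ) • (curlyL U.prod hU.loc n).flip.compl₁₂
    ((oddProj hU).restrictScalars k) ((oddProj hU).restrictScalars k)

theorem superComm_apply (hU : IsConformal U.parity U.prod) (n : ℕ) (w z : U) :
    superComm hU n w z = commL U.prod hU.loc 1 n w z +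
      (2 : ℤ) • curly U.prod n (oddProj hU z) (oddProj hU w) := rfl

theorem curly_zero_left {M : Type u} [AddCommGroup M] [Module k M] [Module k[X] M]
    [IsScalarTower k k[X] M] (p : ℕ → M →ₗ[k] M →ₗ[k] M) (n : ℕ) (y : M) : curly p n 0 y = 0 := by
  simp [curly]

theorem curly_zero_right {M : Type u} [AddCommGroup M] [Module k M] [Module k[X] M]
    [IsScalarTower k k[X] M] (p : ℕ → M →ₗ[k] M →ₗ[k] M) (n : ℕ) (y : M) : curly p n y 0 = 0 := by
  simp [curly]

theorem superComm_of_parity (hU : IsConformal U.parity U.prod) {i j : ZMod 2} {w z : U}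
    (hw : w ∈ U.parity i) (hz : z ∈ U.parity j) (n : ℕ) :
    superComm hU n w z = commL U.prod hU.loc (sgn i j) n w z := by
  rw [superComm_apply, commL_apply, commL_apply]
  rcases zmod_two_cases i with rfl | rfl
  · rw [oddProj_even hU hw, curly_zero_right, sgn_zero_left, smul_zero, add_zero]
  · rcases zmod_two_cases j with rfl | rfl
    · rw [oddProj_even hU hz, curly_zero_left, sgn_zero_right, smul_zero, add_zero]
    · rw [oddProj_odd hU hw, oddProj_odd hU hz, sgn_one_one]
      module

theorem superComm_sesq (hU : IsConformal U.parity U.prod) : Sesq (superComm hU) where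
  left n w z := by
    simp only [superComm_apply, (commL_sesq hU.loc hU.sesq 1).left, map_smul,
      curly_sesq_right hU.loc hU.sesq, smul_add, smul_neg, smul_comm (2 : ℤ)]
    abel
  right n w z := by
    simp only [superComm_apply, (commL_sesq hU.loc hU.sesq 1).right, map_smul,
      curly_sesq_left hU.loc hU.sesq, smul_add, smul_comm (2 : ℤ)]
    abel

variable (ac : AlmostCommutative U x N)
include ac

theorem AlmostCommutative.superComm_mem (n : ℕ) {d e : ℕ} {w z : U} (hw : w ∈ filt U x N d)
    (hz : z ∈ filt U x N e) : superComm ac.conformal n w z ∈ filt U x N (d + e - 1) := by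
  refine sesq_mem (superComm_sesq ac.conformal) _ ?_ n hw hz
  rintro n w ⟨a, d', hd, hw⟩ z ⟨b, e', he, hz⟩
  obtain ⟨i, hi⟩ := hw.homogeneous ac.conformal ac.homogeneous
  obtain ⟨j, hj⟩ := hz.homogeneous ac.conformal ac.homogeneous
  rw [superComm_of_parity ac.conformal hi hj]
  exact filt_mono (by omega) (ac.comm_mem n hi hj hw hz)

theorem AlmostCommutative.comm_mem_filt (n : ℕ) {i j : ZMod 2} {d e : ℕ} {w z : U}
    (hi : w ∈ U.parity i) (hj : z ∈ U.parity j) (hw : w ∈ filt U x N d)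
    (hz : z ∈ filt U x N e) :
    commL U.prod ac.conformal.loc (sgn i j) n w z ∈ filt U x N (d + e - 1) := by
  rw [← superComm_of_parity ac.conformal hi hj]
  exact ac.superComm_mem n hw hz

theorem AlmostCommutative.comm_mem_parity (ε : ℤ) (n : ℕ) {i j : ZMod 2} {w z : U}
    (hi : w ∈ U.parity i) (hj : z ∈ U.parity j) :
    commL U.prod ac.conformal.loc ε n w z ∈ U.parity (i + j) := by
  rw [commL_apply]
  refine Submodule.sub_mem _ (ac.conformal.mem_parity _ _ _ _ _ hi hj) (zsmul_mem ?_ _)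
  refine curly_mem ac.conformal.loc _ (fun n => ?_) n
  rw [add_comm i j]
  exact ac.conformal.mem_parity _ _ _ _ _ hj hi

/-- The product on the associated graded module. -/
def AlmostCommutative.grMul (n : ℕ) : Gr U x N →ₗ[k] Gr U x N →ₗ[k] Gr U x N :=
  grOp (U.prod n) (fun d e => d + e) (fun hw hz => ac.mul_mem n hw hz)

/-- The bracket on the associated graded module. -/
def AlmostCommutative.grBr (n : ℕ) : Gr U x N →ₗ[k] Gr U x N →ₗ[k] Gr U x N :=
  grOp (superComm ac.conformal n) (fun d e => d + e - 1) (fun hw hz => ac.superComm_mem n hw hz)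

theorem eq_zero_of_mem_filt_zero {w : U} (hw : w ∈ filt U x N 0) : w = 0 := by
  rwa [filt_zero, Submodule.mem_bot] at hw

theorem AlmostCommutative.grMul_isSymb (n : ℕ) {d e : ℕ} {w z : U} {a b : Gr U x N}
    (ha : IsSymb d w a) (hb : IsSymb e z b) : IsSymb (d + e) (U.prod n w z) (ac.grMul n a b) := by
  refine grOp_isSymb (U.prod n) (fun d e => d + e) (fun hw hz => ac.mul_mem n hw hz)
    (fun {d e w z} hw hz => ?_) (fun {d e w z} hw hz => ?_) ha hb
  · rcases Nat.eq_zero_or_pos d with rfl | hd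
    · rw [eq_zero_of_mem_filt_zero ac hw, map_zero]
      exact Submodule.zero_mem _
    · exact filt_mono (by omega) (ac.mul_mem n hw hz)
  · rcases Nat.eq_zero_or_pos e with rfl | he
    · rw [eq_zero_of_mem_filt_zero ac hz, map_zero]
      exact Submodule.zero_mem _
    · exact filt_mono (by omega) (ac.mul_mem n hw hz)

theorem AlmostCommutative.grBr_isSymb_superComm (n : ℕ) {d e : ℕ} {w z : U} {a b : Gr U x N}
    (ha : IsSymb d w a) (hb : IsSymb e z b) :
    IsSymb (d + e - 1) (superComm ac.conformal n w z) (ac.grBr n a b) := by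
  refine grOp_isSymb (superComm ac.conformal n) (fun d e => d + e - 1)
    (fun hw hz => ac.superComm_mem n hw hz) (fun {d e w z} hw hz => ?_) (fun {d e w z} hw hz => ?_) ha hb
  · rcases Nat.eq_zero_or_pos d with rfl | hd
    · rw [eq_zero_of_mem_filt_zero ac hw, map_zero]
      exact Submodule.zero_mem _
    · exact filt_mono (by omega) (ac.superComm_mem n hw hz)
  · rcases Nat.eq_zero_or_pos e with rfl | he
    · rw [eq_zero_of_mem_filt_zero ac hz, map_zero]
      exact Submodule.zero_mem _
    · exact filt_mono (by omega) (ac.superComm_mem n hw hz)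

theorem AlmostCommutative.isInduced : IsInduced U x N ac.grMul ac.grBr where
  mul_symb n _ _ _ _ hw hz := ac.grMul_isSymb n (isSymb_symb hw) (isSymb_symb hz)
  br_symb i j n _ _ _ _ hw hz hi hj := by
    have h1 := ac.grBr_isSymb_superComm n (isSymb_symb hw) (isSymb_symb hz)
    rw [superComm_of_parity ac.conformal hi hj] at h1
    exact h1

end Parity

section Poisson

variable {k : Type u} [Field k] [CharZero k] {U : ConfData k} {ι : Type} {x : ι → U}
  {N : ι → ι → ℕ} {mul br : ℕ → Gr U x N →ₗ[k] Gr U x N →ₗ[k] Gr U x N}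

theorem IsInduced.mul_isSymb (h : IsInduced U x N mul br) (n : ℕ) {d e : ℕ} {w z : U}
    {a b : Gr U x N} (ha : IsSymb d w a) (hb : IsSymb e z b) :
    IsSymb (d + e) (U.prod n w z) (mul n a b) := by
  obtain ⟨hw, rfl⟩ := ha
  obtain ⟨hz, rfl⟩ := hb
  exact h.mul_symb n d e w z hw hz

variable (ac : AlmostCommutative U x N) (h : IsInduced U x N mul br)
include ac h

theorem IsInduced.br_isSymb (n : ℕ) {i j : ZMod 2} {d e : ℕ} {w z : U}
    {a b : Gr U x N} (hi : w ∈ U.parity i) (hj : z ∈ U.parity j) (ha : IsSymb d w a)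
    (hb : IsSymb e z b) :
    IsSymb (d + e - 1) (commL U.prod ac.conformal.loc (sgn i j) n w z) (br n a b) := by
  obtain ⟨hw, rfl⟩ := ha
  obtain ⟨hz, rfl⟩ := hb
  exact h.br_symb i j n d e w z hw hz hi hj

theorem IsInduced.unique {mul' br' : ℕ → Gr U x N →ₗ[k] Gr U x N →ₗ[k] Gr U x N}
    (h' : IsInduced U x N mul' br') : mul' = mul ∧ br' = br := by
  constructor
  · refine funext fun n => LinearMap.ext₂ fun a b => ?_
    refine ac.gr_induction (P := fun a => mul' n a b = mul n a b) (by simp) (fun a b ha hb => by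
      simp only [map_add, LinearMap.add_apply, ha, hb]) (fun i d w a _ hi ha => ?_) a
    refine ac.gr_induction (P := fun b => mul' n a b = mul n a b) (by simp) (fun a b ha hb => by
      simp only [map_add, ha, hb]) (fun j e z b _ hj hb => ?_) b
    exact (h'.mul_isSymb n ha hb).unique (h.mul_isSymb n ha hb)
  · refine funext fun n => LinearMap.ext₂ fun a b => ?_
    refine ac.gr_induction (P := fun a => br' n a b = br n a b) (by simp) (fun a b ha hb => by
      simp only [map_add, LinearMap.add_apply, ha, hb]) (fun i d w a _ hi ha => ?_) a
    refine ac.gr_induction (P := fun b => br' n a b = br n a b) (by simp) (fun a b ha hb => by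
      simp only [map_add, ha, hb]) (fun j e z b _ hj hb => ?_) b
    exact (h'.br_isSymb ac n hi hj ha hb).unique (h.br_isSymb ac n hi hj ha hb)

theorem IsInduced.mul_loc : Loc mul := by
  intro a b
  refine ac.gr_induction (P := fun a => EvZero fun n => mul n a b) ⟨0, by simp⟩
    (fun a b ha hb => by simpa only [map_add, LinearMap.add_apply] using ha.add hb)
    (fun i d w a _ hi ha => ?_) a
  refine ac.gr_induction (P := fun b => EvZero fun n => mul n a b) ⟨0, by simp⟩
    (fun a b ha hb => by simpa only [map_add] using ha.add hb)
    (fun j e z b _ hj hb => ?_) b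
  obtain ⟨K, hK⟩ := ac.conformal.loc w z
  exact ⟨K, fun n hn => (h.mul_isSymb n ha hb).unique ((IsSymb.zero _).congr (hK n hn).symm)⟩

theorem IsInduced.br_loc : Loc br := by
  intro a b
  refine ac.gr_induction (P := fun a => EvZero fun n => br n a b) ⟨0, by simp⟩
    (fun a b ha hb => by simpa only [map_add, LinearMap.add_apply] using ha.add hb)
    (fun i d w a _ hi ha => ?_) a
  refine ac.gr_induction (P := fun b => EvZero fun n => br n a b) ⟨0, by simp⟩
    (fun a b ha hb => by simpa only [map_add] using ha.add hb)
    (fun j e z b _ hj hb => ?_) b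
  obtain ⟨K, hK⟩ := commL_loc ac.conformal.loc (sgn i j) w z
  exact ⟨K, fun n hn =>
    (h.br_isSymb ac n hi hj ha hb).unique ((IsSymb.zero _).congr (hK n hn).symm)⟩

theorem IsInduced.mul_sesq : Sesq mul where
  left n a b := by
    refine ac.gr_induction (P := fun a => mul n ((X : k[X]) • a) b = -((n : k) • mul (n - 1) a b))
      (by simp) (fun a b ha hb => by
        simp only [smul_add, map_add, LinearMap.add_apply, ha, hb, neg_add])
      (fun i d w a _ hi ha => ?_) a
    refine ac.gr_induction (P := fun b => mul n ((X : k[X]) • a) b = -((n : k) • mul (n - 1) a b))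
      (by simp) (fun a b ha hb => by simp only [smul_add, map_add, ha, hb, neg_add])
      (fun j e z b _ hj hb => ?_) b
    exact (h.mul_isSymb n (ha.smul X) hb).unique
      ((((h.mul_isSymb (n - 1) ha hb).k_smul n).neg).congr (ac.conformal.sesq.left n w z).symm)
  right n a b := by
    refine ac.gr_induction (P := fun a => mul n a ((X : k[X]) • b) =
      (X : k[X]) • mul n a b + (n : k) • mul (n - 1) a b)
      (by simp) (fun a b ha hb => by
        simp only [smul_add, map_add, LinearMap.add_apply, ha, hb]; abel)
      (fun i d w a _ hi ha => ?_) a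
    refine ac.gr_induction (P := fun b => mul n a ((X : k[X]) • b) =
      (X : k[X]) • mul n a b + (n : k) • mul (n - 1) a b)
      (by simp) (fun a b ha hb => by simp only [smul_add, map_add, ha, hb]; abel)
      (fun j e z b _ hj hb => ?_) b
    exact (h.mul_isSymb n ha (hb.smul X)).unique
      ((((h.mul_isSymb n ha hb).smul X).add ((h.mul_isSymb (n - 1) ha hb).k_smul n)).congr
        (ac.conformal.sesq.right n w z).symm)

theorem IsInduced.br_sesq : Sesq br where
  left n a b := by
    refine ac.gr_induction (P := fun a => br n ((X : k[X]) • a) b = -((n : k) • br (n - 1) a b))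
      (by simp) (fun a b ha hb => by
        simp only [smul_add, map_add, LinearMap.add_apply, ha, hb, neg_add])
      (fun i d w a _ hi ha => ?_) a
    refine ac.gr_induction (P := fun b => br n ((X : k[X]) • a) b = -((n : k) • br (n - 1) a b))
      (by simp) (fun a b ha hb => by simp only [smul_add, map_add, ha, hb, neg_add])
      (fun j e z b _ hj hb => ?_) b
    exact (h.br_isSymb ac n (Submodule.smul_mem _ _ hi) hj (ha.smul X) hb).unique
      ((((h.br_isSymb ac (n - 1) hi hj ha hb).k_smul n).neg).congr
        ((commL_sesq ac.conformal.loc ac.conformal.sesq _).left n w z).symm)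
  right n a b := by
    refine ac.gr_induction (P := fun a => br n a ((X : k[X]) • b) =
      (X : k[X]) • br n a b + (n : k) • br (n - 1) a b)
      (by simp) (fun a b ha hb => by
        simp only [smul_add, map_add, LinearMap.add_apply, ha, hb]; abel)
      (fun i d w a _ hi ha => ?_) a
    refine ac.gr_induction (P := fun b => br n a ((X : k[X]) • b) =
      (X : k[X]) • br n a b + (n : k) • br (n - 1) a b)
      (by simp) (fun a b ha hb => by simp only [smul_add, map_add, ha, hb]; abel)
      (fun j e z b _ hj hb => ?_) b
    exact (h.br_isSymb ac n hi (Submodule.smul_mem _ _ hj) ha (hb.smul X)).unique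
      ((((h.br_isSymb ac n hi hj ha hb).smul X).add
        ((h.br_isSymb ac (n - 1) hi hj ha hb).k_smul n)).congr
        ((commL_sesq ac.conformal.loc ac.conformal.sesq _).right n w z).symm)

omit h in
theorem AlmostCommutative.gr_isCompl : IsCompl (grParity U x N 0) (grParity U x N 1) := by
  constructor
  · let f : ∀ d, filt U x N d →ₗ[k[X]] Gr U x N := fun d =>
      symbL x N d ∘ₗ (oddProj ac.conformal).restrict fun w hw => ac.oddProj_filt hw
    have hf : ∀ d (w : filt U x N d), (w : U) ∈ filt U x N (d - 1) → f d w = 0 :=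
      fun d w hw => symbL_eq_zero.2 (ac.oddProj_filt hw)
    have h0 : ∀ z ∈ grParity U x N 0, grLift f hf z = 0 := fun z hz =>
      grParity_induction (P := fun z => grLift f hf z = 0) (map_zero _)
        (fun a b ha hb => by rw [map_add, ha, hb, add_zero]) (fun d w a _ hi ha => by
          rw [ha.grLift]
          refine symbL_eq_zero.2 ?_
          change oddProj ac.conformal w ∈ _
          rw [oddProj_even _ hi]
          exact Submodule.zero_mem _) hz
    have h1 : ∀ z ∈ grParity U x N 1, grLift f hf z = z := fun z hz =>
      grParity_induction (P := fun z => grLift f hf z = z) (map_zero _)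
        (fun a b ha hb => by rw [map_add, ha, hb]) (fun d w a _ hi ha => by
          rw [ha.grLift]
          refine IsSymb.unique (d := d) (w := w) ?_ ha
          exact (isSymb_symb (ac.oddProj_filt ha.mem)).congr (oddProj_odd _ hi)) hz
    exact Submodule.disjoint_def.2 fun z hz hz' => by rw [← h1 z hz', h0 z hz]
  · rw [codisjoint_iff, eq_top_iff]
    rintro z -
    refine ac.gr_induction (Submodule.zero_mem _) (fun a b => Submodule.add_mem _)
      (fun i d w a _ hi ha => ?_) z
    rcases zmod_two_cases i with rfl | rfl
    · exact Submodule.mem_sup_left (ha.mem_grParity hi)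
    · exact Submodule.mem_sup_right (ha.mem_grParity hi)

theorem IsInduced.mul_isConformal : IsConformal (grParity U x N) mul where
  isCompl := ac.gr_isCompl
  mem_parity i j n a b ha hb := by
    refine grParity_induction (P := fun a => mul n a b ∈ grParity U x N (i + j)) (by simp)
      (fun a b ha hb => by
        simpa only [map_add, LinearMap.add_apply] using Submodule.add_mem _ ha hb)
      (fun d w a _ hi ha => ?_) ha
    refine grParity_induction (P := fun b => mul n a b ∈ grParity U x N (i + j)) (by simp)
      (fun a b ha hb => by simpa only [map_add] using Submodule.add_mem _ ha hb)
      (fun e z b _ hj hb => ?_) hb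
    exact (h.mul_isSymb n ha hb).mem_grParity (ac.conformal.mem_parity _ _ _ _ _ hi hj)
  locality := h.mul_loc ac
  partial_left := (h.mul_sesq ac).left
  partial_right := (h.mul_sesq ac).right

theorem IsInduced.br_isConformal : IsConformal (grParity U x N) br where
  isCompl := ac.gr_isCompl
  mem_parity i j n a b ha hb := by
    refine grParity_induction (P := fun a => br n a b ∈ grParity U x N (i + j)) (by simp)
      (fun a b ha hb => by
        simpa only [map_add, LinearMap.add_apply] using Submodule.add_mem _ ha hb)
      (fun d w a _ hi ha => ?_) ha
    refine grParity_induction (P := fun b => br n a b ∈ grParity U x N (i + j)) (by simp)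
      (fun a b ha hb => by simpa only [map_add] using Submodule.add_mem _ ha hb)
      (fun e z b _ hj hb => ?_) hb
    exact (h.br_isSymb ac n hi hj ha hb).mem_grParity (ac.comm_mem_parity _ _ hi hj)
  locality := h.br_loc ac
  partial_left := (h.br_sesq ac).left
  partial_right := (h.br_sesq ac).right

theorem IsInduced.mul_assoc : IsAssociative mul := by
  intro n m a b c
  refine ac.gr_induction (P := fun a => mul n a (mul m b c) = ∑ s ∈ Finset.range (n + 1),
      (n.choose s : k) • mul (n + m - s) (mul s a b) c) (by simp) (fun a b ha hb => by
    simp only [map_add, LinearMap.add_apply, smul_add, Finset.sum_add_distrib, ha, hb])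
    (fun i d w a _ hi ha => ?_) a
  refine ac.gr_induction (P := fun b => mul n a (mul m b c) = ∑ s ∈ Finset.range (n + 1),
      (n.choose s : k) • mul (n + m - s) (mul s a b) c) (by simp) (fun a b ha hb => by
    simp only [map_add, LinearMap.add_apply, smul_add, Finset.sum_add_distrib, ha, hb])
    (fun j e z b _ hj hb => ?_) b
  refine ac.gr_induction (P := fun c => mul n a (mul m b c) = ∑ s ∈ Finset.range (n + 1),
      (n.choose s : k) • mul (n + m - s) (mul s a b) c) (by simp) (fun a b ha hb => by
    simp only [map_add, smul_add, Finset.sum_add_distrib, ha, hb])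
    (fun l f y c _ hl hc => ?_) c
  refine ((h.mul_isSymb n ha (h.mul_isSymb m hb hc)).cast (Nat.add_assoc d e f).symm).unique
    (IsSymb.congr (IsSymb.sum _ fun s _ => IsSymb.k_smul
      (h.mul_isSymb (n + m - s) (h.mul_isSymb s ha hb) hc) _) (ac.assoc n m w z y).symm)

theorem IsInduced.mul_comm {i j : ZMod 2} (n : ℕ) {a b : Gr U x N} (ha : a ∈ grParity U x N i)
    (hb : b ∈ grParity U x N j) : mul n a b = sgn i j • curly mul n b a := by
  have hL := h.mul_loc ac
  change mul n a b = sgn i j • curlyL mul hL n b a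
  refine grParity_induction (P := fun a => mul n a b = sgn i j • curlyL mul hL n b a) (by simp)
    (fun a b ha hb => by simp only [map_add, LinearMap.add_apply, smul_add, ha, hb])
    (fun d w a hd hi ha => ?_) ha
  refine grParity_induction (P := fun b => mul n a b = sgn i j • curlyL mul hL n b a) (by simp)
    (fun a b ha hb => by simp only [map_add, LinearMap.add_apply, smul_add, ha, hb])
    (fun e z b he hj hb => ?_) hb
  rw [← sub_eq_zero]
  refine IsSymb.eq_zero_iff (d := d + e) (w := commL U.prod ac.conformal.loc (sgn i j) n w z)
    ((h.mul_isSymb n ha hb).sub (IsSymb.zsmul (IsSymb.curly ac.conformal.loc hL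
      (fun n => (h.mul_isSymb n hb ha).cast (Nat.add_comm e d)) n) _)) |>.2 ?_
  exact ac.comm_mem_filt n hi hj ha.mem hb.mem

theorem IsInduced.br_skew {i j : ZMod 2} (n : ℕ) {a b : Gr U x N} (ha : a ∈ grParity U x N i)
    (hb : b ∈ grParity U x N j) : br n a b = -(sgn i j • curly br n b a) := by
  have hL := h.br_loc ac
  change br n a b = -(sgn i j • curlyL br hL n b a)
  refine grParity_induction (P := fun a => br n a b = -(sgn i j • curlyL br hL n b a)) (by simp)
    (fun a b ha hb => by simp only [map_add, LinearMap.add_apply, smul_add, ha, hb, neg_add])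
    (fun d w a hd hi ha => ?_) ha
  refine grParity_induction (P := fun b => br n a b = -(sgn i j • curlyL br hL n b a)) (by simp)
    (fun a b ha hb => by simp only [map_add, LinearMap.add_apply, smul_add, ha, hb, neg_add])
    (fun e z b he hj hb => ?_) hb
  refine (h.br_isSymb ac n hi hj ha hb).unique (IsSymb.congr (IsSymb.neg (IsSymb.zsmul
    (IsSymb.curly (commL_loc ac.conformal.loc (sgn i j)) hL (fun n => ?_) n) _))
    (ac.skew (sgn_mul_self i j) n w z).symm)
  rw [sgn_comm i j]
  exact (h.br_isSymb ac n hj hi hb ha).cast (by omega)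

theorem IsInduced.jacobi {i j : ZMod 2} (n m : ℕ) {a b : Gr U x N} (c : Gr U x N)
    (ha : a ∈ grParity U x N i) (hb : b ∈ grParity U x N j) :
    br n a (br m b c) - sgn i j • br m b (br n a c) =
      ∑ s ∈ Finset.range (n + 1), (n.choose s : k) • br (n + m - s) (br s a b) c := by
  refine grParity_induction (P := fun a => br n a (br m b c) - sgn i j • br m b (br n a c) =
      ∑ s ∈ Finset.range (n + 1), (n.choose s : k) • br (n + m - s) (br s a b) c) (by simp)
    (fun a b ha hb => by
      simp only [map_add, LinearMap.add_apply, smul_add, Finset.sum_add_distrib, ← ha, ← hb]; abel)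
    (fun d w a hd hi ha => ?_) ha
  refine grParity_induction (P := fun b => br n a (br m b c) - sgn i j • br m b (br n a c) =
      ∑ s ∈ Finset.range (n + 1), (n.choose s : k) • br (n + m - s) (br s a b) c) (by simp)
    (fun a b ha hb => by
      simp only [map_add, LinearMap.add_apply, smul_add, Finset.sum_add_distrib, ← ha, ← hb]; abel)
    (fun e z b he hj hb => ?_) hb
  refine ac.gr_induction (P := fun c => br n a (br m b c) - sgn i j • br m b (br n a c) =
      ∑ s ∈ Finset.range (n + 1), (n.choose s : k) • br (n + m - s) (br s a b) c) (by simp)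
    (fun a b ha hb => by
      simp only [map_add, smul_add, Finset.sum_add_distrib, ← ha, ← hb]; abel)
    (fun l f y c hf hl hc => ?_) c
  have h1 := h.br_isSymb ac n hi (ac.comm_mem_parity _ m hj hl) ha
    (h.br_isSymb ac m hj hl hb hc)
  have h2 := h.br_isSymb ac m hj (ac.comm_mem_parity _ n hi hl) hb
    (h.br_isSymb ac n hi hl ha hc)
  have h3 := fun s => h.br_isSymb ac (n + m - s) (ac.comm_mem_parity _ s hi hj) hl
    (h.br_isSymb ac s hi hj ha hb) hc
  rw [sgn_add_right] at h1 h2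
  simp only [sgn_add_left] at h3
  rw [sgn_comm j i] at h2
  exact ((h1.cast (show _ = d + e + f - 2 by omega)).sub
    ((h2.cast (show _ = d + e + f - 2 by omega)).zsmul _)).unique
    (IsSymb.congr (IsSymb.sum _ fun s _ =>
      ((h3 s).cast (show _ = d + e + f - 2 by omega)).k_smul _)
      (ac.jacobi (sgn_mul_self i j) n m w z y).symm)

theorem IsInduced.leibniz {i j : ZMod 2} (n m : ℕ) {a b : Gr U x N} (c : Gr U x N)
    (ha : a ∈ grParity U x N i) (hb : b ∈ grParity U x N j) :
    br n a (mul m b c) = ∑ s ∈ Finset.range (n + 1),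
      (n.choose s : k) • mul (n + m - s) (br s a b) c + sgn i j • mul m b (br n a c) := by
  refine grParity_induction (P := fun a => br n a (mul m b c) = ∑ s ∈ Finset.range (n + 1),
      (n.choose s : k) • mul (n + m - s) (br s a b) c + sgn i j • mul m b (br n a c)) (by simp)
    (fun a b ha hb => by
      simp only [map_add, LinearMap.add_apply, smul_add, Finset.sum_add_distrib, ha, hb]; abel)
    (fun d w a hd hi ha => ?_) ha
  refine grParity_induction (P := fun b => br n a (mul m b c) = ∑ s ∈ Finset.range (n + 1),
      (n.choose s : k) • mul (n + m - s) (br s a b) c + sgn i j • mul m b (br n a c)) (by simp)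
    (fun a b ha hb => by
      simp only [map_add, LinearMap.add_apply, smul_add, Finset.sum_add_distrib, ha, hb]; abel)
    (fun e z b he hj hb => ?_) hb
  refine ac.gr_induction (P := fun c => br n a (mul m b c) = ∑ s ∈ Finset.range (n + 1),
      (n.choose s : k) • mul (n + m - s) (br s a b) c + sgn i j • mul m b (br n a c)) (by simp)
    (fun a b ha hb => by
      simp only [map_add, smul_add, Finset.sum_add_distrib, ha, hb]; abel)
    (fun l f y c hf hl hc => ?_) c
  have h1 := h.br_isSymb ac n hi (ac.conformal.mem_parity _ _ m _ _ hj hl) ha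
    (h.mul_isSymb m hb hc)
  have h2 := h.mul_isSymb m hb (h.br_isSymb ac n hi hl ha hc)
  have h3 := fun s => h.mul_isSymb (n + m - s) (h.br_isSymb ac s hi hj ha hb) hc
  rw [sgn_add_right] at h1
  exact (h1.cast (show _ = d + e + f - 1 by omega)).unique
    (IsSymb.congr ((IsSymb.sum _ fun s _ =>
      ((h3 s).cast (show _ = d + e + f - 1 by omega)).k_smul _).add
      ((h2.cast (show _ = d + e + f - 1 by omega)).zsmul _))
      (ac.leibniz (sgn i j) (sgn i l) n m w z y).symm)

theorem IsInduced.isPoisson : IsPoisson (grParity U x N) mul br where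
  mul_conformal := h.mul_isConformal ac
  br_conformal := h.br_isConformal ac
  mul_assoc := h.mul_assoc ac
  mul_comm _ _ n _ _ ha hb := h.mul_comm ac n ha hb
  br_skew _ _ n _ _ ha hb := h.br_skew ac n ha hb
  jacobi _ _ n m _ _ c ha hb := h.jacobi ac n m c ha hb
  leibniz _ _ n m _ _ c ha hb := h.leibniz ac n m c ha hb

end Poisson

section LamTables

variable {k : Type u} [Field k] [CharZero k] {M : Type u} [AddCommGroup M] [Module k M]
  [Module k[X] M] [IsScalarTower k k[X] M] {p q : ℕ → M →ₗ[k] M →ₗ[k] M}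

theorem coeff_eq_of_lam {c : ℕ → M} (hc : EvZero c) (t u : k[X][X]) (x y : M)
    (h : ∀ l : k, lam (C l) c = t.eval (C l) • x + u.eval (C l) • y) (n : ℕ) :
    c n = ((n.factorial : k) • t.coeff n) • x + ((n.factorial : k) • u.coeff n) • y := by
  refine lam_injective (k := k) hc ((evZero_table t x).add (evZero_table u y)) (fun l => ?_) n
  rw [h, lam_add _ (evZero_table t x) (evZero_table u y), lam_table, lam_table]

theorem lam_eq_of_lam_C {c : ℕ → M} (hc : EvZero c) (t u : k[X][X]) (x y : M)
    (h : ∀ l : k, lam (C l) c = t.eval (C l) • x + u.eval (C l) • y) (s : k[X]) :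
    lam s c = t.eval s • x + u.eval s • y := by
  rw [lam_congr s (coeff_eq_of_lam hc t u x y h), lam_add _ (evZero_table t x) (evZero_table u y),
    lam_table, lam_table]

theorem coeff_smul_cst (t : k[X][X]) (x : M) (n : ℕ) : (t • cst k x).coeff n = t.coeff n • x := by
  rw [cst, PolynomialModule.smul_single_apply, if_pos (Nat.zero_le _), Nat.sub_zero]

theorem lambdaEq_two (hp : Loc p) {x y x' y' : M} {t u : k[X][X]}
    (h : ∀ l : k, lam (C l) (fun n => p n x y) = t.eval (C l) • x' + u.eval (C l) • y') :
    LambdaEq p x y (t • cst k x' + u • cst k y') := by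
  intro n
  rw [coeff_eq_of_lam (hp x y) t u x' y' h, PolynomialModule.coeff_add, Finsupp.add_apply,
    coeff_smul_cst, coeff_smul_cst, smul_add, smul_assoc, smul_assoc]

theorem lambdaEq_one (hp : Loc p) {x y x' : M} {t : k[X][X]}
    (h : ∀ l : k, lam (C l) (fun n => p n x y) = t.eval (C l) • x') :
    LambdaEq p x y (t • cst k x') := by
  have := lambdaEq_two hp (x := x) (y := y) (x' := x') (y' := (0 : M)) (t := t) (u := 0)
    fun l => by simp [h]
  rwa [zero_smul, add_zero] at this

theorem lambdaEq_zero (hp : Loc p) {x y : M}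
    (h : ∀ l : k, lam (C l) (fun n => p n x y) = 0) : LambdaEq p x y (0 : PolynomialModule k[X] M) := by
  have := lambdaEq_one hp (x := x) (y := y) (x' := (0 : M)) (t := 0) fun l => by simp [h]
  rwa [zero_smul] at this

theorem lam_conv_left (hp : Loc p) (hq : Loc q) (l : k) (x y z : M) :
    lam (C l) (fun n => ∑ s ∈ Finset.range (n + 1), (n.choose s : k) • p (n - s) (q s x y) z) =
      lam (C l) (fun r => p r (lam (C l) (fun s => q s x y)) z) := by
  rw [lam_conv (C l) (c := fun r s => p r (q s x y) z) (evZero₂_left hp hq x y z),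
    lam_comm _ _ (evZero₂_left hp hq x y z).swap]
  exact lam_congr _ fun r => (map_lam_C l (hq x y) ((p r).flip z)).symm

theorem lam_add_fst (hp : Loc p) (s : k[X]) (x x' y : M) :
    lam s (fun n => p n (x + x') y) = lam s (fun n => p n x y) + lam s (fun n => p n x' y) := by
  simp only [map_add, LinearMap.add_apply]
  exact lam_add s (hp x y) (hp x' y)

theorem zero_mul_smul (hp : Sesq p) (x y : M) (f : k[X]) : p 0 x (f • y) = f • p 0 x y :=
  map_smul (zeroMulL hp x) f y

theorem lam_zero_mul (hp : Loc p) (ha : IsAssociative p) (l : k) (x y z : M) :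
    lam (C l) (fun n => p n (p 0 x y) z) = p 0 x (lam (C l) (fun n => p n y z)) := by
  rw [map_lam_C l (hp y z) (p 0 x)]
  exact lam_congr _ fun n => (ha.zero n x y z).symm

theorem lam_mul_zero (hp : Loc p) (ha : IsAssociative p) (l : k) (x y z : M) :
    lam (C l) (fun n => p n x (p 0 y z)) =
      lam (C l) (fun n => p n (lam (C l) (fun n => p n x y)) z) := by
  rw [← lam_conv_left hp hp]
  exact lam_congr _ fun n => ha n 0 x y z

end LamTables

section PoissonTables

variable {k : Type u} [Field k] [CharZero k] {M : Type u} [AddCommGroup M] [Module k M]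
  [Module k[X] M] [IsScalarTower k k[X] M] {par : ZMod 2 → Submodule k[X] M}
  {mul br : ℕ → M →ₗ[k] M →ₗ[k] M}

namespace IsPoisson

variable (hP : IsPoisson par mul br)
include hP

theorem lam_mul_comm {x y : M} (hx : x ∈ par 0) (hy : y ∈ par 0) (s : k[X]) :
    lam s (fun n => mul n x y) = lam (-X - s) (fun n => mul n y x) := by
  rw [← lam_curly hP.mul_conformal.loc]
  refine lam_congr _ fun n => ?_
  rw [hP.mul_comm 0 0 n x y hx hy, sgn_zero_left, one_smul]

theorem lam_br_skew {x y : M} (hx : x ∈ par 0) (hy : y ∈ par 0) (s : k[X]) :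
    lam s (fun n => br n x y) = -lam (-X - s) (fun n => br n y x) := by
  rw [← lam_curly hP.br_conformal.loc, ← lam_neg _ (hP.br_conformal.loc.curly y x)]
  refine lam_congr _ fun n => ?_
  rw [hP.br_skew 0 0 n x y hx hy, sgn_zero_left, one_smul]

theorem lam_br_mul_zero {x y : M} (hx : x ∈ par 0) (hy : y ∈ par 0) (l : k) (z : M) :
    lam (C l) (fun n => br n x (mul 0 y z)) =
      lam (C l) (fun n => mul n (lam (C l) (fun n => br n x y)) z) +
        mul 0 y (lam (C l) (fun n => br n x z)) := by
  have h2 : EvZero (fun n => mul 0 y (br n x z)) :=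
    (hP.br_conformal.loc x z).map fun _ => (mul 0 y).toAddMonoidHom
  rw [← lam_conv_left hP.mul_conformal.loc hP.br_conformal.loc,
    map_lam_C l (hP.br_conformal.loc x z) (mul 0 y), ← lam_add _ _ h2]
  · refine lam_congr _ fun n => ?_
    rw [hP.leibniz 0 0 n 0 x y z hx hy, sgn_zero_left, one_smul]
    rfl
  · have h1 := evZero₂_conv (k := k) (evZero₂_left hP.mul_conformal.loc hP.br_conformal.loc x y z)
    exact h1.swap.right 0

end IsPoisson

/-- The polynomial `(λ² + ∂λ) / 4` at `λ = s`. -/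
def quarterPoly (s : k[X]) : k[X] := C (1 / 4) * (s ^ 2 + X * s)

theorem quarterPoly_comp (l : k) : (quarterPoly (C l)).comp (-C l) = 0 := by
  simp only [quarterPoly, mul_comp, add_comp, pow_comp, C_comp, X_comp]
  ring

/-- Sequences `a_n` (`n ≥ 1`) and `b_n` (`n ≥ 2`) in a Poisson conformal algebra, determined by
recursion, with the products of `a_1` and `b_2` as in the even part of `PK_1`. -/
structure IsTable (par : ZMod 2 → Submodule k[X] M) (mul br : ℕ → M →ₗ[k] M →ₗ[k] M)
    (a b : ℕ → M) : Prop where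
  poisson : IsPoisson par mul br
  a_one_mem : a 1 ∈ par 0
  b_two_mem : b 2 ∈ par 0
  a_succ : ∀ n, 1 ≤ n → a (n + 1) = mul 0 (a 1) (a n)
  b_succ : ∀ n, 2 ≤ n → b (n + 1) = mul 0 (a 1) (b n)
  mul_aa_one : ∀ l : k, lam (C l) (fun n => mul n (a 1) (a 1)) = a 2 + quarterPoly (C l) • b 2
  mul_ab_one : ∀ l : k, lam (C l) (fun n => mul n (a 1) (b 2)) = b 3
  mul_bb_one : ∀ l : k, lam (C l) (fun n => mul n (b 2) (b 2)) = 0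
  br_aa_one : ∀ l : k, lam (C l) (fun n => br n (a 1) (a 1)) = (X + 2 * C l) • a 1
  br_ab_one : ∀ l : k, lam (C l) (fun n => br n (a 1) (b 2)) = (X + C l) • b 2
  br_bb_one : ∀ l : k, lam (C l) (fun n => br n (b 2) (b 2)) = 0

namespace IsTable

variable {a b : ℕ → M} (h : IsTable par mul br a b)
include h

theorem mul_loc : Loc mul := h.poisson.mul_conformal.loc

theorem br_loc : Loc br := h.poisson.br_conformal.loc

theorem a_mem (i : ℕ) : a (i + 1) ∈ par 0 := by
  induction i with
  | zero => exact h.a_one_mem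
  | succ i ih =>
    rw [h.a_succ _ (by omega)]
    simpa using h.poisson.mul_conformal.mem_parity 0 0 0 _ _ h.a_one_mem ih

theorem b_mem (i : ℕ) : b (i + 2) ∈ par 0 := by
  induction i with
  | zero => exact h.b_two_mem
  | succ i ih =>
    rw [show i + 1 + 2 = i + 2 + 1 by omega, h.b_succ _ (by omega)]
    simpa using h.poisson.mul_conformal.mem_parity 0 0 0 _ _ h.a_one_mem ih

theorem a_step (i : ℕ) : mul 0 (a 1) (a (i + 1)) = a (i + 2) := (h.a_succ _ (by omega)).symm

theorem b_step (i : ℕ) : mul 0 (a 1) (b (i + 2)) = b (i + 3) := (h.b_succ _ (by omega)).symm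

theorem step_smul (f : k[X]) (x : M) : mul 0 (a 1) (f • x) = f • mul 0 (a 1) x :=
  zero_mul_smul h.poisson.mul_conformal.sesq _ _ _

theorem lam_step (l : k) (y z : M) : lam (C l) (fun n => mul n (mul 0 (a 1) y) z) =
    mul 0 (a 1) (lam (C l) (fun n => mul n y z)) :=
  lam_zero_mul h.mul_loc h.poisson.mul_assoc l _ y z

theorem lam_smul (l : k) (f : k[X]) (x y : M) : lam (C l) (fun n => mul n (f • x) y) =
    f.comp (-C l) • lam (C l) (fun n => mul n x y) :=
  lam_smul_left h.mul_loc h.poisson.mul_conformal.sesq _ _ _ _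

theorem lam_a_step (l : k) (z : M) : lam (C l) (fun n => mul n (a 1) (mul 0 (a 1) z)) =
    mul 0 (a 1) (lam (C l) (fun n => mul n (a 1) z)) := by
  rw [lam_mul_zero h.mul_loc h.poisson.mul_assoc, h.mul_aa_one, lam_add_fst h.mul_loc, h.lam_smul,
    quarterPoly_comp, zero_smul, add_zero, ← h.a_step 0, h.lam_step]

theorem mul_aa (l : k) (i j : ℕ) : lam (C l) (fun n => mul n (a (i + 1)) (a (j + 1))) =
    a (i + j + 2) + quarterPoly (C l) • b (i + j + 2) := by
  induction i with
  | zero =>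
    induction j with
    | zero => exact h.mul_aa_one l
    | succ j ih =>
      rw [← h.a_step j, h.lam_a_step, ih, map_add, h.step_smul, h.b_step,
        show 0 + j + 2 = 0 + j + 1 + 1 by omega, h.a_step]
      rfl
  | succ i ih =>
    rw [← h.a_step i, h.lam_step, ih, map_add, h.step_smul, h.b_step,
      show i + j + 2 = i + j + 1 + 1 by omega, h.a_step,
      show i + 1 + j + 2 = i + j + 3 by omega]

theorem mul_ab (l : k) (i j : ℕ) : lam (C l) (fun n => mul n (a (i + 1)) (b (j + 2))) =
    b (i + j + 3) := by
  induction i with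
  | zero =>
    induction j with
    | zero => exact h.mul_ab_one l
    | succ j ih =>
      rw [show j + 1 + 2 = j + 3 by omega, ← h.b_step j, h.lam_a_step, ih,
        show 0 + j + 3 = 0 + j + 1 + 2 by omega, h.b_step]
      rfl
  | succ i ih =>
    rw [← h.a_step i, h.lam_step, ih, show i + j + 3 = i + j + 1 + 2 by omega, h.b_step,
      show i + 1 + j + 3 = i + j + 1 + 3 by omega]

theorem mul_ab' (s : k[X]) (i j : ℕ) : lam s (fun n => mul n (a (i + 1)) (b (j + 2))) =
    b (i + j + 3) := by
  have := lam_eq_of_lam_C (h.mul_loc _ _) 1 0 (b (i + j + 3)) 0 (fun l => by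
    rw [h.mul_ab l i j]
    simp) s
  simpa using this

theorem mul_ba (s : k[X]) (i j : ℕ) : lam s (fun n => mul n (b (j + 2)) (a (i + 1))) =
    b (i + j + 3) := by
  rw [h.poisson.lam_mul_comm (h.b_mem _) (h.a_mem _), h.mul_ab']

theorem mul_bb (l : k) (i j : ℕ) : lam (C l) (fun n => mul n (b (i + 2)) (b (j + 2))) = 0 := by
  induction i with
  | zero =>
    induction j with
    | zero => exact h.mul_bb_one l
    | succ j ih =>
      rw [show j + 1 + 2 = j + 3 by omega, ← h.b_step j,
        lam_mul_zero h.mul_loc h.poisson.mul_assoc, h.mul_ba (C l) 0 0,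
        show 0 + 0 + 3 = 0 + 3 from rfl, ← h.b_step 0, h.lam_step, ih, map_zero]
  | succ i ih =>
    rw [show i + 1 + 2 = i + 3 by omega, ← h.b_step i, h.lam_step, ih, map_zero]

theorem lam_br_step {x : M} (hx : x ∈ par 0) (l : k) (z : M) :
    lam (C l) (fun n => br n x (mul 0 (a 1) z)) =
      lam (C l) (fun n => mul n (lam (C l) (fun n => br n x (a 1))) z) +
        mul 0 (a 1) (lam (C l) (fun n => br n x z)) :=
  h.poisson.lam_br_mul_zero hx h.a_one_mem l z

theorem step_b (f : k[X]) {i : ℕ} (hi : i = 0 → f = 0) :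
    mul 0 (a 1) (f • b (i + 1)) = f • b (i + 2) := by
  rcases Nat.eq_zero_or_pos i with rfl | hi'
  · simp [hi rfl]
  · obtain ⟨i, rfl⟩ : ∃ j, i = j + 1 := ⟨i - 1, by omega⟩
    rw [h.step_smul, h.b_step]

theorem br_aa_left (l : k) (j : ℕ) : lam (C l) (fun n => br n (a 1) (a (j + 1))) =
    (X + ((j : k[X]) + 2) * C l) • a (j + 1) +
      (quarterPoly (C l) * ((j : k[X]) * C l)) • b (j + 1) := by
  induction j with
  | zero =>
    simp only [Nat.cast_zero, zero_add, zero_mul, mul_zero, zero_smul, add_zero]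
    exact h.br_aa_one l
  | succ j ih =>
    rw [← h.a_step j, h.lam_br_step h.a_one_mem, h.br_aa_one, h.lam_smul, h.mul_aa l 0 j, ih,
      map_add, h.step_smul, h.a_step, h.step_b _ fun hj => by simp [hj]]
    simp only [add_comp, mul_comp, X_comp, C_comp, ofNat_comp, zero_add]
    push_cast
    module

theorem br_aa_left' (s : k[X]) (j : ℕ) : lam s (fun n => br n (a 1) (a (j + 1))) =
    (X + ((j : k[X]) + 2) * s) • a (j + 1) + (quarterPoly s * ((j : k[X]) * s)) • b (j + 1) := by
  have := lam_eq_of_lam_C (h.br_loc _ _) (C X + ((j : k[X][X]) + 2) * X)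
    (C (C (1 / 4)) * (X ^ 2 + C X * X) * ((j : k[X][X]) * X)) (a (j + 1)) (b (j + 1)) (fun l => by
    rw [h.br_aa_left l j, quarterPoly]
    simp) s
  rw [this, quarterPoly]
  simp

theorem br_aa_right (l : k) (i : ℕ) : lam (C l) (fun n => br n (a (i + 1)) (a 1)) =
    (((i : k[X]) + 1) * X + ((i : k[X]) + 2) * C l) • a (i + 1) +
      (quarterPoly (C l) * ((i : k[X]) * (X + C l))) • b (i + 1) := by
  rw [h.poisson.lam_br_skew (h.a_mem _) h.a_one_mem, h.br_aa_left', quarterPoly, quarterPoly]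
  module

theorem br_aa (l : k) (i j : ℕ) : lam (C l) (fun n => br n (a (i + 1)) (a (j + 1))) =
    (((i : k[X]) + 1) * X + ((i : k[X]) + (j : k[X]) + 2) * C l) • a (i + j + 1) +
      (quarterPoly (C l) * (((i : k[X]) + (j : k[X])) * C l + (i : k[X]) * X)) • b (i + j + 1) := by
  induction j with
  | zero =>
    simp only [Nat.cast_zero, zero_add, add_zero]
    rw [h.br_aa_right]
    module
  | succ j ih =>
    have h0 : (quarterPoly (C l) * ((i : k[X]) * (X + C l))).comp (-C l) = 0 := by
      rw [mul_comp, quarterPoly_comp, zero_mul]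
    rw [← h.a_step j, h.lam_br_step (h.a_mem _), h.br_aa_right, lam_add_fst h.mul_loc, h.lam_smul,
      h.lam_smul, h0, zero_smul, add_zero, h.mul_aa l i j, ih,
      map_add, h.step_smul, h.a_step, h.step_b _ fun hj => by
        obtain ⟨rfl, rfl⟩ : i = 0 ∧ j = 0 := by omega
        simp]
    simp only [add_comp, mul_comp, X_comp, C_comp, ofNat_comp, natCast_comp, one_comp]
    rw [show i + (j + 1) + 1 = i + j + 2 by omega]
    push_cast
    module

theorem br_ab_left (l : k) (j : ℕ) : lam (C l) (fun n => br n (a 1) (b (j + 2))) =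
    (((j : k[X]) + 1) * C l + X) • b (j + 2) := by
  induction j with
  | zero =>
    rw [h.br_ab_one, Nat.cast_zero]
    module
  | succ j ih =>
    rw [show j + 1 + 2 = j + 3 by omega, ← h.b_step j, h.lam_br_step h.a_one_mem, h.br_aa_one,
      h.lam_smul, h.mul_ab l 0 j, ih, h.step_smul, h.b_step]
    simp only [add_comp, mul_comp, X_comp, C_comp, ofNat_comp, zero_add]
    push_cast
    module

theorem br_ab_left' (s : k[X]) (j : ℕ) : lam s (fun n => br n (a 1) (b (j + 2))) =
    (((j : k[X]) + 1) * s + X) • b (j + 2) := by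
  have := lam_eq_of_lam_C (h.br_loc _ _) (((j : k[X][X]) + 1) * X + C X) 0
    (b (j + 2)) 0 (fun l => by
    rw [h.br_ab_left l j]
    simp) s
  simpa using this

theorem br_ba_right (l : k) (j : ℕ) : lam (C l) (fun n => br n (b (j + 2)) (a 1)) =
    (((j : k[X]) + 1) * C l + (j : k[X]) * X) • b (j + 2) := by
  rw [h.poisson.lam_br_skew (h.b_mem _) h.a_one_mem, h.br_ab_left']
  module

theorem br_ba_left (l : k) (i : ℕ) : lam (C l) (fun n => br n (b 2) (a (i + 1))) =
    (((i : k[X]) + 1) * C l) • b (i + 2) := by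
  induction i with
  | zero =>
    rw [h.br_ba_right l 0, Nat.cast_zero]
    module
  | succ i ih =>
    rw [← h.a_step i, h.lam_br_step h.b_two_mem, h.br_ba_right l 0, h.lam_smul, h.mul_ba _ i 0, ih,
      h.step_smul, h.b_step]
    simp only [add_comp, mul_comp, X_comp, C_comp, one_comp, Nat.cast_zero, zero_comp]
    push_cast
    module

theorem br_ba_left' (s : k[X]) (i : ℕ) : lam s (fun n => br n (b 2) (a (i + 1))) =
    (((i : k[X]) + 1) * s) • b (i + 2) := by
  have := lam_eq_of_lam_C (h.br_loc _ _) (((i : k[X][X]) + 1) * X) 0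
    (b (i + 2)) 0 (fun l => by
    rw [h.br_ba_left l i]
    simp) s
  simpa using this

theorem br_ab (l : k) (i j : ℕ) : lam (C l) (fun n => br n (a (i + 1)) (b (j + 2))) =
    (((i : k[X]) + (j : k[X]) + 1) * C l + ((i : k[X]) + 1) * X) • b (i + j + 2) := by
  induction j with
  | zero =>
    rw [h.poisson.lam_br_skew (h.a_mem _) h.b_two_mem, h.br_ba_left', Nat.cast_zero]
    module
  | succ j ih =>
    have h0 : (quarterPoly (C l) * ((i : k[X]) * (X + C l))).comp (-C l) = 0 := by
      rw [mul_comp, quarterPoly_comp, zero_mul]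
    rw [show j + 1 + 2 = j + 3 by omega, ← h.b_step j, h.lam_br_step (h.a_mem _), h.br_aa_right,
      lam_add_fst h.mul_loc, h.lam_smul, h.lam_smul, h0, zero_smul, add_zero, h.mul_ab l i j, ih,
      h.step_smul, h.b_step]
    simp only [add_comp, mul_comp, X_comp, C_comp, ofNat_comp, natCast_comp, one_comp]
    rw [show i + (j + 1) + 2 = i + j + 3 by omega]
    push_cast
    module

theorem br_bb (l : k) (i j : ℕ) : lam (C l) (fun n => br n (b (i + 2)) (b (j + 2))) = 0 := by
  have key : ∀ i, (∀ l : k, lam (C l) (fun n => br n (b (i + 2)) (b 2)) = 0) →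
      ∀ (j : ℕ) (l : k), lam (C l) (fun n => br n (b (i + 2)) (b (j + 2))) = 0 := by
    intro i hi j
    induction j with
    | zero => exact hi
    | succ j ih =>
      intro l
      rw [show j + 1 + 2 = j + 3 by omega, ← h.b_step j, h.lam_br_step (h.b_mem _), h.br_ba_right,
        h.lam_smul, h.mul_bb, ih, smul_zero, map_zero, add_zero]
  refine key i (fun l => ?_) j l
  rw [h.poisson.lam_br_skew (h.b_mem _) h.b_two_mem, neg_eq_zero]
  have := lam_eq_of_lam_C (h.br_loc (b 2) (b (i + 2))) 0 0 (0 : M) 0 (fun l => by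
    rw [key 0 h.br_bb_one i l]
    simp) (-X - C l)
  simpa using this

theorem lambdaEq_mul_aa {n m : ℕ} (hn : 1 ≤ n) (hm : 1 ≤ m) : LambdaEq mul (a n) (a m)
    (cst k (a (n + m)) +
      ((1 / 4 : k) • (ll k ^ 2 + dd k * ll k)) • cst k (b (n + m))) := by
  obtain ⟨i, rfl⟩ : ∃ i, n = i + 1 := ⟨n - 1, by omega⟩
  obtain ⟨j, rfl⟩ : ∃ j, m = j + 1 := ⟨m - 1, by omega⟩
  rw [← one_smul k[X][X] (cst k (a _)), show i + 1 + (j + 1) = i + j + 2 by omega]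
  refine lambdaEq_two h.mul_loc fun l => ?_
  rw [h.mul_aa, eval_one, one_smul, quarterPoly, eval_smul, smul_eq_C_mul]
  simp [ll, dd]

theorem lambdaEq_mul_ab {n m : ℕ} (hn : 1 ≤ n) (hm : 2 ≤ m) :
    LambdaEq mul (a n) (b m) (cst k (b (n + m))) := by
  obtain ⟨i, rfl⟩ : ∃ i, n = i + 1 := ⟨n - 1, by omega⟩
  obtain ⟨j, rfl⟩ : ∃ j, m = j + 2 := ⟨m - 2, by omega⟩
  rw [← one_smul k[X][X] (cst k (b _)), show i + 1 + (j + 2) = i + j + 3 by omega]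
  refine lambdaEq_one h.mul_loc fun l => ?_
  rw [h.mul_ab, eval_one, one_smul]

theorem lambdaEq_mul_bb {n m : ℕ} (hn : 2 ≤ n) (hm : 2 ≤ m) :
    LambdaEq mul (b n) (b m) (0 : PolynomialModule k[X] M) := by
  obtain ⟨i, rfl⟩ : ∃ i, n = i + 2 := ⟨n - 2, by omega⟩
  obtain ⟨j, rfl⟩ : ∃ j, m = j + 2 := ⟨m - 2, by omega⟩
  exact lambdaEq_zero h.mul_loc fun l => h.mul_bb l i j

theorem lambdaEq_br_aa {n m : ℕ} (hn : 1 ≤ n) (hm : 1 ≤ m) : LambdaEq br (a n) (a m)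
    (((n : k[X][X]) * dd k + ((m : k[X][X]) + n) * ll k) • cst k (a (n + m - 1)) +
      ((1 / 4 : k) • (ll k ^ 2 + dd k * ll k) *
        (((m : k[X][X]) + n - 2) * ll k + ((n : k[X][X]) - 1) * dd k)) •
        cst k (b (n + m - 1))) := by
  obtain ⟨i, rfl⟩ : ∃ i, n = i + 1 := ⟨n - 1, by omega⟩
  obtain ⟨j, rfl⟩ : ∃ j, m = j + 1 := ⟨m - 1, by omega⟩
  rw [show i + 1 + (j + 1) - 1 = i + j + 1 by omega]
  refine lambdaEq_two h.br_loc fun l => ?_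
  rw [h.br_aa, quarterPoly, eval_mul, eval_smul, smul_eq_C_mul]
  congr 2
  · simp only [ll, dd, eval_add, eval_mul, eval_natCast, eval_X, eval_C,
      eval_one, Nat.cast_add, Nat.cast_one]
    ring
  · simp only [ll, dd, eval_add, eval_mul, eval_sub, eval_natCast, eval_ofNat, eval_X, eval_C, eval_pow,
      eval_one, Nat.cast_add, Nat.cast_one]
    ring

theorem lambdaEq_br_ab {n m : ℕ} (hn : 1 ≤ n) (hm : 2 ≤ m) : LambdaEq br (a n) (b m)
    ((((n : k[X][X]) + m - 2) * ll k + (n : k[X][X]) * dd k) • cst k (b (n + m - 1))) := by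
  obtain ⟨i, rfl⟩ : ∃ i, n = i + 1 := ⟨n - 1, by omega⟩
  obtain ⟨j, rfl⟩ : ∃ j, m = j + 2 := ⟨m - 2, by omega⟩
  rw [show i + 1 + (j + 2) - 1 = i + j + 2 by omega]
  refine lambdaEq_one h.br_loc fun l => ?_
  rw [h.br_ab]
  congr 1
  simp only [ll, dd, eval_add, eval_mul, eval_sub, eval_natCast, eval_ofNat, eval_X, eval_C,
    eval_one, Nat.cast_add, Nat.cast_one, Nat.cast_ofNat]
  ring

theorem lambdaEq_br_bb {n m : ℕ} (hn : 2 ≤ n) (hm : 2 ≤ m) :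
    LambdaEq br (b n) (b m) (0 : PolynomialModule k[X] M) := by
  obtain ⟨i, rfl⟩ : ∃ i, n = i + 2 := ⟨n - 2, by omega⟩
  obtain ⟨j, rfl⟩ : ∃ j, m = j + 2 := ⟨m - 2, by omega⟩
  exact lambdaEq_zero h.br_loc fun l => h.br_bb l i j

end IsTable

end PoissonTables

section Coordinates

variable {k : Type u} [Field k] [CharZero k] {U : ConfData k} {φ : K1 k →ₗ[k[X]] U}

theorem Hom_k_smul {A B : ConfData k} (f : A.Hom B) (a : k) (x : A) :
    f.map (a • x) = a • f.map x := by
  rw [k_smul_eq, map_smul, ← k_smul_eq]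

variable (f : U.Hom (cendQData k)) (hφ : ∀ y, f.map (φ y) = phiQ k y)

include hφ in
theorem map_gen_v : f.map (φ (K1.gen k .v)) = vQ k := by
  rw [hφ, phiQ_gen]
  rfl

include hφ in
theorem map_gen_g : f.map (φ (K1.gen k .g)) = gQ k := by
  rw [hφ, phiQ_gen]
  rfl

include hφ in
theorem map_eElt : f.map (eElt U.prod (φ (K1.gen k .g))) = eElt (cendQData k).prod (gQ k) := by
  rw [eElt, Hom_k_smul, f.map_prod, map_gen_g f hφ, eElt]

include hφ in
theorem map_hElt : f.map (hElt U.prod (φ (K1.gen k .g))) = hElt (cendQData k).prod (gQ k) := by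
  rw [hElt, f.map_prod, map_gen_g f hφ, map_eElt f hφ, hElt]

/-- Coordinates with respect to the monomial basis. -/
def coord : U →ₗ[k[X]] k[X][X] × k[X][X] × k[X][X] × k[X][X] :=
  (normalEquiv k).symm.toLinearMap ∘ₗ f.map

theorem coord_eq {w : U} {t : k[X][X] × k[X][X] × k[X][X] × k[X][X]}
    (h : f.map w = normalQ k t) : coord f w = t := by
  rw [coord, LinearMap.comp_apply, h]
  exact (normalEquiv k).symm_apply_apply t

theorem normalQ_coord (w : U) : normalQ k (coord f w) = f.map w :=
  (normalEquiv k).apply_symm_apply (f.map w)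

include hφ in
theorem coord_vPow {m : U} {t : k[X][X] × k[X][X] × k[X][X] × k[X][X]} (h : coord f m = t) (i : ℕ) :
    coord f (vPow φ i m) = (X ^ i * t.1, X ^ i * t.2.1, X ^ i * t.2.2.1, X ^ i * t.2.2.2) := by
  induction i with
  | zero =>
    simp only [pow_zero, one_mul]
    exact h
  | succ i ih =>
    refine coord_eq f ?_
    rw [vPow_succ, f.map_prod, map_gen_v f hφ, ← normalQ_coord, ih]
    have h1 := normalForm_X_mul (q_sesq (k := k)) (vQ k) (gQ k)
      (X ^ i * t.1, X ^ i * t.2.1, X ^ i * t.2.2.1, X ^ i * t.2.2.2)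
    simp only [← _root_.mul_assoc, ← pow_succ'] at h1
    exact h1.symm

include hφ in
theorem coord_vPow_v (i : ℕ) : coord f (vPow φ i (φ (K1.gen k .v))) = (X ^ i, 0, 0, 0) := by
  rw [coord_vPow f hφ (coord_eq f ((map_gen_v f hφ).trans normalQ_v.symm))]
  simp

include hφ in
theorem coord_vPow_e (i : ℕ) :
    coord f (vPow φ i (eElt U.prod (φ (K1.gen k .g)))) = (0, X ^ i, 0, 0) := by
  rw [coord_vPow f hφ (coord_eq f ((map_eElt f hφ).trans normalQ_e.symm))]
  simp

include hφ in
theorem coord_vPow_g (i : ℕ) : coord f (vPow φ i (φ (K1.gen k .g))) = (0, 0, X ^ i, 0) := by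
  rw [coord_vPow f hφ (coord_eq f ((map_gen_g f hφ).trans normalQ_g.symm))]
  simp

include hφ in
theorem coord_vPow_h (i : ℕ) :
    coord f (vPow φ i (hElt U.prod (φ (K1.gen k .g)))) = (0, 0, 0, X ^ i) := by
  rw [coord_vPow f hφ (coord_eq f ((map_hElt f hφ).trans normalQ_h.symm))]
  simp

/-- The coefficient of `v (0)^j v`. -/
def coeffV (j : ℕ) : U →ₗ[k[X]] k[X] := lcoeff k[X] j ∘ₗ LinearMap.fst _ _ _ ∘ₗ coord f

/-- The coefficient of `v (0)^j e`. -/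
def coeffE (j : ℕ) : U →ₗ[k[X]] k[X] :=
  lcoeff k[X] j ∘ₗ LinearMap.fst _ _ _ ∘ₗ LinearMap.snd _ _ _ ∘ₗ coord f

theorem coeffV_apply (j : ℕ) (w : U) : coeffV f j w = (coord f w).1.coeff j := rfl

theorem coeffE_apply (j : ℕ) (w : U) : coeffE f j w = (coord f w).2.1.coeff j := rfl

variable (h : IsEnvelope (K1 k) (K1.gen k) NSGen.loc U φ)
include hφ h

theorem coeffV_eq_zero {d j : ℕ} (hj : d ≤ j) {w : U} (hw : w ∈ nsFilt φ d) :
    coeffV f j w = 0 := by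
  rw [nsFilt_eq_monSpan h] at hw
  have : monSpan φ d ≤ LinearMap.ker (coeffV f j) := by
    refine Submodule.span_le.2 ?_
    rintro w ⟨i, ⟨hi, rfl | rfl⟩ | ⟨hi, rfl | rfl⟩⟩ <;>
      refine LinearMap.mem_ker.2 ?_ <;> rw [coeffV_apply]
    · rw [coord_vPow_v f hφ]
      exact (coeff_X_pow _ _).trans (if_neg (by omega))
    · rw [coord_vPow_g f hφ, coeff_zero]
    · rw [coord_vPow_e f hφ, coeff_zero]
    · rw [coord_vPow_h f hφ, coeff_zero]
  exact this hw

theorem coeffE_eq_zero {d j : ℕ} (hj : d ≤ j + 1) {w : U} (hw : w ∈ nsFilt φ d) :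
    coeffE f j w = 0 := by
  rw [nsFilt_eq_monSpan h] at hw
  have : monSpan φ d ≤ LinearMap.ker (coeffE f j) := by
    refine Submodule.span_le.2 ?_
    rintro w ⟨i, ⟨hi, rfl | rfl⟩ | ⟨hi, rfl | rfl⟩⟩ <;>
      refine LinearMap.mem_ker.2 ?_ <;> rw [coeffE_apply]
    · rw [coord_vPow_v f hφ, coeff_zero]
    · rw [coord_vPow_g f hφ, coeff_zero]
    · rw [coord_vPow_e f hφ]
      exact (coeff_X_pow _ _).trans (if_neg (by omega))
    · rw [coord_vPow_h f hφ, coeff_zero]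
  exact this hw

/-- The coordinates of the associated graded module with respect to the classes of `v (0)^j v`. -/
def grCoordV : Gr U (fun a => φ (K1.gen k a)) NSGen.loc →ₗ[k[X]] (ℕ+ →₀ k[X]) :=
  grLift (fun d => Finsupp.lsingle d.toPNat' ∘ₗ coeffV f (d - 1) ∘ₗ (nsFilt φ d).subtype)
    fun d w hw => by
      rw [LinearMap.comp_apply, LinearMap.comp_apply]
      have := coeffV_eq_zero f hφ h le_rfl hw
      rw [Submodule.subtype_apply, this, map_zero]

/-- The coordinates of the associated graded module with respect to the classes of `v (0)^j e`. -/
def grCoordE : Gr U (fun a => φ (K1.gen k a)) NSGen.loc →ₗ[k[X]] (ℕ →₀ k[X]) :=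
  grLift (fun d => Finsupp.lsingle d ∘ₗ coeffE f (d - 2) ∘ₗ (nsFilt φ d).subtype)
    fun d w hw => by
      rw [LinearMap.comp_apply, LinearMap.comp_apply]
      have := coeffE_eq_zero f hφ h (show d - 1 ≤ d - 2 + 1 by omega) hw
      rw [Submodule.subtype_apply, this, map_zero]

theorem grCoordV_isSymb {d : ℕ} {w : U} {z : Gr U (fun a => φ (K1.gen k a)) NSGen.loc}
    (hz : IsSymb d w z) :
    grCoordV f hφ h z = Finsupp.single d.toPNat' ((coord f w).1.coeff (d - 1)) := hz.grLift

theorem grCoordE_isSymb {d : ℕ} {w : U} {z : Gr U (fun a => φ (K1.gen k a)) NSGen.loc}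
    (hz : IsSymb d w z) :
    grCoordE f hφ h z = Finsupp.single d ((coord f w).2.1.coeff (d - 2)) := hz.grLift

end Coordinates

section Classes

variable {k : Type u} [Field k] [CharZero k] {U : ConfData k} {φ : K1 k →ₗ[k[X]] U}
  (h : IsEnvelope (K1 k) (K1.gen k) NSGen.loc U φ)
  {mul br : ℕ → Gr U (fun a => φ (K1.gen k a)) NSGen.loc →ₗ[k]
    Gr U (fun a => φ (K1.gen k a)) NSGen.loc →ₗ[k] Gr U (fun a => φ (K1.gen k a)) NSGen.loc}

variable (φ) in
/-- The class of `v (0)^{n-1} v` in degree `n`. -/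
def aClass (mul : ℕ → Gr U (fun a => φ (K1.gen k a)) NSGen.loc →ₗ[k]
    Gr U (fun a => φ (K1.gen k a)) NSGen.loc →ₗ[k] Gr U (fun a => φ (K1.gen k a)) NSGen.loc)
    (n : ℕ) : Gr U (fun a => φ (K1.gen k a)) NSGen.loc :=
  (mul 0 (symb U _ _ 1 _ (nsFilt_gen .v)))^[n - 1] (symb U _ _ 1 _ (nsFilt_gen .v))

variable (φ) in
/-- The class of `v (0)^{m-2} e` in degree `m`. -/
def bClass (mul : ℕ → Gr U (fun a => φ (K1.gen k a)) NSGen.loc →ₗ[k]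
    Gr U (fun a => φ (K1.gen k a)) NSGen.loc →ₗ[k] Gr U (fun a => φ (K1.gen k a)) NSGen.loc)
    (m : ℕ) : Gr U (fun a => φ (K1.gen k a)) NSGen.loc :=
  (mul 0 (symb U _ _ 1 _ (nsFilt_gen .v)))^[m - 2] (symb U _ _ 2 _ nsFilt_e)

theorem aClass_succ (n : ℕ) (hn : 1 ≤ n) :
    aClass φ mul (n + 1) = mul 0 (aClass φ mul 1) (aClass φ mul n) := by
  obtain ⟨i, rfl⟩ : ∃ i, n = i + 1 := ⟨n - 1, by omega⟩
  exact Function.iterate_succ_apply' _ _ _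

theorem bClass_succ (n : ℕ) (hn : 2 ≤ n) :
    bClass φ mul (n + 1) = mul 0 (aClass φ mul 1) (bClass φ mul n) := by
  obtain ⟨i, rfl⟩ : ∃ i, n = i + 2 := ⟨n - 2, by omega⟩
  exact Function.iterate_succ_apply' _ _ _

theorem aClass_isSymb (hI : IsInduced U (fun a => φ (K1.gen k a)) NSGen.loc mul br) (i : ℕ) :
    IsSymb (i + 1) (vPow φ i (φ (K1.gen k .v))) (aClass φ mul (i + 1)) := by
  induction i with
  | zero => exact isSymb_symb _
  | succ i ih =>
    rw [aClass_succ _ (by omega), vPow_succ]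
    exact (hI.mul_isSymb 0 (isSymb_symb _) ih).cast (by omega)

theorem bClass_isSymb (hI : IsInduced U (fun a => φ (K1.gen k a)) NSGen.loc mul br) (i : ℕ) :
    IsSymb (i + 2) (vPow φ i (eElt U.prod (φ (K1.gen k .g)))) (bClass φ mul (i + 2)) := by
  induction i with
  | zero => exact isSymb_symb _
  | succ i ih =>
    rw [show i + 1 + 2 = i + 2 + 1 by omega, bClass_succ _ (by omega), vPow_succ]
    exact (hI.mul_isSymb 0 (isSymb_symb _) ih).cast (by omega)

theorem IsEnvelope.vPow_mem (h : IsEnvelope (K1 k) (K1.gen k) NSGen.loc U φ) {i : ZMod 2} {m : U}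
    (hm : m ∈ U.parity i) (j : ℕ) : vPow φ j m ∈ U.parity i := by
  induction j with
  | zero => exact hm
  | succ j ih =>
    rw [vPow_succ]
    exact h.V0_mem ih

theorem IsSymb.eq_of_sub_mem {ι : Type} {x : ι → U} {N : ι → ι → ℕ} {d : ℕ} {w w' : U}
    {z z' : Gr U x N} (hw : IsSymb d w z) (hw' : IsSymb d w' z')
    (hs : w - w' ∈ filt U x N (d - 1)) : z = z' := by
  rw [← sub_eq_zero]
  exact (hw.sub hw').eq_zero_iff.2 hs

theorem lam_three {M : Type u} [AddCommGroup M] [Module k M] [Module k[X] M] (s : k[X])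
    {c : ℕ → M} (hc : ∀ n, 3 ≤ n → c n = 0) :
    lam s c = c 0 + s • c 1 + (s ^ 2 * C (1 / 2)) • c 2 := by
  rw [lam_eq_sum s hc, Finset.sum_range_succ, Finset.sum_range_succ, Finset.sum_range_one]
  simp

include h in
theorem isTable (ac : AlmostCommutative U (fun a => φ (K1.gen k a)) NSGen.loc)
    (hI : IsInduced U (fun a => φ (K1.gen k a)) NSGen.loc mul br) :
    IsTable (grParity U (fun a => φ (K1.gen k a)) NSGen.loc) mul br (aClass φ mul)
      (bClass φ mul) := by
  have r := h.nsRel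
  have hL := hI.mul_loc ac
  have hL' := hI.br_loc ac
  have hl := ac.conformal.loc
  have ha1 : IsSymb 1 (φ (K1.gen k .v)) (aClass φ mul 1) := aClass_isSymb hI 0
  have ha2 : IsSymb 2 (U.prod 0 (φ (K1.gen k .v)) (φ (K1.gen k .v))) (aClass φ mul 2) :=
    aClass_isSymb hI 1
  have hb2 : IsSymb 2 (eElt U.prod (φ (K1.gen k .g))) (bClass φ mul 2) := bClass_isSymb hI 0
  have hb3 : IsSymb 3 (U.prod 0 (φ (K1.gen k .v)) (eElt U.prod (φ (K1.gen k .g))))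
    (bClass φ mul 3) := bClass_isSymb hI 1
  refine ⟨hI.isPoisson ac, ha1.mem_grParity h.v_mem, hb2.mem_grParity h.e_mem, aClass_succ,
    bClass_succ, fun l => ?_, fun l => ?_, fun l => ?_, fun l => ?_, fun l => ?_, fun l => ?_⟩
  · refine IsSymb.eq_of_sub_mem (IsSymb.lam (hl _ _) (hL _ _)
      (fun n => hI.mul_isSymb n ha1 ha1) (C l)) (ha2.add (hb2.smul _)) ?_
    rw [lam_three _ r.v_v, r.v1v, r.v2v]
    have h1 : U.prod 0 (φ (K1.gen k .v)) (φ (K1.gen k .v)) + (C l : k[X]) • (φ (K1.gen k .v) +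
        (1 / 4 : k) • (X : k[X]) • eElt U.prod (φ (K1.gen k .g))) +
        ((C l : k[X]) ^ 2 * C (1 / 2)) • (1 / 2 : k) • eElt U.prod (φ (K1.gen k .g)) -
        (U.prod 0 (φ (K1.gen k .v)) (φ (K1.gen k .v)) +
          quarterPoly (C l) • eElt U.prod (φ (K1.gen k .g))) =
        (C l : k[X]) • φ (K1.gen k .v) := by
      have h2 : (C (1 / 2 : k) : k[X]) * C (1 / 2) = C (1 / 4) := by
        rw [← C_mul]
        norm_num
      rw [quarterPoly, ← h2, k_smul_eq, k_smul_eq, ← h2]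
      module
    rw [h1]
    exact Submodule.smul_mem _ _ (nsFilt_gen _)
  · refine IsSymb.eq_of_sub_mem (IsSymb.lam (hl _ _) (hL _ _)
      (fun n => hI.mul_isSymb n ha1 hb2) (C l)) hb3 ?_
    rw [lam_three _ fun n hn => r.v_e n (by omega), r.v1e, r.v_e 2 le_rfl, smul_zero, add_zero,
      add_sub_cancel_left]
    exact Submodule.smul_mem _ _ (filt_k_smul _ nsFilt_e)
  · refine (IsSymb.eq_zero_iff (IsSymb.lam (hl _ _) (hL _ _)
      (fun n => hI.mul_isSymb n hb2 hb2) (C l))).2 ?_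
    rw [lam_three _ fun n hn => r.e_e' n (by omega), r.e_e' 1 le_rfl, r.e_e' 2 (by omega), r.e0e,
      smul_zero, smul_zero, add_zero, add_zero]
    exact filt_mono (by omega) nsFilt_e
  · have h1 : ∀ n, br n (aClass φ mul 1) (aClass φ mul 1) =
        ((n.factorial : k) • (dd k + 2 * ll k).coeff n) • aClass φ mul 1 := fun n => by
      refine (hI.br_isSymb ac n h.v_mem h.v_mem ha1 ha1).unique ((ha1.smul _).congr ?_)
      have h2 := h.map_bracket 0 0 n _ _ (K1_gen_mem (k := k) .v) (K1_gen_mem .v)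
      rw [K1_prod_gen (k := k) (a := .v) (b := .v) n rfl, map_smul] at h2
      exact h2
    rw [lam_congr _ h1, lam_table]
    simp [dd, ll]
  · refine IsSymb.unique (IsSymb.lam (commL_loc hl _ _ _) (hL' _ _)
      (fun n => hI.br_isSymb ac n h.v_mem h.e_mem ha1 hb2) (C l)) ((hb2.smul _).congr ?_)
    rw [lam_commL, sgn_zero_left, one_smul, lam_three _ fun n hn => r.v_e n (by omega),
      lam_three _ fun n hn => r.e_v n (by omega), r.v1e, r.v_e 2 le_rfl, r.e0v, r.e1v,
      r.e_v 2 le_rfl]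
    have h2 : (C (1 / 2 : k) : k[X]) + C (1 / 2) = 1 := by
      rw [← C_add, ← C_1]
      norm_num
    simp only [k_smul_eq (1 / 2 : k)]
    have h3 : (X + C l : k[X]) = (X + C l) * (C (1 / 2 : k) + C (1 / 2)) := by
      rw [h2, mul_one]
    rw [h3]
    module
  · refine IsSymb.unique (IsSymb.lam (commL_loc hl _ _ _) (hL' _ _)
      (fun n => hI.br_isSymb ac n h.e_mem h.e_mem hb2 hb2) (C l)) ((IsSymb.zero _).congr ?_)
    rw [lam_commL, sgn_zero_left, one_smul, lam_three _ fun n hn => r.e_e' n (by omega),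
      lam_three _ fun n hn => r.e_e' n (by omega), r.e_e' 1 le_rfl, r.e_e' 2 (by omega)]
    simp

end Classes

section Coeff

variable {k : Type u} [Field k] [CharZero k]

/-- The coefficients of a product given by a table. -/
theorem map_coeff_two {M M' : Type u} [AddCommGroup M] [Module k M] [Module k[X] M]
    [IsScalarTower k k[X] M] [AddCommGroup M'] [Module k M'] [Module k[X] M']
    [IsScalarTower k k[X] M'] {p : ℕ → M →ₗ[k] M →ₗ[k] M} {x y x' y' : M} {t u : k[X][X]}
    (hF : LambdaEq p x y (t • cst k x' + u • cst k y')) (g : M →ₗ[k[X]] M') (n : ℕ) :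
    g (p n x y) = ((n.factorial : k) • t.coeff n) • g x' + ((n.factorial : k) • u.coeff n) • g y' := by
  rw [hF n, PolynomialModule.coeff_add, Finsupp.add_apply, coeff_smul_cst, coeff_smul_cst, smul_add,
    map_add, ← smul_assoc, ← smul_assoc, map_smul, map_smul]

end Coeff

section EvenPart

variable {k : Type u} [Field k] [CharZero k] {U : ConfData k} {φ : K1 k →ₗ[k[X]] U}
  {mul br : ℕ → Gr U (fun a => φ (K1.gen k a)) NSGen.loc →ₗ[k]
    Gr U (fun a => φ (K1.gen k a)) NSGen.loc →ₗ[k] Gr U (fun a => φ (K1.gen k a)) NSGen.loc}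

/-- The generators of the even part. -/
def classSet (φ : K1 k →ₗ[k[X]] U) (mul : ℕ → Gr U (fun a => φ (K1.gen k a)) NSGen.loc →ₗ[k]
    Gr U (fun a => φ (K1.gen k a)) NSGen.loc →ₗ[k] Gr U (fun a => φ (K1.gen k a)) NSGen.loc) :
    Set (Gr U (fun a => φ (K1.gen k a)) NSGen.loc) :=
  aClass φ mul '' {n | 1 ≤ n} ∪ bClass φ mul '' {m | 2 ≤ m}

/-- The span of the classes of `v (0)^j e`. -/
def bSpan (φ : K1 k →ₗ[k[X]] U) (mul : ℕ → Gr U (fun a => φ (K1.gen k a)) NSGen.loc →ₗ[k]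
    Gr U (fun a => φ (K1.gen k a)) NSGen.loc →ₗ[k] Gr U (fun a => φ (K1.gen k a)) NSGen.loc) :
    Submodule k[X] (Gr U (fun a => φ (K1.gen k a)) NSGen.loc) :=
  Submodule.span k[X] (bClass φ mul '' {m | 2 ≤ m})

variable (h : IsEnvelope (K1 k) (K1.gen k) NSGen.loc U φ)
  (ac : AlmostCommutative U (fun a => φ (K1.gen k a)) NSGen.loc)
  (hI : IsInduced U (fun a => φ (K1.gen k a)) NSGen.loc mul br)

/-- The even monomials of degree at most `d`. -/
def evenMonomials (φ : K1 k →ₗ[k[X]] U) (d : ℕ) : Set U :=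
  {w | ∃ i, (i + 1 ≤ d ∧ w = vPow φ i (φ (K1.gen k .v))) ∨
    (i + 2 ≤ d ∧ w = vPow φ i (eElt U.prod (φ (K1.gen k .g))))}

include h in
theorem mem_span_evenMonomials {d : ℕ} {w : U} (hw : w ∈ nsFilt φ d) (h0 : w ∈ U.parity 0) :
    w ∈ Submodule.span k[X] (evenMonomials φ d) := by
  rw [nsFilt_eq_monSpan h] at hw
  have key : monSpan φ d ≤ (Submodule.span k[X] (evenMonomials φ d)).comap
      (LinearMap.id - oddProj h.conformal) := by
    refine Submodule.span_le.2 ?_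
    rintro w ⟨i, ⟨hi, rfl | rfl⟩ | ⟨hi, rfl | rfl⟩⟩ <;> refine Submodule.mem_comap.2 ?_ <;>
      rw [LinearMap.sub_apply, LinearMap.id_apply]
    · rw [oddProj_even _ (h.vPow_mem h.v_mem i), sub_zero]
      exact Submodule.subset_span ⟨i, Or.inl ⟨hi, rfl⟩⟩
    · rw [oddProj_odd _ (h.vPow_mem h.g_mem i), sub_self]
      exact Submodule.zero_mem _
    · rw [oddProj_even _ (h.vPow_mem h.e_mem i), sub_zero]
      exact Submodule.subset_span ⟨i, Or.inr ⟨hi, rfl⟩⟩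
    · rw [oddProj_odd _ (h.vPow_mem h.h_mem i), sub_self]
      exact Submodule.zero_mem _
  have h1 := Submodule.mem_comap.1 (key hw)
  rwa [LinearMap.sub_apply, LinearMap.id_apply, oddProj_even _ h0, sub_zero] at h1

include h hI

theorem span_classSet : Submodule.span k[X] (classSet φ mul) =
    grParity U (fun a => φ (K1.gen k a)) NSGen.loc 0 := by
  apply le_antisymm
  · refine Submodule.span_le.2 ?_
    rintro _ (⟨n, hn, rfl⟩ | ⟨m, hm, rfl⟩)
    · obtain ⟨i, rfl⟩ := Nat.exists_eq_add_of_le' hn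
      exact (aClass_isSymb hI i).mem_grParity (h.vPow_mem h.v_mem i)
    · obtain ⟨i, rfl⟩ := Nat.exists_eq_add_of_le' hm
      exact (bClass_isSymb hI i).mem_grParity (h.vPow_mem h.e_mem i)
  · refine Submodule.span_le.2 ?_
    rintro _ ⟨d, w, hw, h0, rfl⟩
    have key : ∃ z ∈ Submodule.span k[X] (classSet φ mul), IsSymb d w z := by
      have h1 := mem_span_evenMonomials h hw h0
      clear hw h0
      induction h1 using Submodule.span_induction with
      | mem w hw =>
        obtain ⟨i, ⟨hi, rfl⟩ | ⟨hi, rfl⟩⟩ := hw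
        · rcases hi.eq_or_lt with rfl | hi
          · exact ⟨_, Submodule.subset_span (Or.inl ⟨i + 1, by simp, rfl⟩), aClass_isSymb hI i⟩
          · have h1 : vPow φ i (φ (K1.gen k .v)) ∈ nsFilt φ (d - 1) :=
              filt_mono (by omega) (aClass_isSymb hI i).mem
            have h2 := isSymb_symb (filt_mono (Nat.sub_le d 1) h1)
            exact ⟨_, by rw [h2.eq_zero_iff.2 h1]; exact Submodule.zero_mem _, h2⟩
        · rcases hi.eq_or_lt with rfl | hi
          · exact ⟨_, Submodule.subset_span (Or.inr ⟨i + 2, by simp, rfl⟩), bClass_isSymb hI i⟩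
          · have h1 : vPow φ i (eElt U.prod (φ (K1.gen k .g))) ∈ nsFilt φ (d - 1) :=
              filt_mono (by omega) (bClass_isSymb hI i).mem
            have h2 := isSymb_symb (filt_mono (Nat.sub_le d 1) h1)
            exact ⟨_, by rw [h2.eq_zero_iff.2 h1]; exact Submodule.zero_mem _, h2⟩
      | zero => exact ⟨0, Submodule.zero_mem _, IsSymb.zero d⟩
      | add w w' _ _ hw hw' =>
        obtain ⟨z, hz, hw⟩ := hw
        obtain ⟨z', hz', hw'⟩ := hw'
        exact ⟨_, Submodule.add_mem _ hz hz', hw.add hw'⟩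
      | smul c w _ hw =>
        obtain ⟨z, hz, hw⟩ := hw
        exact ⟨_, Submodule.smul_mem _ c hz, hw.smul c⟩
    obtain ⟨z, hz, hs⟩ := key
    rw [hs.unique (isSymb_symb hw)] at hz
    exact hz

variable (f : U.Hom (cendQData k)) (hφ : ∀ y, f.map (φ y) = phiQ k y)

theorem grCoordV_aClass (i : ℕ) :
    grCoordV f hφ h (aClass φ mul (i + 1)) = Finsupp.single i.succPNat 1 := by
  rw [grCoordV_isSymb f hφ h (aClass_isSymb hI i), coord_vPow_v f hφ]
  simp
  rfl

theorem grCoordV_bClass (i : ℕ) : grCoordV f hφ h (bClass φ mul (i + 2)) = 0 := by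
  rw [grCoordV_isSymb f hφ h (bClass_isSymb hI i), coord_vPow_e f hφ]
  simp

theorem grCoordE_aClass (i : ℕ) : grCoordE f hφ h (aClass φ mul (i + 1)) = 0 := by
  rw [grCoordE_isSymb f hφ h (aClass_isSymb hI i), coord_vPow_v f hφ]
  simp

theorem grCoordE_bClass (i : ℕ) :
    grCoordE f hφ h (bClass φ mul (i + 2)) = Finsupp.single (i + 2) 1 := by
  rw [grCoordE_isSymb f hφ h (bClass_isSymb hI i), coord_vPow_e f hφ]
  simp

include f hφ in
theorem linearIndependent_classes : LinearIndependent k[X]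
    (Sum.elim (fun n : {n : ℕ // 1 ≤ n} => aClass φ mul n)
      (fun m : {m : ℕ // 2 ≤ m} => bClass φ mul m)) := by
  refine LinearIndependent.of_comp ((grCoordV f hφ h).prod (grCoordE f hφ h)) ?_
  have h1 : ((grCoordV f hφ h).prod (grCoordE f hφ h)) ∘
      (Sum.elim (fun n : {n : ℕ // 1 ≤ n} => aClass φ mul n)
        (fun m : {m : ℕ // 2 ≤ m} => bClass φ mul m)) =
      Sum.elim (LinearMap.inl k[X] (ℕ+ →₀ k[X]) (ℕ →₀ k[X]) ∘
        fun n : {n : ℕ // 1 ≤ n} => Finsupp.single (Nat.toPNat n.1 n.2) (1 : k[X]))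
        (LinearMap.inr k[X] (ℕ+ →₀ k[X]) (ℕ →₀ k[X]) ∘
          fun m : {m : ℕ // 2 ≤ m} => Finsupp.single m.1 (1 : k[X])) := by
    funext x
    rcases x with ⟨n, hn⟩ | ⟨m, hm⟩
    · obtain ⟨i, rfl⟩ := Nat.exists_eq_add_of_le' hn
      exact Prod.ext (grCoordV_aClass h hI f hφ i) (grCoordE_aClass h hI f hφ i)
    · obtain ⟨i, rfl⟩ := Nat.exists_eq_add_of_le' hm
      exact Prod.ext (grCoordV_bClass h hI f hφ i) (grCoordE_bClass h hI f hφ i)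
  rw [h1]
  refine linearIndependent_inl_union_inr' ?_ ?_
  · have h2 := (Finsupp.basisSingleOne (R := k[X]) (ι := ℕ+)).linearIndependent.comp
      (fun n : {n : ℕ // 1 ≤ n} => Nat.toPNat n.1 n.2) (fun n m hnm =>
        Subtype.ext (congrArg PNat.val hnm))
    rwa [Finsupp.coe_basisSingleOne] at h2
  · have h2 := (Finsupp.basisSingleOne (R := k[X]) (ι := ℕ)).linearIndependent.comp
      (fun m : {m : ℕ // 2 ≤ m} => m.1) Subtype.val_injective
    rwa [Finsupp.coe_basisSingleOne] at h2

theorem bClass_grCoordV {z : Gr U (fun a => φ (K1.gen k a)) NSGen.loc} (hz : z ∈ bSpan φ mul) :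
    grCoordV f hφ h z = 0 := by
  have : bSpan φ mul ≤ LinearMap.ker (grCoordV f hφ h) := by
    refine Submodule.span_le.2 ?_
    rintro _ ⟨m, hm, rfl⟩
    obtain ⟨i, rfl⟩ := Nat.exists_eq_add_of_le' hm
    exact grCoordV_bClass h hI f hφ i
  exact this hz

include ac

theorem mul_bClass_bClass {n m : ℕ} (hn : 2 ≤ n) (hm : 2 ≤ m) (s : ℕ) :
    mul s (bClass φ mul n) (bClass φ mul m) = 0 := by
  rw [(isTable h ac hI).lambdaEq_mul_bb hn hm s]
  simp

theorem br_bClass_bClass {n m : ℕ} (hn : 2 ≤ n) (hm : 2 ≤ m) (s : ℕ) :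
    br s (bClass φ mul n) (bClass φ mul m) = 0 := by
  rw [(isTable h ac hI).lambdaEq_br_bb hn hm s]
  simp

theorem mul_aClass_bClass {n m : ℕ} (hn : 1 ≤ n) (hm : 2 ≤ m) (s : ℕ) :
    mul s (aClass φ mul n) (bClass φ mul m) ∈ Submodule.span k[X] {bClass φ mul (n + m)} := by
  have h1 := (isTable h ac hI).lambdaEq_mul_ab hn hm s
  rw [← one_smul k[X][X] (cst k _), coeff_smul_cst, ← smul_assoc] at h1
  rw [h1]
  exact Submodule.smul_mem _ _ (Submodule.mem_span_singleton_self _)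

theorem br_aClass_bClass {n m : ℕ} (hn : 1 ≤ n) (hm : 2 ≤ m) (s : ℕ) :
    br s (aClass φ mul n) (bClass φ mul m) ∈ Submodule.span k[X] {bClass φ mul (n + m - 1)} := by
  have h1 := (isTable h ac hI).lambdaEq_br_ab hn hm s
  rw [coeff_smul_cst, ← smul_assoc] at h1
  rw [h1]
  exact Submodule.smul_mem _ _ (Submodule.mem_span_singleton_self _)

theorem aClass_mem {n : ℕ} (hn : 1 ≤ n) :
    aClass φ mul n ∈ grParity U (fun a => φ (K1.gen k a)) NSGen.loc 0 := by
  obtain ⟨i, rfl⟩ := Nat.exists_eq_add_of_le' hn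
  exact (isTable h ac hI).a_mem i

theorem bClass_mem {n : ℕ} (hn : 2 ≤ n) :
    bClass φ mul n ∈ grParity U (fun a => φ (K1.gen k a)) NSGen.loc 0 := by
  obtain ⟨i, rfl⟩ := Nat.exists_eq_add_of_le' hn
  exact (isTable h ac hI).b_mem i

theorem mul_bClass_aClass {n m : ℕ} (hn : 1 ≤ n) (hm : 2 ≤ m) (s : ℕ) :
    mul s (bClass φ mul m) (aClass φ mul n) ∈ Submodule.span k[X] {bClass φ mul (n + m)} := by
  rw [hI.mul_comm ac s (bClass_mem h ac hI hm) (aClass_mem h ac hI hn)]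
  exact zsmul_mem (curly_mem (hI.mul_loc ac) _ (mul_aClass_bClass h ac hI hn hm) s) _

theorem br_bClass_aClass {n m : ℕ} (hn : 1 ≤ n) (hm : 2 ≤ m) (s : ℕ) :
    br s (bClass φ mul m) (aClass φ mul n) ∈ Submodule.span k[X] {bClass φ mul (n + m - 1)} := by
  rw [hI.br_skew ac s (bClass_mem h ac hI hm) (aClass_mem h ac hI hn)]
  exact neg_mem (zsmul_mem (curly_mem (hI.br_loc ac) _ (br_aClass_bClass h ac hI hn hm) s) _)

omit h ac hI in
theorem span_bClass_le {n : ℕ} (hn : 2 ≤ n) :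
    Submodule.span k[X] {bClass φ mul n} ≤ bSpan φ mul :=
  Submodule.span_mono (Set.singleton_subset_iff.2 ⟨n, hn, rfl⟩)

theorem grCoordV_mul {n : ℕ} {x y : Gr U (fun a => φ (K1.gen k a)) NSGen.loc}
    (hx : x ∈ grParity U (fun a => φ (K1.gen k a)) NSGen.loc 0)
    (hy : y ∈ grParity U (fun a => φ (K1.gen k a)) NSGen.loc 0) :
    grCoordV f hφ h (mul n x y) = (PV2 k).mul n (grCoordV f hφ h x) (grCoordV f hφ h y) := by
  rw [← span_classSet h hI] at hx hy
  refine sesq_hom_ext (M' := ℕ+ →₀ k[X]) (hI.mul_sesq ac)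
    (q := tableProd fun m n => Finsupp.single (m + n) 1) (tableProd_sesq _) (grCoordV f hφ h)
    (fun s x hx y hy => ?_) n hx hy
  rcases hx with ⟨n, hn, rfl⟩ | ⟨n, hn, rfl⟩ <;> rcases hy with ⟨m, hm, rfl⟩ | ⟨m, hm, rfl⟩ <;>
    obtain ⟨i, rfl⟩ := Nat.exists_eq_add_of_le' hn <;>
    obtain ⟨j, rfl⟩ := Nat.exists_eq_add_of_le' hm
  · have h1 := (isTable h ac hI).lambdaEq_mul_aa hn hm
    rw [← one_smul k[X][X] (cst k (aClass φ mul _))] at h1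
    rw [map_coeff_two h1, show i + 1 + (j + 1) = i + j + 1 + 1 by omega, grCoordV_aClass h hI,
      grCoordV_aClass h hI, grCoordV_aClass h hI, show i + j + 1 + 1 = i + j + 2 by omega,
      grCoordV_bClass h hI, smul_zero, add_zero]
    have h2 : (i + j + 1).succPNat = i.succPNat + j.succPNat := PNat.eq (by simp; omega)
    rw [h2]
    exact (tableProd_single_one (fun m n => Finsupp.single (m + n) 1) s rfl).symm
  · rw [bClass_grCoordV h hI f hφ (span_bClass_le (by omega)
      (mul_aClass_bClass h ac hI hn hm s)), grCoordV_bClass h hI, map_zero]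
  · rw [bClass_grCoordV h hI f hφ (span_bClass_le (by omega)
      (mul_bClass_aClass h ac hI hm hn s)), grCoordV_bClass h hI, map_zero, LinearMap.zero_apply]
  · rw [mul_bClass_bClass h ac hI hn hm, map_zero, grCoordV_bClass h hI, map_zero,
      LinearMap.zero_apply]

theorem grCoordV_br {n : ℕ} {x y : Gr U (fun a => φ (K1.gen k a)) NSGen.loc}
    (hx : x ∈ grParity U (fun a => φ (K1.gen k a)) NSGen.loc 0)
    (hy : y ∈ grParity U (fun a => φ (K1.gen k a)) NSGen.loc 0) :
    grCoordV f hφ h (br n x y) = (PV2 k).br n (grCoordV f hφ h x) (grCoordV f hφ h y) := by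
  rw [← span_classSet h hI] at hx hy
  refine sesq_hom_ext (M' := ℕ+ →₀ k[X]) (hI.br_sesq ac)
    (q := tableProd fun m n =>
      Finsupp.single (m + n - 1)
        (((m : ℕ) : k[X][X]) * dd k + (((m : ℕ) : k[X][X]) + ((n : ℕ) : k[X][X])) * ll k)) (tableProd_sesq _) (grCoordV f hφ h)
    (fun s x hx y hy => ?_) n hx hy
  rcases hx with ⟨n, hn, rfl⟩ | ⟨n, hn, rfl⟩ <;> rcases hy with ⟨m, hm, rfl⟩ | ⟨m, hm, rfl⟩ <;>
    obtain ⟨i, rfl⟩ := Nat.exists_eq_add_of_le' hn <;>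
    obtain ⟨j, rfl⟩ := Nat.exists_eq_add_of_le' hm
  · have h1 := (isTable h ac hI).lambdaEq_br_aa hn hm
    rw [map_coeff_two h1, show i + 1 + (j + 1) - 1 = i + j + 1 by omega, grCoordV_aClass h hI,
      grCoordV_aClass h hI, grCoordV_aClass h hI]
    have h3 : ((s.factorial : k) • ((1 / 4 : k) • (ll k ^ 2 + dd k * ll k) *
        ((((j + 1 : ℕ) : k[X][X]) + ((i + 1 : ℕ) : k[X][X]) - 2) * ll k +
          (((i + 1 : ℕ) : k[X][X]) - 1) * dd k)).coeff s) •
        grCoordV f hφ h (bClass φ mul (i + j + 1)) = 0 := by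
      rcases Nat.eq_zero_or_pos (i + j) with hij | hij
      · obtain ⟨rfl, rfl⟩ : i = 0 ∧ j = 0 := by omega
        have : ((((0 + 1 : ℕ) : k[X][X]) + ((0 + 1 : ℕ) : k[X][X]) - 2) * ll k +
          (((0 + 1 : ℕ) : k[X][X]) - 1) * dd k) = 0 := by
          push_cast
          ring
        rw [this, mul_zero, coeff_zero, smul_zero, zero_smul]
      · obtain ⟨l, hl⟩ := Nat.exists_eq_add_of_le' hij
        rw [hl, show l + 1 + 1 = l + 2 by omega, grCoordV_bClass h hI, smul_zero]
    rw [h3, add_zero]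
    have h2 : (i + j).succPNat = i.succPNat + j.succPNat - 1 := PNat.eq (by
      rw [PNat.sub_coe]
      split_ifs with h4
      · simp; omega
      · exact absurd (show (1 : ℕ+) < _ from PNat.coe_lt_coe _ _ |>.1 (by simp; omega)) h4)
    rw [h2, add_comm (((j + 1 : ℕ) : k[X][X])) _]
    exact (tableProd_single_one (fun m n : ℕ+ => Finsupp.single (m + n - 1)
      (((m : ℕ) : k[X][X]) * dd k + (((m : ℕ) : k[X][X]) + ((n : ℕ) : k[X][X])) * ll k)) s
      (i := i.succPNat) (j := j.succPNat) rfl).symm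
  · rw [bClass_grCoordV h hI f hφ (span_bClass_le (by omega)
      (br_aClass_bClass h ac hI hn hm s)), grCoordV_bClass h hI, map_zero]
  · rw [bClass_grCoordV h hI f hφ (span_bClass_le (by omega)
      (br_bClass_aClass h ac hI hm hn s)), grCoordV_bClass h hI, map_zero, LinearMap.zero_apply]
  · rw [br_bClass_bClass h ac hI hn hm, map_zero, grCoordV_bClass h hI, map_zero,
      LinearMap.zero_apply]

/-- The projection of the even part onto `PV_2`. -/
def toPV2 (hP : IsPoisson (grParity U (fun a => φ (K1.gen k a)) NSGen.loc) mul br) :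
    (evenPart (grParity U (fun a => φ (K1.gen k a)) NSGen.loc) mul br hP).Hom (PV2 k) where
  map := grCoordV f hφ h ∘ₗ (grParity U (fun a => φ (K1.gen k a)) NSGen.loc 0).subtype
  map_mul _ x y := grCoordV_mul h ac hI f hφ x.2 y.2
  map_br _ x y := grCoordV_br h ac hI f hφ x.2 y.2

variable (mul) in
omit h ac hI in
/-- The linear section of the projection onto `PV_2` given by the classes of `v (0)^j v`. -/
def aCombination (φ : K1 k →ₗ[k[X]] U)
    (mul : ℕ → Gr U (fun a => φ (K1.gen k a)) NSGen.loc →ₗ[k]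
    Gr U (fun a => φ (K1.gen k a)) NSGen.loc →ₗ[k] Gr U (fun a => φ (K1.gen k a)) NSGen.loc) :
    (ℕ+ →₀ k[X]) →ₗ[k[X]] Gr U (fun a => φ (K1.gen k a)) NSGen.loc :=
  Finsupp.linearCombination k[X] fun n : ℕ+ => aClass φ mul n

omit ac in
theorem grCoordV_aCombination (y : ℕ+ →₀ k[X]) :
    grCoordV f hφ h (aCombination φ mul y) = y := by
  have : grCoordV f hφ h ∘ₗ aCombination φ mul = LinearMap.id := by
    refine Finsupp.lhom_ext' fun n => LinearMap.ext_ring ?_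
    obtain ⟨i, rfl⟩ : ∃ i : ℕ, n = i.succPNat := ⟨n.natPred, (PNat.succPNat_natPred n).symm⟩
    simp only [aCombination, LinearMap.comp_apply, Finsupp.lsingle_apply,
      Finsupp.linearCombination_single, one_smul, LinearMap.id_apply]
    exact grCoordV_aClass h hI f hφ i
  exact LinearMap.congr_fun this y

theorem aCombination_mem (y : ℕ+ →₀ k[X]) :
    aCombination φ mul y ∈ grParity U (fun a => φ (K1.gen k a)) NSGen.loc 0 := by
  rw [aCombination, Finsupp.linearCombination_apply]
  exact Submodule.sum_mem _ fun n _ => Submodule.smul_mem _ _ (aClass_mem h ac hI n.2)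

omit ac in
theorem mem_bSpan {z : Gr U (fun a => φ (K1.gen k a)) NSGen.loc}
    (hz : z ∈ grParity U (fun a => φ (K1.gen k a)) NSGen.loc 0) (h0 : grCoordV f hφ h z = 0) :
    z ∈ bSpan φ mul := by
  rw [← span_classSet h hI] at hz
  have key : Submodule.span k[X] (classSet φ mul) ≤ (bSpan φ mul).comap
      (LinearMap.id - aCombination φ mul ∘ₗ grCoordV f hφ h) := by
    refine Submodule.span_le.2 ?_
    rintro _ (⟨n, hn, rfl⟩ | ⟨n, hn, rfl⟩) <;>
      obtain ⟨i, rfl⟩ := Nat.exists_eq_add_of_le' hn <;> refine Submodule.mem_comap.2 ?_ <;>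
      rw [LinearMap.sub_apply, LinearMap.id_apply, LinearMap.comp_apply]
    · rw [grCoordV_aClass h hI, aCombination, Finsupp.linearCombination_single, one_smul]
      rw [show ((i.succPNat : ℕ+) : ℕ) = i + 1 from rfl, sub_self]
      exact Submodule.zero_mem _
    · rw [grCoordV_bClass h hI, map_zero, sub_zero]
      exact Submodule.subset_span ⟨_, hn, rfl⟩
  have h1 := Submodule.mem_comap.1 (key hz)
  rwa [LinearMap.sub_apply, LinearMap.id_apply, LinearMap.comp_apply, h0, map_zero, sub_zero] at h1

theorem mul_bSpan_bSpan {x y : Gr U (fun a => φ (K1.gen k a)) NSGen.loc} (hx : x ∈ bSpan φ mul)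
    (hy : y ∈ bSpan φ mul) (n : ℕ) : mul n x y = 0 := by
  refine (Submodule.mem_bot k[X]).1 (sesq_mem (hI.mul_sesq ac) ⊥ ?_ n hx hy)
  rintro s _ ⟨n, hn, rfl⟩ _ ⟨m, hm, rfl⟩
  exact (Submodule.mem_bot k[X]).2 (mul_bClass_bClass h ac hI hn hm s)

theorem br_bSpan_bSpan {x y : Gr U (fun a => φ (K1.gen k a)) NSGen.loc} (hx : x ∈ bSpan φ mul)
    (hy : y ∈ bSpan φ mul) (n : ℕ) : br n x y = 0 := by
  refine (Submodule.mem_bot k[X]).1 (sesq_mem (hI.br_sesq ac) ⊥ ?_ n hx hy)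
  rintro s _ ⟨n, hn, rfl⟩ _ ⟨m, hm, rfl⟩
  exact (Submodule.mem_bot k[X]).2 (br_bClass_bClass h ac hI hn hm s)

theorem isNullExtension
    (hP : IsPoisson (grParity U (fun a => φ (K1.gen k a)) NSGen.loc) mul br) :
    IsNullExtension (toPV2 h ac hI f hφ hP) ((bSpan φ mul).submoduleOf
      (grParity U (fun a => φ (K1.gen k a)) NSGen.loc 0)) where
  surjective y := ⟨⟨_, aCombination_mem h ac hI y⟩, grCoordV_aCombination h hI f hφ y⟩
  ker_eq := by
    ext z
    constructor
    · intro hz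
      exact mem_bSpan h hI f hφ z.2 hz
    · intro hz
      exact bClass_grCoordV h hI f hφ hz
  mul_zero n x y hx hy := Subtype.ext (mul_bSpan_bSpan h ac hI hx hy n)
  br_zero n x y hx hy := Subtype.ext (br_bSpan_bSpan h ac hI hx hy n)

theorem not_isSplit (hP : IsPoisson (grParity U (fun a => φ (K1.gen k a)) NSGen.loc) mul br) :
    ¬ IsSplit (toPV2 h ac hI f hφ hP) := by
  rintro ⟨σ, hσ⟩
  set v : PV2 k := PV2.vpow k 1
  have hvv : (PV2 k).mul 2 v v = 0 := by
    refine (tableProd_single_one (fun m n : ℕ+ => Finsupp.single (m + n) 1) 2 rfl).trans ?_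
    rw [coeff_one]
    simp
    rfl
  set x : Gr U (fun a => φ (K1.gen k a)) NSGen.loc := (σ.map v).1
  have hxx : mul 2 x x = 0 := by
    have h1 := σ.map_mul 2 v v
    rw [hvv, map_zero] at h1
    exact (congrArg Subtype.val h1).symm
  have hx : grCoordV f hφ h x = Finsupp.single 1 1 := hσ v
  set z := x - aClass φ mul 1
  have hz : z ∈ bSpan φ mul := by
    refine mem_bSpan h hI f hφ (Submodule.sub_mem _ (σ.map v).2 (aClass_mem h ac hI le_rfl)) ?_
    rw [map_sub, hx]
    exact sub_eq_zero.2 (grCoordV_aClass h hI f hφ 0).symm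
  have hxz : x = aClass φ mul 1 + z := by simp [z]
  set W := LinearMap.ker (Finsupp.lapply 2 ∘ₗ grCoordE f hφ h)
  have hW : ∀ m, 2 ≤ m → Submodule.span k[X] {bClass φ mul (1 + m)} ≤ W := by
    intro m hm
    obtain ⟨i, rfl⟩ := Nat.exists_eq_add_of_le' hm
    rw [Submodule.span_singleton_le_iff_mem, LinearMap.mem_ker, LinearMap.comp_apply,
      show 1 + (i + 2) = i + 1 + 2 by omega, grCoordE_bClass h hI]
    exact Finsupp.single_eq_of_ne (by omega)
  have h1 : mul 2 (aClass φ mul 1) z ∈ W := by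
    refine sesq_mem (hI.mul_sesq ac) W (S := {aClass φ mul 1}) ?_ 2
      (Submodule.mem_span_singleton_self _) hz
    rintro s _ rfl _ ⟨m, hm, rfl⟩
    exact hW m hm (mul_aClass_bClass h ac hI le_rfl hm s)
  have h2 : mul 2 z (aClass φ mul 1) ∈ W := by
    refine sesq_mem (hI.mul_sesq ac) W (T := {aClass φ mul 1}) ?_ 2 hz
      (Submodule.mem_span_singleton_self _)
    rintro s _ ⟨m, hm, rfl⟩ _ rfl
    exact hW m hm (mul_bClass_aClass h ac hI le_rfl hm s)
  have h3 : mul 2 (aClass φ mul 1) (aClass φ mul 1) ∈ W := by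
    rw [hxz] at hxx
    simp only [map_add, LinearMap.add_apply, mul_bSpan_bSpan h ac hI hz hz, add_zero] at hxx
    have h4 : mul 2 (aClass φ mul 1) (aClass φ mul 1) =
        -(mul 2 z (aClass φ mul 1) + mul 2 (aClass φ mul 1) z) := by
      rw [← sub_eq_zero, ← hxx]
      abel
    rw [h4]
    exact neg_mem (add_mem h2 h1)
  have h5 := (isTable h ac hI).lambdaEq_mul_aa (n := 1) (m := 1) le_rfl le_rfl
  rw [← one_smul k[X][X] (cst k (aClass φ mul _))] at h5
  rw [LinearMap.mem_ker, LinearMap.comp_apply, map_coeff_two h5, grCoordE_aClass h hI f hφ 1,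
    grCoordE_bClass h hI f hφ 0] at h3
  have h6 : ((1 / 4 : k) • (ll k ^ 2 + dd k * ll k)).coeff 2 = C (1 / 4) := by
    rw [coeff_smul, coeff_add, ll, dd, coeff_X_pow, if_pos rfl, coeff_C_mul, coeff_X]
    simp [smul_eq_C_mul]
  rw [h6] at h3
  simp [smul_eq_C_mul] at h3

end EvenPart

section Matrices

variable {k : Type u} [Field k] [CharZero k] {U : ConfData k} {φ : K1 k →ₗ[k[X]] U}
  (f : U.Hom (cendQData k)) (hφ : ∀ y, f.map (φ y) = phiQ k y)

include hφ

theorem qVal_map_vPow (i : ℕ) (m : U) :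
    qVal k (f.map (vPow φ i m)) = (qVal k (f.map m)).map fun t => X ^ i * t := by
  induction i with
  | zero =>
    ext1 r c
    simp [vPow_zero]
  | succ i ih =>
    rw [vPow_succ, f.map_prod, map_gen_v f hφ, qVal_prod, qVal_vQ, cendProd_zero_v, ih]
    ext1 r c
    simp only [Matrix.map_apply]
    ring

theorem qVal_map_vPow_v (i : ℕ) :
    qVal k (f.map (vPow φ i (φ (K1.gen k .v)))) = aMat k (i + 1) := by
  rw [qVal_map_vPow f hφ, map_gen_v f hφ, qVal_vQ]
  refine Matrix.ext fun r c => ?_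
  rw [aMat, Cend2.mk, vMatrix, Matrix.map_apply, Nat.add_sub_cancel]
  fin_cases r <;> fin_cases c
  · exact (pow_succ _ _).symm
  · exact mul_zero _
  · exact mul_zero _
  · change (X : k[X][X]) ^ i * (X - C ((1 / 2 : k) • X)) =
      X ^ (i + 1) - C ((1 / 2 : k) • X) * X ^ i
    ring

theorem qVal_map_vPow_e (i : ℕ) :
    qVal k (f.map (vPow φ i (eElt U.prod (φ (K1.gen k .g))))) = bMat k (i + 2) := by
  rw [qVal_map_vPow f hφ, map_eElt f hφ, coe_eElt_gQ]
  refine Matrix.ext fun r c => ?_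
  rw [bMat, Cend2.mk, eMatrix, Matrix.map_apply, Nat.add_sub_cancel]
  fin_cases r <;> fin_cases c
  · exact mul_zero _
  · exact mul_zero _
  · exact mul_zero _
  · exact mul_one _

end Matrices

end

end ConfSuper

theorem mainTheorem9 (k : Type u) [Field k] [CharZero k] :
    -- the universal envelope `U(K_1; X, N)` exists
    (∃ (U : ConfSuper.ConfData k) (φ : ConfSuper.K1 k →ₗ[k[X]] U),
      ConfSuper.IsUniversalEnvelope (ConfSuper.K1 k) (ConfSuper.K1.gen k) ConfSuper.NSGen.loc U φ) ∧
    ∀ (U : ConfSuper.ConfData k) (φ : ConfSuper.K1 k →ₗ[k[X]] U),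
      ConfSuper.IsUniversalEnvelope (ConfSuper.K1 k) (ConfSuper.K1.gen k) ConfSuper.NSGen.loc U φ →
      -- `U` is identified with the conformal subalgebra `cendQ` of `Cend_2`
      ∃ Φ : U.Hom (ConfSuper.Cend2 k),
        Function.Injective Φ.map ∧
        Set.range Φ.map = ConfSuper.cendQ k ∧
        Φ.map (φ (ConfSuper.K1.gen k .v)) = ConfSuper.vMat k ∧
        Φ.map (φ (ConfSuper.K1.gen k .g)) = ConfSuper.gMat k ∧
      -- the Poisson conformal superalgebra `PK_1` on the associated graded module
      ∃ (mul br : ℕ →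
          ConfSuper.Gr U (fun a => φ (ConfSuper.K1.gen k a)) ConfSuper.NSGen.loc →ₗ[k]
          ConfSuper.Gr U (fun a => φ (ConfSuper.K1.gen k a)) ConfSuper.NSGen.loc →ₗ[k]
          ConfSuper.Gr U (fun a => φ (ConfSuper.K1.gen k a)) ConfSuper.NSGen.loc),
        ConfSuper.IsInduced U (fun a => φ (ConfSuper.K1.gen k a)) ConfSuper.NSGen.loc mul br ∧
        (∀ mul' br', ConfSuper.IsInduced U (fun a => φ (ConfSuper.K1.gen k a))
          ConfSuper.NSGen.loc mul' br' → mul' = mul ∧ br' = br) ∧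
      ∃ hP : ConfSuper.IsPoisson
          (ConfSuper.grParity U (fun a => φ (ConfSuper.K1.gen k a)) ConfSuper.NSGen.loc) mul br,
      ∃ a b : ℕ → ConfSuper.Gr U (fun a => φ (ConfSuper.K1.gen k a)) ConfSuper.NSGen.loc,
        (∀ n, 1 ≤ n → ∃ (w : U)
          (hw : w ∈ ConfSuper.filt U (fun a => φ (ConfSuper.K1.gen k a)) ConfSuper.NSGen.loc n),
          Φ.map w = ConfSuper.aMat k n ∧ a n = ConfSuper.symb U _ _ n w hw) ∧
        (∀ m, 2 ≤ m → ∃ (w : U)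
          (hw : w ∈ ConfSuper.filt U (fun a => φ (ConfSuper.K1.gen k a)) ConfSuper.NSGen.loc m),
          Φ.map w = ConfSuper.bMat k m ∧ b m = ConfSuper.symb U _ _ m w hw) ∧
        -- they freely generate the even part as an `H`-module
        LinearIndependent k[X]
          (Sum.elim (fun n : {n : ℕ // 1 ≤ n} => a n) (fun m : {m : ℕ // 2 ≤ m} => b m)) ∧
        Submodule.span k[X] (a '' {n | 1 ≤ n} ∪ b '' {m | 2 ≤ m}) =
          ConfSuper.grParity U (fun a => φ (ConfSuper.K1.gen k a)) ConfSuper.NSGen.loc 0 ∧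
        -- the multiplication table
        (∀ n m : ℕ, 1 ≤ n → 1 ≤ m → ConfSuper.LambdaEq br (a n) (a m)
          (((n : k[X][X]) * ConfSuper.dd k + ((m : k[X][X]) + n) * ConfSuper.ll k) •
              ConfSuper.cst k (a (n + m - 1)) +
            ((1 / 4 : k) • (ConfSuper.ll k ^ 2 + ConfSuper.dd k * ConfSuper.ll k) *
              (((m : k[X][X]) + n - 2) * ConfSuper.ll k + ((n : k[X][X]) - 1) * ConfSuper.dd k)) •
              ConfSuper.cst k (b (n + m - 1)))) ∧
        (∀ n m : ℕ, 1 ≤ n → 2 ≤ m → ConfSuper.LambdaEq br (a n) (b m)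
          ((((n : k[X][X]) + m - 2) * ConfSuper.ll k + (n : k[X][X]) * ConfSuper.dd k) •
            ConfSuper.cst k (b (n + m - 1)))) ∧
        (∀ n m : ℕ, 2 ≤ n → 2 ≤ m → ConfSuper.LambdaEq br (b n) (b m) 0) ∧
        (∀ n m : ℕ, 1 ≤ n → 1 ≤ m → ConfSuper.LambdaEq mul (a n) (a m)
          (ConfSuper.cst k (a (n + m)) +
            ((1 / 4 : k) • (ConfSuper.ll k ^ 2 + ConfSuper.dd k * ConfSuper.ll k)) •
              ConfSuper.cst k (b (n + m)))) ∧
        (∀ n m : ℕ, 1 ≤ n → 2 ≤ m → ConfSuper.LambdaEq mul (a n) (b m)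
          (ConfSuper.cst k (b (n + m)))) ∧
        (∀ n m : ℕ, 2 ≤ n → 2 ≤ m → ConfSuper.LambdaEq mul (b n) (b m) 0) ∧
        -- the even part is a non-split null extension of `PV_2` by the span of the `b_m`
        ∃ π : (ConfSuper.evenPart
            (ConfSuper.grParity U (fun a => φ (ConfSuper.K1.gen k a)) ConfSuper.NSGen.loc)
            mul br hP).Hom (ConfSuper.PV2 k),
          (∀ (n : ℕ+) (ha : a n ∈
            ConfSuper.grParity U (fun a => φ (ConfSuper.K1.gen k a)) ConfSuper.NSGen.loc 0),
            π.map ⟨a n, ha⟩ = ConfSuper.PV2.vpow k n) ∧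
          ConfSuper.IsNullExtension π
            ((Submodule.span k[X] (b '' {m | 2 ≤ m})).submoduleOf
              (ConfSuper.grParity U (fun a => φ (ConfSuper.K1.gen k a)) ConfSuper.NSGen.loc 0)) ∧
          ¬ ConfSuper.IsSplit π := by
  refine ⟨⟨ConfSuper.cendQData k, ConfSuper.phiQ k, ConfSuper.q_isUniversal⟩, fun U φ hU => ?_⟩
  obtain ⟨f, hf, hφ⟩ := hU.exists_iso
  have h := hU.envelope
  have hinj : Function.Injective (ConfSuper.qVal k ∘ₗ f.map) :=
    (ConfSuper.qVal_injective (k := k)).comp hf.1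
  have ac := ConfSuper.almostCommutative h (ConfSuper.qVal k ∘ₗ f.map)
    (fun n x y => congrArg (ConfSuper.qVal k) (f.map_prod n x y)) hinj
  have hI := ac.isInduced
  have hP := hI.isPoisson ac
  refine ⟨(ConfSuper.qIncl k).comp f, hinj, ?_,
    congrArg (ConfSuper.qVal k) (ConfSuper.map_gen_v f hφ),
    congrArg (ConfSuper.qVal k) (ConfSuper.map_gen_g f hφ), ac.grMul, ac.grBr, hI,
    fun mul' br' h' => hI.unique ac h', hP, ConfSuper.aClass φ ac.grMul,
    ConfSuper.bClass φ ac.grMul, fun n hn => ?_, fun m hm => ?_,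
    ConfSuper.linearIndependent_classes h hI f hφ, ConfSuper.span_classSet h hI,
    fun n m hn hm => (ConfSuper.isTable h ac hI).lambdaEq_br_aa hn hm,
    fun n m hn hm => (ConfSuper.isTable h ac hI).lambdaEq_br_ab hn hm,
    fun n m hn hm => (ConfSuper.isTable h ac hI).lambdaEq_br_bb hn hm,
    fun n m hn hm => (ConfSuper.isTable h ac hI).lambdaEq_mul_aa hn hm,
    fun n m hn hm => (ConfSuper.isTable h ac hI).lambdaEq_mul_ab hn hm,
    fun n m hn hm => (ConfSuper.isTable h ac hI).lambdaEq_mul_bb hn hm,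
    ConfSuper.toPV2 h ac hI f hφ hP, fun n ha => ?_,
    ConfSuper.isNullExtension h ac hI f hφ hP, ConfSuper.not_isSplit h ac hI f hφ hP⟩
  · rw [← ConfSuper.range_qVal]
    exact hf.2.range_comp (ConfSuper.qVal k)
  · obtain ⟨i, rfl⟩ := Nat.exists_eq_add_of_le' hn
    obtain ⟨hw, hs⟩ := ConfSuper.aClass_isSymb hI i
    exact ⟨_, hw, ConfSuper.qVal_map_vPow_v f hφ i, hs⟩
  · obtain ⟨i, rfl⟩ := Nat.exists_eq_add_of_le' hm
    obtain ⟨hw, hs⟩ := ConfSuper.bClass_isSymb hI i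
    exact ⟨_, hw, ConfSuper.qVal_map_vPow_e f hφ i, hs⟩
  · obtain ⟨i, rfl⟩ : ∃ i : ℕ, n = i.succPNat := ⟨n.natPred, (PNat.succPNat_natPred n).symm⟩
    exact ConfSuper.grCoordV_aClass h hI f hφ i
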